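/- Fix $n\in\mathbb N_0$, $\hbar\in(0,1]$, and let $\hbar\mathbb Z^n=\{\hbar m: m\in\mathbb Z^n\}$, $\mathbb T^n=\mathbb R^n/\mathbb Z^n$; write $|k|$ for the Euclidean norm of $k\in\hbar\mathbb Z^n$. For $\alpha,\beta\in\mathbb N_0^n$ let $\Delta_{\hbar,k}^{\alpha}=\prod_j\Delta_{\hbar,j}^{\alpha_j}$ with $\Delta_{\hbar,j}\tau(k)=\hbar^{-1}(\tau(k+\hbar v_j)-\tau(k))$, where $v_j$ is the $j$-th standard basis vector of $\mathbb Z^n$, and $D_{\hbar,\theta}^{(\beta)}=\prod_j \hbar^{\beta_j}\prod_{\ell=0}^{\beta_j-1}\bigl(\tfrac{1}{2\pi i}\partial_{\theta_j}-\ell\bigr)$. For real $\mu,\rho,\delta$, the class $S^\mu_{\rho,\delta}=S^\mu_{\rho,\delta}(\hbar\mathbb Z^n\times\mathbb T^n)$ consists of the functions $\sigma:\hbar\mathbb Z^n\times\mathbb T^n\to\mathbb C$ with $\sigma(k,\cdot)\in C^\infty(\mathbb T^n)$ for all $k$ and, for all $\alpha,\beta$, $|D_{\hbar,\theta}^{(\beta)}\Delta_{\hbar,k}^{\alpha}\sigma(k,\theta)|\le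 C_{\alpha,\beta}(1+|k|)^{\mu-\rho|\alpha|+\delta|\beta|}$ for all $(k,\theta)$; $S^{-\infty}=\bigcap_{\mu\in\mathbb R}S^\mu_{1,0}$. The operator $\mathrm{Op}(\sigma)$ on the space $\mathcal S(\hbar\mathbb Z^n)$ of rapidly decreasing functions is $\mathrm{Op}(\sigma)f(k)=\int_{\mathbb T^n}e^{2\pi\frac{i}{\hbar}k\cdot\theta}\sigma(k,\theta)\widehat f(\theta)\,d\theta$, where $\widehat f(\theta)=\sum_{k\in\hbar\mathbb Z^n}e^{-2\pi\frac{i}{\hbar}k\cdot\theta}f(k)$; $\sigma_A$ denotes the symbol of $A=\mathrm{Op}(\sigma_A)$. An operator $U\in\mathrm{Op}(S^\mu_{\rho,\delta})$ is elliptic (of order $\mu$) if there are $C,M>0$ with $|\sigma_U(k,\theta)|\ge C(1+|k|)^\mu$ for all $\theta\in\mathbb T^n$ and all $|k|\ge M$. For operators, $A\sim\sum_{l\ge0}A_l$ with $A_l\in\mathrm{Op}(S^{s-(\rho-\delta)l}_{\rho,\delta})$ means $A-\sum_{l<N}A_l\in\mathrm{Op}(S^{s-(\rho-\delta)N}_{\rho,\delta})$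 for every $N\in\mathbb N_0$. **Theorem.** Let $0\le\delta<\rho\le1$, $\mu\in\mathbb R$ and $U\in\mathrm{Op}(S^\mu_{\rho,\delta})$. (1) $U$ is elliptic if and only if there is $V\in\mathrm{Op}(S^{-\mu}_{\rho,\delta})$ which is a left and right parametrix of $U$, i.e. $VU-I\in\mathrm{Op}(S^{-\infty})$ and $UV-I\in\mathrm{Op}(S^{-\infty})$. (2) Let $U$ be elliptic and $U\sim\sum_{l\ge0}U_l$ with $U_l\in\mathrm{Op}(S^{\mu-(\rho-\delta)l}_{\rho,\delta})$. Then there is $M>0$ such that $\sigma_{U_0}(k,\theta)\ne0$ for all $\theta$ and all $|k|\ge M$. For any $M$ with this property there are functions $\sigma_{V_N}$ ($N\ge0$) on $\hbar\mathbb Z^n\times\mathbb T^n$, smooth in $\theta$, such that for all $\theta$ and all $|k|\ge M$ $$\sigma_{V_0}(k,\theta)=\frac1{\sigma_{U_0}(k,\theta)},\qquad \sigma_{V_N}(k,\theta)=\frac{-1}{\sigma_{U_0}(k,\theta)}\sum_{j=0}^{N-1}\sum_{l=0}^{N-j}\sum_{|\gamma|=N-j-l}\frac1{\gamma!}\bigl[D_{\hbar,\theta}^{(\gamma)}\sigma_{V_j}(k,\theta)\bigr]\Delta_{\hbar,k}^{\gamma}\sigma_{U_l}(k,\theta)\quad(N\ge1),$$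 and for every such family (whatever its values, smooth in $\theta$, at the finitely many $k$ with $|k|<M$) one has $\sigma_{V_j}\in S^{-\mu-(\rho-\delta)j}_{\rho,\delta}$ for all $j$, and, with $V_j=\mathrm{Op}(\sigma_{V_j})$, every two-sided parametrix $V\in\mathrm{Op}(S^{-\mu}_{\rho,\delta})$ of $U$ satisfies $V\sim\sum_{j\ge0}V_j$. -/

import Mathlib

open MeasureTheory
open scoped ContDiff

noncomputable section

namespace SemiclassicalLattice

/-! The lattice `ħℤⁿ` is parametrised by `m : Fin n → ℤ`, the index `m` standing for the lattice
point `k = ħ m`.  The torus `𝕋ⁿ = ℝⁿ/ℤⁿ` is Mathlib's `UnitAddTorus (Fin n)`.  The character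
`e^{2πi k·θ/ħ} = e^{2πi (m₁θ₁ + ⋯ + mₙθₙ)}` is Mathlib's `UnitAddTorus.mFourier m θ`. -/

/-- `|k| = ħ (m₁² + ⋯ + mₙ²)^{1/2}` for the lattice point `k = ħ m`. -/
def latNorm {n : ℕ} (h : ℝ) (m : Fin n → ℤ) : ℝ :=
  h * Real.sqrt (∑ j, (m j : ℝ) ^ 2)

/-- The Schwartz space `𝒮(ħℤⁿ)` of rapidly decreasing functions on the lattice. -/
def schwartz (n : ℕ) (h : ℝ) : Submodule ℂ ((Fin n → ℤ) → ℂ) where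
  carrier := {f | ∀ N : ℕ, ∃ C : ℝ, ∀ m, ‖f m‖ ≤ C * (1 + latNorm h m) ^ (-(N : ℝ))}
  zero_mem' := fun N => ⟨0, fun m => by simp⟩
  add_mem' := by
    intro f g hf hg N
    obtain ⟨C, hC⟩ := hf N
    obtain ⟨D, hD⟩ := hg N
    refine ⟨C + D, fun m => ?_⟩
    rw [add_mul]
    exact (norm_add_le _ _).trans (add_le_add (hC m) (hD m))
  smul_mem' := by
    intro c f hf N
    obtain ⟨C, hC⟩ := hf N
    refine ⟨‖c‖ * C, fun m => ?_⟩
    rw [Pi.smul_apply, norm_smul, mul_assoc]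
    exact mul_le_mul_of_nonneg_left (hC m) (norm_nonneg c)

/-- The normalised Haar measure `dθ` on `𝕋ⁿ` (total mass `1`). -/
def torusMeasure (n : ℕ) : Measure (UnitAddTorus (Fin n)) :=
  Measure.pi fun _ => AddCircle.haarAddCircle

/-- The semi-classical Fourier transform `f̂(θ) = ∑ₖ e^{-2πi k·θ/ħ} f(k)`. -/
def fourierLat {n : ℕ} (f : (Fin n → ℤ) → ℂ) (θ : UnitAddTorus (Fin n)) : ℂ :=
  ∑' m : Fin n → ℤ, UnitAddTorus.mFourier (-m) θ * f m

/-- The quantization formula `Op(σ)f(k) = ∫ e^{2πi k·θ/ħ} σ(k,θ) f̂(θ) dθ`. -/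
def opFun {n : ℕ} (σ : (Fin n → ℤ) → UnitAddTorus (Fin n) → ℂ) (f : (Fin n → ℤ) → ℂ)
    (m : Fin n → ℤ) : ℂ :=
  ∫ θ, UnitAddTorus.mFourier m θ * σ m θ * fourierLat f θ ∂(torusMeasure n)

/-- `A = Op(σ)`, as a linear operator on `𝒮(ħℤⁿ)`. -/
def IsOp {n : ℕ} {h : ℝ} (σ : (Fin n → ℤ) → UnitAddTorus (Fin n) → ℂ)
    (A : Module.End ℂ (schwartz n h)) : Prop :=
  ∀ (f : schwartz n h) (m : Fin n → ℤ),
    (A f : (Fin n → ℤ) → ℂ) m = opFun σ (f : (Fin n → ℤ) → ℂ) m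

/-- The difference operator `Δ_{ħ,j} τ(k) = (τ(k + ħ vⱼ) - τ(k)) / ħ` in the lattice variable of a
function on `ħℤⁿ × 𝕋ⁿ`. -/
def diffOp {n : ℕ} (h : ℝ) (j : Fin n) (τ : (Fin n → ℤ) → UnitAddTorus (Fin n) → ℂ) :
    (Fin n → ℤ) → UnitAddTorus (Fin n) → ℂ :=
  fun m θ => (τ (m + Pi.single j 1) θ - τ m θ) / (h : ℂ)

/-- `Δ_ħ^α = Δ_{ħ,1}^{α₁} ⋯ Δ_{ħ,n}^{αₙ}`. -/
def diffOpMulti {n : ℕ} (h : ℝ) (α : Fin n → ℕ) (τ : (Fin n → ℤ) → UnitAddTorus (Fin n) → ℂ) :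
    (Fin n → ℤ) → UnitAddTorus (Fin n) → ℂ :=
  (List.finRange n).foldr (fun j τ' => (diffOp h j)^[α j] τ') τ

/-- `g ∈ C^∞(𝕋ⁿ)`: the `ℤⁿ`-periodic lift of `g` to `ℝⁿ` is smooth. -/
def TorusSmooth {n : ℕ} (g : UnitAddTorus (Fin n) → ℂ) : Prop :=
  ContDiff ℝ ∞ fun x : Fin n → ℝ => g fun j => (x j : UnitAddCircle)

/-- The partial derivative `∂g/∂θⱼ` on the torus. -/
def torusDeriv {n : ℕ} (j : Fin n) (g : UnitAddTorus (Fin n) → ℂ) : UnitAddTorus (Fin n) → ℂ :=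
  fun θ => deriv (fun t : ℝ => g (θ + Pi.single j (t : UnitAddCircle))) 0

/-- `D_{ħ,θⱼ}^{(b)} = ħ^b ∏_{ℓ=0}^{b-1} ((1/2πi) ∂/∂θⱼ - ℓ)`. -/
def torusD {n : ℕ} (h : ℝ) (j : Fin n) : ℕ → (UnitAddTorus (Fin n) → ℂ) →
    (UnitAddTorus (Fin n) → ℂ)
  | 0, g => g
  | b + 1, g => fun θ =>
      (h : ℂ) * (1 / (2 * Real.pi * Complex.I) * torusDeriv j (torusD h j b g) θ
        - (b : ℂ) * torusD h j b g θ)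

/-- `D_{ħ,θ}^{(β)} = D_{ħ,θ₁}^{(β₁)} ⋯ D_{ħ,θₙ}^{(βₙ)}`. -/
def torusDMulti {n : ℕ} (h : ℝ) (β : Fin n → ℕ) (g : UnitAddTorus (Fin n) → ℂ) :
    UnitAddTorus (Fin n) → ℂ :=
  (List.finRange n).foldr (fun j g' => torusD h j (β j) g') g

/-- The symbol class `S^μ_{ρ,δ}(ħℤⁿ × 𝕋ⁿ)`. -/
structure IsSymbol {n : ℕ} (h μ ρ δ : ℝ) (σ : (Fin n → ℤ) → UnitAddTorus (Fin n) → ℂ) :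
    Prop where
  smooth : ∀ m, TorusSmooth (σ m)
  bound : ∀ α β : Fin n → ℕ, ∃ C > 0, ∀ (m : Fin n → ℤ) (θ : UnitAddTorus (Fin n)),
    ‖torusDMulti h β (diffOpMulti h α σ m) θ‖ ≤
      C * (1 + latNorm h m) ^ (μ - ρ * ((∑ j, α j : ℕ) : ℝ) + δ * ((∑ j, β j : ℕ) : ℝ))

/-- `S^{-∞} = ⋂_μ S^μ_{1,0}`. -/
def IsSmoothing {n : ℕ} (h : ℝ) (σ : (Fin n → ℤ) → UnitAddTorus (Fin n) → ℂ) : Prop :=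
  ∀ μ : ℝ, IsSymbol h μ 1 0 σ

/-- `Op(S^μ_{ρ,δ}(ħℤⁿ × 𝕋ⁿ))`. -/
def OpClass (n : ℕ) (h μ ρ δ : ℝ) : Set (Module.End ℂ (schwartz n h)) :=
  {A | ∃ σ, IsSymbol h μ ρ δ σ ∧ IsOp σ A}

/-- `Op(S^{-∞}(ħℤⁿ × 𝕋ⁿ))`. -/
def OpSmoothing (n : ℕ) (h : ℝ) : Set (Module.End ℂ (schwartz n h)) :=
  {A | ∃ σ, IsSmoothing h σ ∧ IsOp σ A}

/-- `|σ(k,θ)| ≥ C (1 + |k|)^μ` for all `θ` and all `|k| ≥ M`, for some `C, M > 0`. -/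
def IsEllipticSymbol {n : ℕ} (h μ : ℝ) (σ : (Fin n → ℤ) → UnitAddTorus (Fin n) → ℂ) : Prop :=
  ∃ C > 0, ∃ M > 0, ∀ m : Fin n → ℤ, M ≤ latNorm h m → ∀ θ : UnitAddTorus (Fin n),
    C * (1 + latNorm h m) ^ μ ≤ ‖σ m θ‖

/-- `U` is an operator in `Op(S^μ_{ρ,δ})` with elliptic symbol (of order `μ`). -/
def IsEllipticOp {n : ℕ} {h : ℝ} (μ ρ δ : ℝ) (U : Module.End ℂ (schwartz n h)) : Prop :=
  ∃ σ, IsSymbol h μ ρ δ σ ∧ IsOp σ U ∧ IsEllipticSymbol h μ σ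

/-- `V` is a left and right parametrix of `U`: `VU - I` and `UV - I` lie in `Op(S^{-∞})`. -/
def IsParametrix {n : ℕ} {h : ℝ} (V U : Module.End ℂ (schwartz n h)) : Prop :=
  V * U - 1 ∈ OpSmoothing n h ∧ U * V - 1 ∈ OpSmoothing n h

/-- `A ∼ ∑ₗ Aₗ` with terms of orders `s - (ρ-δ) l`: every remainder `A - ∑_{l<N} Aₗ` lies in
`Op(S_{ρ,δ}^{s-(ρ-δ)N})`. -/
def HasExpansion {n : ℕ} {h : ℝ} (s ρ δ : ℝ) (A : Module.End ℂ (schwartz n h))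
    (a : ℕ → Module.End ℂ (schwartz n h)) : Prop :=
  ∀ N : ℕ, A - ∑ l ∈ Finset.range N, a l ∈ OpClass n h (s - (ρ - δ) * N) ρ δ

/-- The family `v = (v_N)` of functions, smooth in `θ`, satisfies for `|k| ≥ M` the parametrix
recursion `v₀ = 1/u₀` and
`v_N = -(1/u₀) ∑_{j=0}^{N-1} ∑_{l=0}^{N-j} ∑_{|γ|=N-j-l} (1/γ!) (D_{ħ,θ}^{(γ)} vⱼ) Δ_{ħ,k}^γ uₗ`.
No condition other than smoothness is put on the finitely many lattice points `|k| < M`. -/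
structure IsParametrixRecursion {n : ℕ} (h M : ℝ)
    (u v : ℕ → (Fin n → ℤ) → UnitAddTorus (Fin n) → ℂ) : Prop where
  smooth : ∀ N m, TorusSmooth (v N m)
  zero : ∀ m : Fin n → ℤ, M ≤ latNorm h m → ∀ θ, v 0 m θ = 1 / u 0 m θ
  succ : ∀ N : ℕ, 1 ≤ N → ∀ m : Fin n → ℤ, M ≤ latNorm h m → ∀ θ,
    v N m θ = (-1) / u 0 m θ *
      ∑ j ∈ Finset.range N, ∑ l ∈ Finset.range (N - j + 1),
        ∑ γ ∈ Finset.piAntidiag (Finset.univ : Finset (Fin n)) (N - j - l),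
          1 / ((∏ i, (γ i).factorial : ℕ) : ℂ) *
            (torusDMulti h γ (v j m) θ * diffOpMulti h γ (u l) m θ)

end SemiclassicalLattice

end

/-! Everything is read off from the Fourier coefficients `coef (σ m) p` of a symbol in θ. With m
indexing the lattice point, Op(σ)f(m) = ∑ₚ coef(σ m)(p) f(m+p) (`hasSum_opFun`), and a symbol of
order μ has coefficients O((1+|k|)^(μ+δL) (1+|p|)^(-L)) for every L. Conversely, such decay gives
back symbol estimates with a loss of order. The loss is harmless in an asymptotic expansion: enough
further terms make the remainder small, and those terms have the right order already
(`sym_sub_sum_of_remainder`).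

The product Op(σ)Op(τ) has coefficients ∑ₚ coef(σ m)(p) coef(τ(m+p))(q-p). Newton's forward
difference formula expands τ(m+p) at m with weights binom(p,γ) ħ^|γ|, which is exactly the Fourier
multiplier of D^(γ)/γ!. This yields the expansion ∑ (1/γ!) D^(γ)σ Δ^γτ; its remainder is controlled
by splitting into |p| small and |p| large compared with 1+|k|, where δ < ρ handles the former and δ
< 1 the latter (`comp_sub_sum_sym`). In particular the symbol of a product is the product of the
symbols modulo order ρ-δ lower.

Ellipticity then gives a parametrix: 1/σ, corrected at finitely many lattice points, inverts U up to
an error of order -(ρ-δ), and a Neumann series summed asymptotically removes the error on either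
side. Conversely, UV - I smoothing forces σ_U σ_V → 1, and the upper bound on σ_V becomes a lower
bound on σ_U.

For part (2), the recursion says that the terms of total order j+l+|γ| = K in the formal composition
of ∑ v_j with ∑ u_l cancel for K ≥ 1 and give 1 for K = 0. Hence W = ∑_{j<N} V_j satisfies WU - I ∈
Op(S^(-(ρ-δ)N)) (`sum_mul_sub_one_mem`), and V - W = W(UV - I) - (WU - I)V has the required order.
Changing a smooth function at finitely many lattice points alters it by a negligible symbol, so the
values at |k| < M do not matter. -/

noncomputable section

namespace SemiclassicalLattice

section

variable {n : ℕ}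

/-! ### Smooth functions on the torus -/

/-- The quotient map `ℝⁿ → 𝕋ⁿ`. -/
def torusProj (n : ℕ) (x : Fin n → ℝ) : UnitAddTorus (Fin n) := fun j => (x j : UnitAddCircle)

/-- Smoothness is defined through periodic lifts; the quotient property brings continuity back down
to the torus. -/
lemma isOpenQuotientMap_torusProj : IsOpenQuotientMap (torusProj n) :=
  IsOpenQuotientMap.piMap fun _ => QuotientAddGroup.isOpenQuotientMap_mk

lemma torusProj_add_smul_single (x : Fin n → ℝ) (j : Fin n) (t : ℝ) :
    torusProj n (x + t • Pi.single j 1) = torusProj n x + Pi.single j (t : UnitAddCircle) := by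
  funext i
  by_cases hij : i = j
  · subst hij; simp [torusProj]
  · simp [torusProj, hij]

lemma torusSmooth_iff {g : UnitAddTorus (Fin n) → ℂ} :
    TorusSmooth g ↔ ContDiff ℝ ∞ (g ∘ torusProj n) := Iff.rfl

namespace TorusSmooth

variable {f g : UnitAddTorus (Fin n) → ℂ}

lemma continuous (hg : TorusSmooth g) : Continuous g :=
  isOpenQuotientMap_torusProj.isQuotientMap.continuous_iff.2 (ContDiff.continuous hg)

lemma hasDerivAt_line (hg : TorusSmooth g) (j : Fin n) (x : Fin n → ℝ) (t : ℝ) :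
    HasDerivAt (fun s : ℝ => g (torusProj n x + Pi.single j (s : UnitAddCircle)))
      (fderiv ℝ (g ∘ torusProj n) (x + t • Pi.single j 1) (Pi.single j 1)) t := by
  have h1 : HasFDerivAt (g ∘ torusProj n) (fderiv ℝ (g ∘ torusProj n) (x + t • Pi.single j 1))
      (x + t • Pi.single j 1) :=
    ((torusSmooth_iff.1 hg).differentiable (by simp) _).hasFDerivAt
  have h2 : HasDerivAt (fun s : ℝ => x + s • (Pi.single j 1 : Fin n → ℝ)) (Pi.single j 1) t := by
    simpa using ((hasDerivAt_id t).smul_const (Pi.single j 1 : Fin n → ℝ)).const_add x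
  have h3 := h1.comp_hasDerivAt t h2
  refine h3.congr_of_eventuallyEq (Filter.Eventually.of_forall fun s => ?_)
  simp only [Function.comp_apply, torusProj_add_smul_single]

lemma torusDeriv_torusProj (hg : TorusSmooth g) (j : Fin n) (x : Fin n → ℝ) :
    torusDeriv j g (torusProj n x) = fderiv ℝ (g ∘ torusProj n) x (Pi.single j 1) := by
  have := (hg.hasDerivAt_line j x 0).deriv
  rwa [zero_smul, add_zero] at this

lemma hasDerivAt (hg : TorusSmooth g) (j : Fin n) (θ : UnitAddTorus (Fin n)) (t : ℝ) :
    HasDerivAt (fun s : ℝ => g (θ + Pi.single j (s : UnitAddCircle)))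
      (torusDeriv j g (θ + Pi.single j (t : UnitAddCircle))) t := by
  obtain ⟨x, rfl⟩ := isOpenQuotientMap_torusProj.surjective θ
  rw [← torusProj_add_smul_single, hg.torusDeriv_torusProj]
  exact hg.hasDerivAt_line j x t

lemma hasDerivAt_zero (hg : TorusSmooth g) (j : Fin n) (θ : UnitAddTorus (Fin n)) :
    HasDerivAt (fun s : ℝ => g (θ + Pi.single j (s : UnitAddCircle))) (torusDeriv j g θ) 0 := by
  simpa using hg.hasDerivAt j θ 0

lemma torusDeriv (hg : TorusSmooth g) (j : Fin n) : TorusSmooth (torusDeriv j g) := by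
  have h : SemiclassicalLattice.torusDeriv j g ∘ torusProj n =
      fun x => fderiv ℝ (g ∘ torusProj n) x (Pi.single j 1) :=
    funext fun x => hg.torusDeriv_torusProj j x
  rw [torusSmooth_iff, h]
  exact (ContDiff.fderiv_right (m := ∞) (torusSmooth_iff.1 hg) (by simp)).clm_apply contDiff_const

protected lemma const (c : ℂ) : TorusSmooth (fun _ : UnitAddTorus (Fin n) => c) := contDiff_const

protected lemma add (hf : TorusSmooth f) (hg : TorusSmooth g) :
    TorusSmooth (fun θ => f θ + g θ) := ContDiff.add hf hg

protected lemma sub (hf : TorusSmooth f) (hg : TorusSmooth g) :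
    TorusSmooth (fun θ => f θ - g θ) := ContDiff.sub hf hg

protected lemma mul (hf : TorusSmooth f) (hg : TorusSmooth g) :
    TorusSmooth (fun θ => f θ * g θ) := ContDiff.mul hf hg

protected lemma const_mul (c : ℂ) (hf : TorusSmooth f) : TorusSmooth (fun θ => c * f θ) :=
  (TorusSmooth.const c).mul hf

protected lemma sum {ι : Type*} {s : Finset ι} {F : ι → UnitAddTorus (Fin n) → ℂ}
    (hF : ∀ i ∈ s, TorusSmooth (F i)) : TorusSmooth (fun θ => ∑ i ∈ s, F i θ) :=
  ContDiff.sum hF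

protected lemma inv (hf : TorusSmooth f) (h0 : ∀ θ, f θ ≠ 0) : TorusSmooth (fun θ => (f θ)⁻¹) :=
  ContDiff.inv hf fun _ => h0 _

end TorusSmooth

lemma torusDeriv_add {f g : UnitAddTorus (Fin n) → ℂ} (hf : TorusSmooth f) (hg : TorusSmooth g)
    (j : Fin n) : torusDeriv j (fun θ => f θ + g θ) = fun θ => torusDeriv j f θ + torusDeriv j g θ :=
  funext fun θ => ((hf.hasDerivAt_zero j θ).add (hg.hasDerivAt_zero j θ)).deriv

lemma torusDeriv_const_mul {f : UnitAddTorus (Fin n) → ℂ} (hf : TorusSmooth f) (c : ℂ)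
    (j : Fin n) : torusDeriv j (fun θ => c * f θ) = fun θ => c * torusDeriv j f θ :=
  funext fun θ => ((hf.hasDerivAt_zero j θ).const_mul c).deriv

lemma torusDeriv_mul {f g : UnitAddTorus (Fin n) → ℂ} (hf : TorusSmooth f) (hg : TorusSmooth g)
    (j : Fin n) : torusDeriv j (fun θ => f θ * g θ) =
      fun θ => torusDeriv j f θ * g θ + f θ * torusDeriv j g θ :=
  funext fun θ => by
    have := ((hf.hasDerivAt_zero j θ).mul (hg.hasDerivAt_zero j θ)).deriv
    simp only [Pi.single_zero, add_zero, AddCircle.coe_zero] at this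
    exact this

lemma torusDeriv_inv {f : UnitAddTorus (Fin n) → ℂ} (hf : TorusSmooth f) (h0 : ∀ θ, f θ ≠ 0)
    (j : Fin n) : torusDeriv j (fun θ => (f θ)⁻¹) =
      fun θ => -(torusDeriv j f θ * ((f θ)⁻¹ * (f θ)⁻¹)) :=
  funext fun θ => by
    have := ((hf.hasDerivAt_zero j θ).fun_inv (by simpa using h0 θ)).deriv
    rw [SemiclassicalLattice.torusDeriv, this]
    have := h0 θ
    simp
    field_simp

/-! ### Fourier coefficients -/

instance : IsProbabilityMeasure (torusMeasure n) :=
  inferInstanceAs (IsProbabilityMeasure (Measure.pi fun _ => AddCircle.haarAddCircle))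

instance : (torusMeasure n).IsAddHaarMeasure :=
  inferInstanceAs ((Measure.pi fun _ : Fin n =>
    (AddCircle.haarAddCircle : Measure UnitAddCircle)).IsAddHaarMeasure)

/-- The Fourier coefficient `∫ e^{-2πi p·θ} g(θ) dθ`. -/
def coef (g : UnitAddTorus (Fin n) → ℂ) (p : Fin n → ℤ) : ℂ :=
  ∫ θ, UnitAddTorus.mFourier (-p) θ * g θ ∂(torusMeasure n)

lemma integrable_of_continuous {g : UnitAddTorus (Fin n) → ℂ} (hg : Continuous g) :
    Integrable g (torusMeasure n) :=
  hg.integrable_of_hasCompactSupport (HasCompactSupport.of_compactSpace g)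

lemma norm_mFourier_apply (p : Fin n → ℤ) (θ : UnitAddTorus (Fin n)) :
    ‖UnitAddTorus.mFourier p θ‖ = 1 := by
  simp [UnitAddTorus.mFourier, fourier_apply, Circle.norm_coe]

lemma norm_coef_le {g : UnitAddTorus (Fin n) → ℂ} {C : ℝ} (hg : ∀ θ, ‖g θ‖ ≤ C)
    (p : Fin n → ℤ) : ‖coef g p‖ ≤ C := by
  have := norm_integral_le_of_norm_le_const (μ := torusMeasure n) (C := C)
    (f := fun θ => UnitAddTorus.mFourier (-p) θ * g θ)
    (Filter.Eventually.of_forall fun θ => by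
      rw [norm_mul, norm_mFourier_apply, one_mul]; exact hg θ)
  simpa [coef] using this

lemma coef_add {f g : UnitAddTorus (Fin n) → ℂ} (hf : Continuous f) (hg : Continuous g)
    (p : Fin n → ℤ) : coef (fun θ => f θ + g θ) p = coef f p + coef g p := by
  simp only [coef, mul_add]
  exact integral_add (integrable_of_continuous (by fun_prop)) (integrable_of_continuous (by fun_prop))

lemma coef_sub {f g : UnitAddTorus (Fin n) → ℂ} (hf : Continuous f) (hg : Continuous g)
    (p : Fin n → ℤ) : coef (fun θ => f θ - g θ) p = coef f p - coef g p := by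
  simp only [coef, mul_sub]
  exact integral_sub (integrable_of_continuous (by fun_prop)) (integrable_of_continuous (by fun_prop))

lemma coef_const_mul (f : UnitAddTorus (Fin n) → ℂ) (c : ℂ)
    (p : Fin n → ℤ) : coef (fun θ => c * f θ) p = c * coef f p := by
  simp only [coef, ← integral_const_mul]
  congr 1; ext θ; ring

lemma coef_zero (p : Fin n → ℤ) : coef (fun _ => 0) p = 0 := by simp [coef]

lemma coef_sum {ι : Type*} (s : Finset ι) {F : ι → UnitAddTorus (Fin n) → ℂ}
    (hF : ∀ i ∈ s, Continuous (F i)) (p : Fin n → ℤ) :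
    coef (fun θ => ∑ i ∈ s, F i θ) p = ∑ i ∈ s, coef (F i) p := by
  simp only [coef, Finset.mul_sum]
  exact integral_finsetSum _ fun i hi =>
    integrable_of_continuous ((UnitAddTorus.mFourier (-p)).continuous.mul (hF i hi))

lemma mFourier_apply_add (p : Fin n → ℤ) (θ η : UnitAddTorus (Fin n)) :
    UnitAddTorus.mFourier p (θ + η) = UnitAddTorus.mFourier p θ * UnitAddTorus.mFourier p η := by
  simp [UnitAddTorus.mFourier, fourier_apply, ← Finset.prod_mul_distrib, smul_add, AddCircle.toCircle_add]

lemma mFourier_apply_single (p : Fin n → ℤ) (j : Fin n) (t : UnitAddCircle) :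
    UnitAddTorus.mFourier p (Pi.single j t) = fourier (p j) t := by
  simp only [UnitAddTorus.mFourier, ContinuousMap.coe_mk]
  rw [Finset.prod_eq_single j]
  · simp
  · intro i _ hij; simp [hij]
  · simp

/-- Invariance of Haar measure. Differentiated in η it gives the coefficients of a derivative; at a
half-period it gives orthogonality of characters. -/
lemma coef_translate (g : UnitAddTorus (Fin n) → ℂ) (η : UnitAddTorus (Fin n)) (p : Fin n → ℤ) :
    coef (fun θ => g (θ + η)) p = UnitAddTorus.mFourier p η * coef g p := by
  have := integral_add_right_eq_self (μ := torusMeasure n)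
    (fun θ => UnitAddTorus.mFourier (-p) θ * g θ) η
  rw [coef, coef, ← this, ← integral_const_mul]
  congr 1; ext θ
  rw [mFourier_apply_add]
  have h1 : UnitAddTorus.mFourier p η * UnitAddTorus.mFourier (-p) η = 1 := by
    rw [← UnitAddTorus.mFourier_add]; simp [UnitAddTorus.mFourier_zero]
  linear_combination (-(UnitAddTorus.mFourier (-p) θ * g (θ + η))) * h1

lemma exists_norm_le_of_continuous {g : UnitAddTorus (Fin n) → ℂ} (hg : Continuous g) :
    ∃ C, ∀ θ, ‖g θ‖ ≤ C := by
  obtain ⟨C, hC⟩ := isCompact_univ.exists_bound_of_continuousOn hg.continuousOn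
  exact ⟨C, fun θ => hC θ trivial⟩

lemma hasDerivAt_integral_translate {g : UnitAddTorus (Fin n) → ℂ} (hg : TorusSmooth g)
    (j : Fin n) (p : Fin n → ℤ) :
    HasDerivAt (fun t : ℝ => ∫ θ, UnitAddTorus.mFourier (-p) θ *
        g (θ + Pi.single j (t : UnitAddCircle)) ∂(torusMeasure n))
      (∫ θ, UnitAddTorus.mFourier (-p) θ *
        torusDeriv j g (θ + Pi.single j ((0 : ℝ) : UnitAddCircle)) ∂(torusMeasure n)) 0 := by
  have hg' := (hg.torusDeriv j).continuous
  have hm := (UnitAddTorus.mFourier (-p)).continuous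
  have hcont : ∀ η, Continuous fun θ => UnitAddTorus.mFourier (-p) θ * g (θ + η) := fun η =>
    hm.mul (hg.continuous.comp (continuous_id.add continuous_const))
  have hcont' : ∀ η, Continuous fun θ => UnitAddTorus.mFourier (-p) θ * torusDeriv j g (θ + η) :=
    fun η => hm.mul (hg'.comp (continuous_id.add continuous_const))
  obtain ⟨C, hC⟩ := exists_norm_le_of_continuous hg'
  let F : ℝ → UnitAddTorus (Fin n) → ℂ := fun t θ =>
    UnitAddTorus.mFourier (-p) θ * g (θ + Pi.single j (t : UnitAddCircle))
  let F' : ℝ → UnitAddTorus (Fin n) → ℂ := fun t θ =>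
    UnitAddTorus.mFourier (-p) θ * torusDeriv j g (θ + Pi.single j (t : UnitAddCircle))
  have h1 : ∀ t, AEStronglyMeasurable (F t) (torusMeasure n) := fun t =>
    (integrable_of_continuous (hcont _)).aestronglyMeasurable
  have h2 : Integrable (F 0) (torusMeasure n) := integrable_of_continuous (hcont _)
  have h3 : AEStronglyMeasurable (F' 0) (torusMeasure n) :=
    (integrable_of_continuous (hcont' _)).aestronglyMeasurable
  have h4 : ∀ θ, ∀ t ∈ Set.univ, ‖F' t θ‖ ≤ C := fun θ t _ => by
    rw [norm_mul, norm_mFourier_apply, one_mul]; exact hC _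
  have h5 : ∀ θ, ∀ t ∈ Set.univ, HasDerivAt (fun t => F t θ) (F' t θ) t := fun θ t _ =>
    (hg.hasDerivAt j θ t).const_mul _
  exact (hasDerivAt_integral_of_dominated_loc_of_deriv_le (𝕜 := ℝ) (μ := torusMeasure n)
    (F := F) (F' := F') (x₀ := (0 : ℝ)) (s := Set.univ) (bound := fun _ => C) Filter.univ_mem
    (Filter.Eventually.of_forall h1) h2 h3 (Filter.Eventually.of_forall h4)
    (integrable_const C) (Filter.Eventually.of_forall h5)).2

/-- In place of integration by parts, the two sides of `coef_translate` are differentiated at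
translation zero: one under the integral sign, the other through the explicit character. -/
lemma coef_torusDeriv {g : UnitAddTorus (Fin n) → ℂ} (hg : TorusSmooth g) (j : Fin n)
    (p : Fin n → ℤ) : coef (torusDeriv j g) p = 2 * Real.pi * Complex.I * p j * coef g p := by
  have h1 := hasDerivAt_integral_translate hg j p
  have h2 : HasDerivAt (fun t : ℝ => fourier (p j) (t : UnitAddCircle) * coef g p)
      (2 * Real.pi * Complex.I * p j * coef g p) 0 := by
    have := (hasDerivAt_fourier (1 : ℝ) (p j) 0).mul_const (coef g p)
    simpa only [Complex.ofReal_one, div_one, AddCircle.coe_zero, fourier_eval_zero, mul_one]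
      using this
  have h3 : (fun t : ℝ => fourier (p j) (t : UnitAddCircle) * coef g p) = fun t : ℝ =>
      ∫ θ, UnitAddTorus.mFourier (-p) θ * g (θ + Pi.single j (t : UnitAddCircle))
        ∂(torusMeasure n) := by
    funext t
    rw [← mFourier_apply_single, ← coef_translate, coef]
  rw [h3] at h2
  rw [h2.unique h1, coef]
  simp only [AddCircle.coe_zero, Pi.single_zero, add_zero]

end

section

variable {n : ℕ}

/-! ### Sizes of frequencies and weights of lattice points -/

/-- `1 + |p₁| + ⋯ + |pₙ|`. -/
def siz (p : Fin n → ℤ) : ℝ := 1 + ∑ j, |(p j : ℝ)|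

/-- `1 + |k|` for the lattice point `k = ħ m`. -/
def wt (h : ℝ) (m : Fin n → ℤ) : ℝ := 1 + latNorm h m

lemma one_le_siz (p : Fin n → ℤ) : 1 ≤ siz p :=
  le_add_of_nonneg_right (Finset.sum_nonneg fun _ _ => abs_nonneg _)

lemma siz_pos (p : Fin n → ℤ) : 0 < siz p := one_pos.trans_le (one_le_siz p)

lemma siz_neg (p : Fin n → ℤ) : siz (-p) = siz p := by simp [siz]

lemma siz_add_le_add (p q : Fin n → ℤ) : siz (p + q) ≤ siz p + (siz q - 1) := by
  simp only [siz, Pi.add_apply, Int.cast_add, add_assoc, add_sub_cancel_left,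
    ← Finset.sum_add_distrib]
  gcongr
  exact abs_add_le _ _

lemma siz_add_le (p q : Fin n → ℤ) : siz (p + q) ≤ siz p * siz q := by
  nlinarith [siz_add_le_add p q, one_le_siz p, one_le_siz q]

lemma siz_single (j : Fin n) : siz (Pi.single j 1 : Fin n → ℤ) = 2 := by
  rw [siz, Finset.sum_eq_single j]
  · norm_num
  · intro i _ hij; simp [hij]
  · simp

lemma abs_apply_le_siz (p : Fin n → ℤ) (j : Fin n) : 1 + |(p j : ℝ)| ≤ siz p :=
  add_le_add le_rfl (Finset.single_le_sum (f := fun j => |(p j : ℝ)|)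
    (fun _ _ => abs_nonneg _) (Finset.mem_univ j))

lemma latNorm_eq (h : ℝ) (m : Fin n → ℤ) :
    latNorm h m = h * ‖WithLp.toLp 2 (fun j => (m j : ℝ))‖ := by
  simp [latNorm, EuclideanSpace.norm_eq]

lemma latNorm_nonneg {h : ℝ} (hh : 0 ≤ h) (m : Fin n → ℤ) : 0 ≤ latNorm h m :=
  mul_nonneg hh (Real.sqrt_nonneg _)

lemma one_le_wt {h : ℝ} (hh : 0 ≤ h) (m : Fin n → ℤ) : 1 ≤ wt h m :=
  le_add_of_nonneg_right (latNorm_nonneg hh m)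

lemma wt_pos {h : ℝ} (hh : 0 ≤ h) (m : Fin n → ℤ) : 0 < wt h m :=
  one_pos.trans_le (one_le_wt hh m)

/-- The ℓ² norm is at most the ℓ¹ norm, and ħ ≤ 1; this is what lets the weight comparisons below
hold with constant 1. -/
lemma latNorm_le_siz {h : ℝ} (hle : h ≤ 1) (p : Fin n → ℤ) :
    latNorm h p ≤ siz p - 1 := by
  have h0 : (0 : ℝ) ≤ ∑ j, |(p j : ℝ)| := Finset.sum_nonneg fun _ _ => abs_nonneg _
  have h1 : Real.sqrt (∑ j, (p j : ℝ) ^ 2) ≤ ∑ j, |(p j : ℝ)| := by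
    refine Real.sqrt_le_iff.2 ⟨h0, ?_⟩
    simpa using Finset.sum_sq_le_sq_sum_of_nonneg (s := Finset.univ) (f := fun j => |(p j : ℝ)|)
      fun _ _ => abs_nonneg _
  calc latNorm h p ≤ 1 * Real.sqrt (∑ j, (p j : ℝ) ^ 2) :=
        mul_le_mul_of_nonneg_right hle (Real.sqrt_nonneg _)
    _ ≤ siz p - 1 := by rw [one_mul, siz, add_sub_cancel_left]; exact h1

lemma wt_add_le_add {h : ℝ} (hh : 0 ≤ h) (hle : h ≤ 1) (m p : Fin n → ℤ) :
    wt h (m + p) ≤ wt h m + (siz p - 1) := by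
  have h1 : latNorm h (m + p) ≤ latNorm h m + latNorm h p := by
    simp only [latNorm_eq, ← mul_add]
    refine mul_le_mul_of_nonneg_left ?_ hh
    refine le_trans (le_of_eq ?_) (norm_add_le _ _)
    congr 1
    ext j; simp
  have := latNorm_le_siz hle p
  simp only [wt]; linarith

lemma wt_add_le {h : ℝ} (hh : 0 ≤ h) (hle : h ≤ 1) (m p : Fin n → ℤ) :
    wt h (m + p) ≤ wt h m * siz p := by
  nlinarith [wt_add_le_add hh hle m p, one_le_siz p, one_le_wt hh m]

lemma wt_le_add {h : ℝ} (hh : 0 ≤ h) (hle : h ≤ 1) (m p : Fin n → ℤ) :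
    wt h m ≤ wt h (m + p) + (siz p - 1) := by
  have := wt_add_le_add hh hle (m + p) (-p)
  rwa [add_neg_cancel_right, siz_neg] at this

lemma wt_le_mul {h : ℝ} (hh : 0 ≤ h) (hle : h ≤ 1) (m p : Fin n → ℤ) :
    wt h m ≤ wt h (m + p) * siz p := by
  have := wt_add_le hh hle (m + p) (-p)
  rwa [add_neg_cancel_right, siz_neg] at this

/-- Peetre's inequality. -/
lemma wt_add_rpow_le {h : ℝ} (hh : 0 ≤ h) (hle : h ≤ 1) (m p : Fin n → ℤ) (s : ℝ) :
    wt h (m + p) ^ s ≤ wt h m ^ s * siz p ^ |s| := by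
  have hm := wt_pos hh m
  have hmp := wt_pos hh (m + p)
  have hp := siz_pos p
  rcases le_total 0 s with hs | hs
  · rw [abs_of_nonneg hs, ← Real.mul_rpow hm.le hp.le]
    exact Real.rpow_le_rpow hmp.le (wt_add_le hh hle m p) hs
  · rw [abs_of_nonpos hs]
    have h1 : (wt h (m + p) * siz p) ^ s ≤ wt h m ^ s :=
      Real.rpow_le_rpow_of_nonpos hm (wt_le_mul hh hle m p) hs
    rw [Real.mul_rpow hmp.le hp.le] at h1
    calc wt h (m + p) ^ s = wt h (m + p) ^ s * siz p ^ s * siz p ^ (-s) := by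
          rw [mul_assoc, ← Real.rpow_add hp, add_neg_cancel, Real.rpow_zero, mul_one]
      _ ≤ _ := mul_le_mul_of_nonneg_right h1 (Real.rpow_nonneg hp.le _)

lemma finite_wt_le {h : ℝ} (hh : 0 < h) (R : ℝ) : {m : Fin n → ℤ | wt h m ≤ R}.Finite := by
  refine (Set.finite_Icc (fun _ : Fin n => -⌈R / h⌉) (fun _ => ⌈R / h⌉)).subset fun m hm => ?_
  have key : ∀ j, |m j| ≤ ⌈R / h⌉ := fun j => by
    have h1 : |(m j : ℝ)| ≤ Real.sqrt (∑ j, (m j : ℝ) ^ 2) :=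
      Real.abs_le_sqrt (Finset.single_le_sum (f := fun j => (m j : ℝ) ^ 2)
        (fun _ _ => sq_nonneg _) (Finset.mem_univ j))
    have h2 : |(m j : ℝ)| ≤ R / h := by
      rw [le_div_iff₀ hh, mul_comm]
      have : wt h m ≤ R := hm
      have h3 := mul_le_mul_of_nonneg_left h1 hh.le
      simp only [wt, latNorm] at this
      linarith
    exact_mod_cast h2.trans (Int.le_ceil _)
  exact ⟨fun j => (abs_le.1 (key j)).1, fun j => (abs_le.1 (key j)).2⟩

lemma summable_one_add_abs_sq_inv : Summable fun k : ℤ => ((1 + |(k : ℝ)|) ^ 2)⁻¹ := by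
  have h1 : Summable fun k : ℕ => ((1 + (k : ℝ)) ^ 2)⁻¹ := by
    have := (summable_nat_add_iff 1).2 (Real.summable_nat_pow_inv.2 (one_lt_two))
    simpa [add_comm] using this
  refine Summable.of_nat_of_neg ?_ ?_ <;> simpa using h1

lemma summable_prod_one_add_abs_sq_inv :
    ∀ n : ℕ, Summable fun p : Fin n → ℤ => ∏ j, ((1 + |(p j : ℝ)|) ^ 2)⁻¹
  | 0 => Summable.of_finite
  | n + 1 => by
    have h1 := summable_one_add_abs_sq_inv.mul_of_nonneg (summable_prod_one_add_abs_sq_inv n)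
      (fun _ => by positivity) (fun _ => Finset.prod_nonneg fun _ _ => by positivity)
    rw [← (Fin.consEquiv fun _ => ℤ).summable_iff]
    refine h1.congr fun x => ?_
    simp [Fin.prod_univ_succ, Fin.consEquiv, mul_comm]

/-- Each factor 1+|pⱼ| is at most `siz p`, so the sum is dominated by a product of one-dimensional
convergent sums. This is the origin of the exponent 2n spent on every summation over frequencies. -/
lemma summable_siz (n : ℕ) : Summable fun p : Fin n → ℤ => (siz p ^ (2 * n))⁻¹ := by
  refine (summable_prod_one_add_abs_sq_inv n).of_nonneg_of_le
    (fun p => inv_nonneg.2 (pow_nonneg (siz_pos p).le _)) fun p => ?_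
  rw [Finset.prod_inv_distrib]
  refine inv_anti₀ (Finset.prod_pos fun _ _ => by positivity) ?_
  calc ∏ j, (1 + |(p j : ℝ)|) ^ 2 ≤ ∏ _j : Fin n, siz p ^ 2 := by
        refine Finset.prod_le_prod (fun _ _ => by positivity) fun j _ => ?_
        gcongr
        exact abs_apply_le_siz p j
    _ = siz p ^ (2 * n) := by simp [← pow_mul, mul_comm]

/-- `∑ₚ (1 + |p|)^{-2n}` -/
def sizSum (n : ℕ) : ℝ := ∑' p : Fin n → ℤ, (siz p ^ (2 * n))⁻¹

lemma sizSum_nonneg (n : ℕ) : 0 ≤ sizSum n :=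
  tsum_nonneg fun p => inv_nonneg.2 (pow_nonneg (siz_pos p).le _)

section

variable {E : Type*} [NormedAddCommGroup E] {c : (Fin n → ℤ) → E} {C : ℝ}

lemma norm_le_of_siz_mul_le {L : ℕ} {p : Fin n → ℤ} (h : ‖c p‖ * siz p ^ L ≤ C) :
    ‖c p‖ ≤ C * (siz p ^ L)⁻¹ := by
  rw [← div_eq_mul_inv, le_div_iff₀ (pow_pos (siz_pos p) _)]; exact h

lemma summable_norm_of_siz (h : ∀ p, ‖c p‖ * siz p ^ (2 * n) ≤ C) : Summable fun p => ‖c p‖ :=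
  ((summable_siz n).mul_left C).of_nonneg_of_le (fun _ => norm_nonneg _)
    fun p => norm_le_of_siz_mul_le (h p)

lemma tsum_norm_le_of_siz (h : ∀ p, ‖c p‖ * siz p ^ (2 * n) ≤ C) :
    ∑' p, ‖c p‖ ≤ C * sizSum n := by
  rw [sizSum, ← tsum_mul_left]
  exact (summable_norm_of_siz h).tsum_le_tsum (fun p => norm_le_of_siz_mul_le (h p))
    ((summable_siz n).mul_left C)

lemma norm_tsum_le_of_siz (h : ∀ p, ‖c p‖ * siz p ^ (2 * n) ≤ C) :
    ‖∑' p, c p‖ ≤ C * sizSum n := by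
  have h1 : ‖∑' p, c p‖ ≤ ∑' p, ‖c p‖ := norm_tsum_le_tsum_norm (summable_norm_of_siz h)
  exact h1.trans (tsum_norm_le_of_siz h)

end

end

section

variable {n : ℕ}

/-! ### Fourier series of smooth functions -/

/-- Faster than polynomial decay of a family indexed by `ℤⁿ`. -/
def RapidDecay (c : (Fin n → ℤ) → ℂ) : Prop := ∀ L : ℕ, ∃ C : ℝ, ∀ p, ‖c p‖ * siz p ^ L ≤ C

lemma RapidDecay.summable_norm_mul {c : (Fin n → ℤ) → ℂ} (hc : RapidDecay c) (L : ℕ) :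
    Summable fun p => ‖c p‖ * siz p ^ L := by
  obtain ⟨C, hC⟩ := hc (L + 2 * n)
  have := summable_norm_of_siz (c := fun p => ‖c p‖ * siz p ^ L) (C := C) fun p => by
    rw [Real.norm_of_nonneg (mul_nonneg (norm_nonneg _) (pow_nonneg (siz_pos p).le _)), mul_assoc,
      ← pow_add]
    exact hC p
  exact this.of_norm

lemma RapidDecay.summable_norm {c : (Fin n → ℤ) → ℂ} (hc : RapidDecay c) :
    Summable fun p => ‖c p‖ := by simpa using hc.summable_norm_mul 0

/-- Since `siz p` is 1 plus the sum of the |pⱼ|, one more power of it is paid for by the function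
itself together with its n first derivatives. -/
lemma TorusSmooth.exists_coef_le (L : ℕ) : ∀ {g : UnitAddTorus (Fin n) → ℂ}, TorusSmooth g →
    ∃ C : ℝ, ∀ p, ‖coef g p‖ * siz p ^ L ≤ C := by
  induction L with
  | zero =>
    intro g hg
    obtain ⟨C, hC⟩ := exists_norm_le_of_continuous hg.continuous
    exact ⟨C, fun p => by simpa using norm_coef_le hC p⟩
  | succ L ih =>
    intro g hg
    obtain ⟨C, hC⟩ := ih hg
    choose D hD using fun j => ih (hg.torusDeriv j)
    refine ⟨C + ∑ j, D j, fun p => ?_⟩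
    have h1 : ∀ j, |(p j : ℝ)| * (‖coef g p‖ * siz p ^ L) ≤ D j := fun j => by
      refine le_trans ?_ (hD j p)
      rw [coef_torusDeriv hg, norm_mul, ← mul_assoc]
      gcongr
      · exact pow_nonneg (siz_pos p).le _
      · simp only [norm_mul, Complex.norm_I, Complex.norm_real, Complex.norm_ofNat,
          Complex.norm_intCast, Real.norm_eq_abs, abs_of_pos Real.pi_pos, mul_one]
        nlinarith [Real.pi_gt_three, abs_nonneg (p j : ℝ)]
    calc ‖coef g p‖ * siz p ^ (L + 1)
        = ‖coef g p‖ * siz p ^ L + ∑ j, |(p j : ℝ)| * (‖coef g p‖ * siz p ^ L) := by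
          rw [← Finset.sum_mul, pow_succ]
          nth_rewrite 2 [siz]
          ring
      _ ≤ _ := add_le_add (hC p) (Finset.sum_le_sum fun j _ => h1 j)

lemma TorusSmooth.rapidDecay {g : UnitAddTorus (Fin n) → ℂ} (hg : TorusSmooth g) :
    RapidDecay (coef g) := fun L => hg.exists_coef_le L

lemma hasSum_coef {g : UnitAddTorus (Fin n) → ℂ} (hg : Continuous g) (hs : Summable (coef g))
    (θ : UnitAddTorus (Fin n)) :
    HasSum (fun p => coef g p * UnitAddTorus.mFourier p θ) (g θ) :=
  UnitAddTorus.hasSum_mFourier_series_apply_of_summable (f := ⟨g, hg⟩) hs θ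

lemma TorusSmooth.hasSum_coef {g : UnitAddTorus (Fin n) → ℂ} (hg : TorusSmooth g)
    (θ : UnitAddTorus (Fin n)) :
    HasSum (fun p => coef g p * UnitAddTorus.mFourier p θ) (g θ) :=
  SemiclassicalLattice.hasSum_coef hg.continuous hg.rapidDecay.summable_norm.of_norm θ

lemma TorusSmooth.eq_of_coef_eq {f g : UnitAddTorus (Fin n) → ℂ} (hf : TorusSmooth f)
    (hg : TorusSmooth g) (h : ∀ p, coef f p = coef g p) : f = g :=
  funext fun θ => (hf.hasSum_coef θ).unique (by simpa [h] using hg.hasSum_coef θ)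

lemma coef_tsum {ι : Type*} [Countable ι] {F : ι → UnitAddTorus (Fin n) → ℂ} {b : ι → ℝ}
    (hF : ∀ i, Continuous (F i)) (hb : ∀ i θ, ‖F i θ‖ ≤ b i) (hs : Summable b) (p : Fin n → ℤ) :
    HasSum (fun i => coef (F i) p) (coef (fun θ => ∑' i, F i θ) p) := by
  have hm := (UnitAddTorus.mFourier (-p)).continuous
  have h1 : ∀ i, ∫ θ, ‖UnitAddTorus.mFourier (-p) θ * F i θ‖ ∂(torusMeasure n) ≤ b i := fun i => by
    calc _ ≤ ∫ _θ, b i ∂(torusMeasure n) := by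
          refine integral_mono (integrable_of_continuous (hm.mul (hF i))).norm
            (integrable_const _) fun θ => ?_
          simp only [norm_mul, norm_mFourier_apply, one_mul]
          exact hb i θ
      _ = b i := by simp
  have h2 := hasSum_integral_of_summable_integral_norm (μ := torusMeasure n)
    (F := fun i θ => UnitAddTorus.mFourier (-p) θ * F i θ)
    (fun i => integrable_of_continuous (hm.mul (hF i)))
    (hs.of_nonneg_of_le (fun i => integral_nonneg fun _ => norm_nonneg _) h1)
  simpa only [coef, tsum_mul_left] using h2

lemma coef_mFourier (k p : Fin n → ℤ) :
    coef (fun θ => UnitAddTorus.mFourier k θ) p = if k = p then 1 else 0 := by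
  split_ifs with hkp
  · subst hkp
    simp only [coef, ← UnitAddTorus.mFourier_add, neg_add_cancel, UnitAddTorus.mFourier_zero]
    simp
  · obtain ⟨j, hj⟩ : ∃ j, (k - p) j ≠ 0 := by
      by_contra! h0
      exact hkp (sub_eq_zero.1 (funext h0))
    -- Translation by half a period in a coordinate where the frequency is nonzero changes the sign
    -- of the character, so its integral equals its own negative.
    have h1 := coef_translate (fun θ => UnitAddTorus.mFourier (k - p) θ)
      (Pi.single j (((1 : ℝ) / 2 / ((k - p) j : ℤ) : ℝ) : UnitAddCircle)) 0
    have h2 : (fun θ : UnitAddTorus (Fin n) => UnitAddTorus.mFourier (k - p) (θ +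
        Pi.single j (((1 : ℝ) / 2 / ((k - p) j : ℤ) : ℝ) : UnitAddCircle))) =
        fun θ => (-1) * UnitAddTorus.mFourier (k - p) θ := by
      funext θ
      have h3 := fourier_add_half_inv_index (T := (1 : ℝ)) hj one_pos 0
      rw [zero_add, fourier_eval_zero] at h3
      rw [mFourier_apply_add, mFourier_apply_single, h3, mul_comm]
    rw [h2, coef_const_mul, UnitAddTorus.mFourier_zero] at h1
    have h4 : coef (fun θ => UnitAddTorus.mFourier (k - p) θ) 0 = 0 := by
      have : (-1 : ℂ) * coef (fun θ => UnitAddTorus.mFourier (k - p) θ) 0 =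
        coef (fun θ => UnitAddTorus.mFourier (k - p) θ) 0 := by simpa using h1
      linear_combination (-1 / 2 : ℂ) * this
    rw [← h4]
    simp only [coef, ← UnitAddTorus.mFourier_add]
    congr 1; ext θ
    congr 2; abel

/-- The Fourier series with coefficients `c`. -/
def fourierSeries (c : (Fin n → ℤ) → ℂ) (θ : UnitAddTorus (Fin n)) : ℂ :=
  ∑' p, c p * UnitAddTorus.mFourier p θ

lemma coef_fourierSeries {c : (Fin n → ℤ) → ℂ} (hc : Summable fun p => ‖c p‖) (q : Fin n → ℤ) :
    coef (fourierSeries c) q = c q := by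
  have h1 := coef_tsum (F := fun p θ => c p * UnitAddTorus.mFourier p θ) (b := fun p => ‖c p‖)
    (fun p => by fun_prop) (fun p θ => by rw [norm_mul, norm_mFourier_apply, mul_one]) hc q
  refine h1.unique ?_
  simp only [coef_const_mul, coef_mFourier]
  have h2 : (fun p => c p * if p = q then (1 : ℂ) else 0) = fun p => if p = q then c q else 0 := by
    funext p
    split_ifs with hp
    · rw [hp, mul_one]
    · rw [mul_zero]
  rw [h2]
  exact hasSum_ite_eq q (c q)

/-- The linear form `x ↦ p · x`. -/
def freqForm (p : Fin n → ℤ) : (Fin n → ℝ) →L[ℝ] ℝ :=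
  ∑ j, (p j : ℝ) • ContinuousLinearMap.proj j

lemma freqForm_apply (p : Fin n → ℤ) (x : Fin n → ℝ) : freqForm p x = ∑ j, (p j : ℝ) * x j := by
  simp [freqForm]

lemma norm_freqForm_le (p : Fin n → ℤ) : ‖freqForm p‖ ≤ siz p := by
  refine ContinuousLinearMap.opNorm_le_bound _ (siz_pos p).le fun x => ?_
  rw [freqForm_apply]
  calc ‖∑ j, (p j : ℝ) * x j‖ ≤ ∑ j, |(p j : ℝ)| * ‖x‖ :=
        norm_sum_le_of_le _ fun j _ => by
          rw [norm_mul, Real.norm_eq_abs]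
          exact mul_le_mul_of_nonneg_left (norm_le_pi_norm x j) (abs_nonneg _)
    _ ≤ siz p * ‖x‖ := by
        rw [← Finset.sum_mul, siz]
        exact mul_le_mul_of_nonneg_right (by linarith) (norm_nonneg _)

lemma mFourier_torusProj (p : Fin n → ℤ) (x : Fin n → ℝ) :
    UnitAddTorus.mFourier p (torusProj n x) =
      Complex.exp (2 * Real.pi * Complex.I * ((freqForm p x : ℝ) : ℂ)) := by
  simp only [UnitAddTorus.mFourier, ContinuousMap.coe_mk, torusProj, fourier_coe_apply,
    ← Complex.exp_sum, freqForm_apply]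
  congr 1
  push_cast
  rw [Finset.mul_sum]
  exact Finset.sum_congr rfl fun j _ => by ring

lemma iteratedDeriv_exp_ofReal (c : ℂ) (k : ℕ) :
    iteratedDeriv k (fun t : ℝ => Complex.exp (c * t)) =
      fun t : ℝ => c ^ k * Complex.exp (c * t) := by
  induction k with
  | zero => simp
  | succ k ih =>
    rw [iteratedDeriv_succ, ih]
    funext t
    have h1 : HasDerivAt (fun t : ℝ => c * (t : ℂ)) c t := by
      simpa using (Complex.ofRealCLM.hasDerivAt (x := t)).const_mul c
    rw [(h1.cexp.const_mul (c ^ k)).deriv]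
    ring

lemma contDiff_mFourier (p : Fin n → ℤ) :
    ContDiff ℝ ∞ fun x => UnitAddTorus.mFourier p (torusProj n x) := by
  simp only [mFourier_torusProj]
  have h1 : ContDiff ℝ ∞ fun x => ((freqForm p x : ℝ) : ℂ) :=
    Complex.ofRealCLM.contDiff.comp (freqForm p).contDiff
  exact (contDiff_const.mul h1).cexp

lemma norm_iteratedFDeriv_mFourier_le (p : Fin n → ℤ) (k : ℕ) (x : Fin n → ℝ) :
    ‖iteratedFDeriv ℝ k (fun x => UnitAddTorus.mFourier p (torusProj n x)) x‖ ≤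
      (2 * Real.pi) ^ k * siz p ^ k := by
  have hE : ContDiff ℝ k fun t : ℝ => Complex.exp (2 * Real.pi * Complex.I * t) :=
    (contDiff_const.mul Complex.ofRealCLM.contDiff).cexp
  have h1 : (fun x => UnitAddTorus.mFourier p (torusProj n x)) =
      (fun t : ℝ => Complex.exp (2 * Real.pi * Complex.I * t)) ∘ freqForm p :=
    funext fun x => mFourier_torusProj p x
  rw [h1, (freqForm p).iteratedFDeriv_comp_right hE x le_rfl]
  refine (ContinuousMultilinearMap.norm_compContinuousLinearMap_le _ _).trans ?_
  rw [norm_iteratedFDeriv_eq_norm_iteratedDeriv, iteratedDeriv_exp_ofReal, Finset.prod_const]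
  simp only [Finset.card_univ, Fintype.card_fin]
  refine mul_le_mul (le_of_eq ?_) (pow_le_pow_left₀ (norm_nonneg _) (norm_freqForm_le p) k)
    (pow_nonneg (norm_nonneg _) _) (by positivity)
  have h2 : ‖Complex.exp (2 * Real.pi * Complex.I * (freqForm p x : ℝ))‖ = 1 := by
    rw [← mFourier_torusProj, norm_mFourier_apply]
  rw [norm_mul, h2, norm_pow]
  simp [abs_of_pos Real.pi_pos]

/-- The k-th derivative of the p-th character is at most (2π `siz p`)^k, so the series may be
differentiated term by term. The symbol of a composition is built this way from its coefficients. -/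
lemma torusSmooth_fourierSeries {c : (Fin n → ℤ) → ℂ} (hc : RapidDecay c) :
    TorusSmooth (fourierSeries c) := by
  rw [torusSmooth_iff]
  refine contDiff_tsum (f := fun p x => c p * UnitAddTorus.mFourier p (torusProj n x))
    (v := fun k p => (2 * Real.pi) ^ k * (‖c p‖ * siz p ^ k))
    (fun p => contDiff_const.mul (contDiff_mFourier p))
    (fun k _ => (hc.summable_norm_mul k).mul_left _) fun k p x _ => ?_
  have h1 := iteratedFDeriv_const_smul_apply (𝕜 := ℝ) (i := k) (a := c p) (x := x)
    (f := fun x => UnitAddTorus.mFourier p (torusProj n x))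
    ((contDiff_mFourier p).of_le (by exact_mod_cast le_top)).contDiffAt
  change ‖iteratedFDeriv ℝ k (c p • fun x => UnitAddTorus.mFourier p (torusProj n x)) x‖ ≤ _
  rw [h1, norm_smul]
  calc _ ≤ ‖c p‖ * ((2 * Real.pi) ^ k * siz p ^ k) :=
        mul_le_mul_of_nonneg_left (norm_iteratedFDeriv_mFourier_le p k x) (norm_nonneg _)
    _ = _ := by ring

lemma coef_mFourier_mul (g : UnitAddTorus (Fin n) → ℂ) (k q : Fin n → ℤ) :
    coef (fun θ => UnitAddTorus.mFourier k θ * g θ) q = coef g (q - k) := by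
  simp only [coef, ← mul_assoc, ← UnitAddTorus.mFourier_add]
  congr 1; ext θ
  congr 3; abel

/-- The Fourier coefficients of a product are the convolution of the Fourier coefficients. -/
lemma hasSum_coef_mul {f g : UnitAddTorus (Fin n) → ℂ} (hf : TorusSmooth f) (hg : Continuous g)
    (q : Fin n → ℤ) :
    HasSum (fun p => coef f p * coef g (q - p)) (coef (fun θ => f θ * g θ) q) := by
  obtain ⟨C, hC⟩ := exists_norm_le_of_continuous hg
  have h1 := coef_tsum (F := fun p θ => coef f p * (UnitAddTorus.mFourier p θ * g θ))
    (b := fun p => ‖coef f p‖ * C) (fun p => by fun_prop) (fun p θ => by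
      rw [norm_mul, norm_mul, norm_mFourier_apply, one_mul]
      exact mul_le_mul_of_nonneg_left (hC θ) (norm_nonneg _))
    (hf.rapidDecay.summable_norm.mul_right C) q
  simp only [coef_const_mul, coef_mFourier_mul] at h1
  simpa only [← mul_assoc, tsum_mul_right, (hf.hasSum_coef _).tsum_eq] using h1

end

section

variable {n : ℕ}

/-! ### Symbol classes of finite regularity -/

/-- The range of parameters of the symbol calculus. -/
structure Admissible (h ρ δ : ℝ) : Prop where
  pos : 0 < h
  le_one : h ≤ 1
  nonneg : 0 ≤ δ
  lt : δ < ρ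
  rho_le : ρ ≤ 1

namespace Admissible

variable {h ρ δ : ℝ}

lemma rho_pos (P : Admissible h ρ δ) : 0 < ρ := P.nonneg.trans_lt P.lt

lemma delta_lt (P : Admissible h ρ δ) : δ < 1 := P.lt.trans_le P.rho_le

lemma one_le_wt (P : Admissible h ρ δ) (m : Fin n → ℤ) : 1 ≤ wt h m :=
  SemiclassicalLattice.one_le_wt P.pos.le m

lemma wt_pos (P : Admissible h ρ δ) (m : Fin n → ℤ) : 0 < wt h m :=
  SemiclassicalLattice.wt_pos P.pos.le m

lemma one_zero (P : Admissible h ρ δ) : Admissible h 1 0 :=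
  ⟨P.pos, P.le_one, le_rfl, one_pos, le_rfl⟩

end Admissible

/-- Functions on `ħℤⁿ × 𝕋ⁿ`. -/
abbrev LatFun (n : ℕ) := (Fin n → ℤ) → UnitAddTorus (Fin n) → ℂ

/-- `(ħ/2πi) ∂/∂θⱼ`. -/
def opP (h : ℝ) (j : Fin n) (g : UnitAddTorus (Fin n) → ℂ) : UnitAddTorus (Fin n) → ℂ :=
  fun θ => (h : ℂ) * (1 / (2 * Real.pi * Complex.I) * torusDeriv j g θ)

lemma TorusSmooth.opP {g : UnitAddTorus (Fin n) → ℂ} (hg : TorusSmooth g) (h : ℝ) (j : Fin n) :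
    TorusSmooth (opP h j g) := ((hg.torusDeriv j).const_mul _).const_mul _

lemma coef_opP {g : UnitAddTorus (Fin n) → ℂ} (hg : TorusSmooth g) (h : ℝ) (j : Fin n)
    (p : Fin n → ℤ) : coef (opP h j g) p = h * p j * coef g p := by
  unfold opP
  rw [coef_const_mul, coef_const_mul, coef_torusDeriv hg]
  have := Complex.two_pi_I_ne_zero
  field_simp

lemma opP_add {f g : UnitAddTorus (Fin n) → ℂ} (hf : TorusSmooth f) (hg : TorusSmooth g)
    (h : ℝ) (j : Fin n) : opP h j (f + g) = opP h j f + opP h j g := by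
  funext θ
  have := congrFun (torusDeriv_add hf hg j) θ
  change _ * (_ * torusDeriv j (fun θ => f θ + g θ) θ) = _ + _
  rw [this]; simp only [opP]; ring

lemma opP_smul {f : UnitAddTorus (Fin n) → ℂ} (hf : TorusSmooth f) (c : ℂ)
    (h : ℝ) (j : Fin n) : opP h j (c • f) = c • opP h j f := by
  funext θ
  have := congrFun (torusDeriv_const_mul hf c j) θ
  change _ * (_ * torusDeriv j (fun θ => c * f θ) θ) = c * _
  rw [this]; simp only [opP]; ring

lemma opP_mul {f g : UnitAddTorus (Fin n) → ℂ} (hf : TorusSmooth f) (hg : TorusSmooth g)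
    (h : ℝ) (j : Fin n) : opP h j (f * g) = opP h j f * g + f * opP h j g := by
  funext θ
  have := congrFun (torusDeriv_mul hf hg j) θ
  change _ * (_ * torusDeriv j (fun θ => f θ * g θ) θ) = _ * _ + _ * _
  rw [this]; simp only [opP]; ring

lemma opP_inv {f : UnitAddTorus (Fin n) → ℂ} (hf : TorusSmooth f) (h0 : ∀ θ, f θ ≠ 0)
    (h : ℝ) (j : Fin n) : opP h j f⁻¹ = (-1 : ℂ) • (opP h j f * (f⁻¹ * f⁻¹)) := by
  funext θ
  have := congrFun (torusDeriv_inv hf h0 j) θ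
  change _ * (_ * torusDeriv j (fun θ => (f θ)⁻¹) θ) = (-1) * (_ * ((f θ)⁻¹ * (f θ)⁻¹))
  rw [this]; simp only [opP]; ring

/-- Translation by the `j`-th basis vector in the lattice variable. -/
def latShift (j : Fin n) (σ : LatFun n) : LatFun n := fun m => σ (m + Pi.single j 1)

lemma diffOp_eq (h : ℝ) (j : Fin n) (σ : LatFun n) :
    diffOp h j σ = (h : ℂ)⁻¹ • (latShift j σ + (-1 : ℂ) • σ) := by
  funext m θ
  simp [diffOp, latShift]
  ring

lemma diffOp_add (h : ℝ) (j : Fin n) (σ τ : LatFun n) :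
    diffOp h j (σ + τ) = diffOp h j σ + diffOp h j τ := by
  funext m θ; simp [diffOp]; ring

lemma diffOp_smul (h : ℝ) (j : Fin n) (c : ℂ) (σ : LatFun n) :
    diffOp h j (c • σ) = c • diffOp h j σ := by
  funext m θ; simp [diffOp]; ring

lemma diffOp_mul (h : ℝ) (j : Fin n) (σ τ : LatFun n) :
    diffOp h j (σ * τ) = diffOp h j σ * τ + latShift j σ * diffOp h j τ := by
  funext m θ; simp [diffOp, latShift]; ring

lemma diffOp_inv (h : ℝ) (j : Fin n) (σ : LatFun n) (h0 : ∀ m θ, σ m θ ≠ 0) :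
    diffOp h j σ⁻¹ = (-1 : ℂ) • (diffOp h j σ * (σ⁻¹ * latShift j σ⁻¹)) := by
  funext m θ
  have h1 := h0 m θ
  have h2 := h0 (m + Pi.single j 1) θ
  simp [diffOp, latShift]
  field_simp
  ring

lemma diffOp_latShift (h : ℝ) (i j : Fin n) (σ : LatFun n) :
    diffOp h i (latShift j σ) = latShift j (diffOp h i σ) := by
  funext m θ; simp [diffOp, latShift, add_right_comm]

lemma smooth_diffOp {σ : LatFun n} (hσ : ∀ m, TorusSmooth (σ m)) (h : ℝ) (j : Fin n)
    (m : Fin n → ℤ) : TorusSmooth (diffOp h j σ m) := by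
  unfold diffOp
  simpa only [div_eq_inv_mul] using ((hσ (m + Pi.single j 1)).sub (hσ m)).const_mul (h : ℂ)⁻¹

lemma diffOp_opP {σ : LatFun n} (hσ : ∀ m, TorusSmooth (σ m)) (h : ℝ) (i j : Fin n) :
    diffOp h i (fun m => opP h j (σ m)) = fun m => opP h j (diffOp h i σ m) := by
  rw [diffOp_eq, diffOp_eq]
  funext m
  have h0 : TorusSmooth (latShift i σ m) := hσ _
  have h1 : TorusSmooth ((-1 : ℂ) • σ m) := (hσ m).const_mul _
  have h2 : TorusSmooth (latShift i σ m + (-1 : ℂ) • σ m) := h0.add h1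
  change _ = opP h j ((h : ℂ)⁻¹ • (latShift i σ m + (-1 : ℂ) • σ m))
  rw [opP_smul h2, opP_add h0 h1, opP_smul (hσ m)]
  rfl

/-- Smoothness in `θ` and a bound of order `μ`. -/
def BoundOrd (h μ : ℝ) (σ : LatFun n) : Prop :=
  (∀ m, TorusSmooth (σ m)) ∧ ∃ C, 0 ≤ C ∧ ∀ m θ, ‖σ m θ‖ ≤ C * wt h m ^ μ

/-- The symbol estimates of order `μ` for at most `k` derivatives and differences. -/
def SymOrd (h ρ δ : ℝ) : ℕ → ℝ → LatFun n → Prop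
  | 0, μ, σ => BoundOrd h μ σ
  | k + 1, μ, σ => BoundOrd h μ σ ∧ ∀ j, SymOrd h ρ δ k (μ + δ) (fun m => opP h j (σ m)) ∧
      SymOrd h ρ δ k (μ - ρ) (diffOp h j σ)

variable {h ρ δ : ℝ}

namespace BoundOrd

variable {a b : ℝ} {σ τ : LatFun n}

lemma mono (P : Admissible h ρ δ) (hab : a ≤ b) (hσ : BoundOrd h a σ) : BoundOrd h b σ := by
  obtain ⟨hs, C, hC, hb⟩ := hσ
  exact ⟨hs, C, hC, fun m θ => (hb m θ).trans (mul_le_mul_of_nonneg_left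
    (Real.rpow_le_rpow_of_exponent_le (P.one_le_wt m) hab) hC)⟩

lemma add (hσ : BoundOrd h a σ) (hτ : BoundOrd h a τ) : BoundOrd h a (σ + τ) := by
  obtain ⟨hs, C, hC, hb⟩ := hσ
  obtain ⟨hs', C', hC', hb'⟩ := hτ
  refine ⟨fun m => (hs m).add (hs' m), C + C', add_nonneg hC hC', fun m θ => ?_⟩
  rw [add_mul]
  exact (norm_add_le _ _).trans (add_le_add (hb m θ) (hb' m θ))

lemma smul (c : ℂ) (hσ : BoundOrd h a σ) : BoundOrd h a (c • σ) := by
  obtain ⟨hs, C, hC, hb⟩ := hσ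
  refine ⟨fun m => (hs m).const_mul c, ‖c‖ * C, by positivity, fun m θ => ?_⟩
  rw [Pi.smul_apply, Pi.smul_apply, norm_smul, mul_assoc]
  exact mul_le_mul_of_nonneg_left (hb m θ) (norm_nonneg _)

lemma mul (P : Admissible h ρ δ) (hσ : BoundOrd h a σ) (hτ : BoundOrd h b τ) :
    BoundOrd h (a + b) (σ * τ) := by
  obtain ⟨hs, C, hC, hb⟩ := hσ
  obtain ⟨hs', C', hC', hb'⟩ := hτ
  refine ⟨fun m => (hs m).mul (hs' m), C * C', mul_nonneg hC hC', fun m θ => ?_⟩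
  rw [Pi.mul_apply, Pi.mul_apply, norm_mul, Real.rpow_add (P.wt_pos m)]
  calc _ ≤ (C * wt h m ^ a) * (C' * wt h m ^ b) :=
        mul_le_mul (hb m θ) (hb' m θ) (norm_nonneg _)
          (mul_nonneg hC (Real.rpow_nonneg (P.wt_pos m).le _))
    _ = _ := by ring

lemma latShift (P : Admissible h ρ δ) (j : Fin n) (hσ : BoundOrd h a σ) :
    BoundOrd h a (latShift j σ) := by
  obtain ⟨hs, C, hC, hb⟩ := hσ
  refine ⟨fun m => hs _, C * 2 ^ |a|, by positivity, fun m θ => (hb _ θ).trans ?_⟩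
  have := wt_add_rpow_le P.pos.le P.le_one m (Pi.single j 1) a
  rw [siz_single] at this
  calc _ ≤ C * (wt h m ^ a * 2 ^ |a|) := mul_le_mul_of_nonneg_left this hC
    _ = _ := by ring

end BoundOrd

namespace SymOrd

variable {a b : ℝ} {σ τ : LatFun n} {k : ℕ}

lemma boundOrd (hσ : SymOrd h ρ δ k a σ) : BoundOrd h a σ := by
  cases k with
  | zero => exact hσ
  | succ k => exact hσ.1

lemma smooth (hσ : SymOrd h ρ δ k a σ) (m : Fin n → ℤ) : TorusSmooth (σ m) := hσ.boundOrd.1 m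

lemma of_succ : ∀ {k : ℕ} {a : ℝ} {σ : LatFun n}, SymOrd h ρ δ (k + 1) a σ → SymOrd h ρ δ k a σ
  | 0, _, _, hσ => hσ.1
  | _ + 1, _, _, hσ => ⟨hσ.1, fun j => ⟨of_succ (hσ.2 j).1, of_succ (hσ.2 j).2⟩⟩

lemma mono (P : Admissible h ρ δ) : ∀ {k : ℕ} {a b : ℝ} {σ : LatFun n}, a ≤ b →
    SymOrd h ρ δ k a σ → SymOrd h ρ δ k b σ
  | 0, _, _, _, hab, hσ => BoundOrd.mono P hab hσ
  | _ + 1, _, _, _, hab, hσ => ⟨hσ.1.mono P hab, fun j =>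
      ⟨mono P (by linarith) (hσ.2 j).1, mono P (by linarith) (hσ.2 j).2⟩⟩

lemma add : ∀ {k : ℕ} {a : ℝ} {σ τ : LatFun n},
    SymOrd h ρ δ k a σ → SymOrd h ρ δ k a τ → SymOrd h ρ δ k a (σ + τ)
  | 0, _, _, _, hσ, hτ => BoundOrd.add hσ hτ
  | _ + 1, _, σ, τ, hσ, hτ => by
    refine ⟨hσ.1.add hτ.1, fun j => ⟨?_, ?_⟩⟩
    · have : (fun m => opP h j ((σ + τ) m)) =
          (fun m => opP h j (σ m)) + fun m => opP h j (τ m) :=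
        funext fun m => opP_add (hσ.smooth m) (hτ.smooth m) h j
      rw [this]
      exact add (hσ.2 j).1 (hτ.2 j).1
    · rw [diffOp_add]
      exact add (hσ.2 j).2 (hτ.2 j).2

lemma smul (c : ℂ) : ∀ {k : ℕ} {a : ℝ} {σ : LatFun n},
    SymOrd h ρ δ k a σ → SymOrd h ρ δ k a (c • σ)
  | 0, _, _, hσ => BoundOrd.smul c hσ
  | _ + 1, _, σ, hσ => by
    refine ⟨hσ.1.smul c, fun j => ⟨?_, ?_⟩⟩
    · have : (fun m => opP h j ((c • σ) m)) = c • fun m => opP h j (σ m) :=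
        funext fun m => opP_smul (hσ.smooth m) c h j
      rw [this]
      exact smul c (hσ.2 j).1
    · rw [diffOp_smul]
      exact smul c (hσ.2 j).2

lemma shift (P : Admissible h ρ δ) (i : Fin n) : ∀ {k : ℕ} {a : ℝ} {σ : LatFun n},
    SymOrd h ρ δ k a σ → SymOrd h ρ δ k a (latShift i σ)
  | 0, _, _, hσ => BoundOrd.latShift P i hσ
  | _ + 1, _, σ, hσ => by
    refine ⟨hσ.1.latShift P i, fun j => ⟨shift P i (hσ.2 j).1, ?_⟩⟩
    rw [diffOp_latShift]
    exact shift P i (hσ.2 j).2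

/-- Both basic operators obey a Leibniz rule (twisted by a shift for the difference), so induction
on the number of operations replaces multi-index Leibniz formulas. -/
lemma mul (P : Admissible h ρ δ) : ∀ {k : ℕ} {a b : ℝ} {σ τ : LatFun n},
    SymOrd h ρ δ k a σ → SymOrd h ρ δ k b τ → SymOrd h ρ δ k (a + b) (σ * τ)
  | 0, _, _, _, _, hσ, hτ => BoundOrd.mul P hσ hτ
  | _ + 1, a, b, σ, τ, hσ, hτ => by
    refine ⟨hσ.1.mul P hτ.1, fun j => ⟨?_, ?_⟩⟩
    · have : (fun m => opP h j ((σ * τ) m)) =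
          (fun m => opP h j (σ m)) * τ + σ * fun m => opP h j (τ m) :=
        funext fun m => opP_mul (hσ.smooth m) (hτ.smooth m) h j
      rw [this]
      exact add ((mul P (hσ.2 j).1 hτ.of_succ).mono P (by linarith))
        ((mul P hσ.of_succ (hτ.2 j).1).mono P (by linarith))
    · rw [diffOp_mul]
      exact add ((mul P (hσ.2 j).2 hτ.of_succ).mono P (by linarith))
        ((mul P (hσ.of_succ.shift P j) (hτ.2 j).2).mono P (by linarith))

/-- One operation applied to 1/σ gives that operation on σ times two (possibly shifted) factors 1/σ,
to which the estimates with one operation fewer apply; the orders add up as (a+δ)-2a and (a-ρ)-2a.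
-/
lemma inv (P : Admissible h ρ δ) {c : ℝ} (hc : 0 < c) (hlow : ∀ m θ, c * wt h m ^ a ≤ ‖σ m θ‖) :
    ∀ {k : ℕ}, SymOrd h ρ δ k a σ → SymOrd h ρ δ k (-a) σ⁻¹ := by
  have h0 : ∀ m θ, σ m θ ≠ 0 := fun m θ => norm_pos_iff.1
    ((mul_pos hc (Real.rpow_pos_of_pos (P.wt_pos m) a)).trans_le (hlow m θ))
  have hb : (∀ m, TorusSmooth (σ m)) → BoundOrd h (-a) σ⁻¹ := fun hs =>
    ⟨fun m => (hs m).inv (h0 m), c⁻¹, inv_nonneg.2 hc.le, fun m θ => by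
      rw [Pi.inv_apply, Pi.inv_apply, norm_inv, Real.rpow_neg (P.wt_pos m).le, ← mul_inv]
      exact inv_anti₀ (mul_pos hc (Real.rpow_pos_of_pos (P.wt_pos m) a)) (hlow m θ)⟩
  intro k
  induction k with
  | zero => exact fun hσ => hb hσ.smooth
  | succ k ih =>
    intro hσ
    have hi := ih hσ.of_succ
    refine ⟨hb hσ.smooth, fun j => ⟨?_, ?_⟩⟩
    · have : (fun m => opP h j (σ⁻¹ m)) =
          (-1 : ℂ) • ((fun m => opP h j (σ m)) * (σ⁻¹ * σ⁻¹)) :=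
        funext fun m => opP_inv (hσ.smooth m) (h0 m) h j
      rw [this]
      exact ((mul P (hσ.2 j).1 (mul P hi hi)).smul _).mono P (by linarith)
    · rw [diffOp_inv h j σ h0]
      exact ((mul P (hσ.2 j).2 (mul P hi (hi.shift P j))).smul _).mono P (by linarith)

end SymOrd

/-- The symbol estimates of order `μ` for all derivatives and differences. -/
def Sym (h ρ δ μ : ℝ) (σ : LatFun n) : Prop := ∀ k, SymOrd h ρ δ k μ σ

namespace Sym

variable {a b : ℝ} {σ τ : LatFun n}

lemma smooth (hσ : Sym h ρ δ a σ) (m : Fin n → ℤ) : TorusSmooth (σ m) := (hσ 0).smooth m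

lemma mono (P : Admissible h ρ δ) (hab : a ≤ b) (hσ : Sym h ρ δ a σ) : Sym h ρ δ b σ :=
  fun k => (hσ k).mono P hab

lemma add (hσ : Sym h ρ δ a σ) (hτ : Sym h ρ δ a τ) : Sym h ρ δ a (σ + τ) :=
  fun k => (hσ k).add (hτ k)

lemma smul (c : ℂ) (hσ : Sym h ρ δ a σ) : Sym h ρ δ a (c • σ) := fun k => (hσ k).smul c

lemma neg (hσ : Sym h ρ δ a σ) : Sym h ρ δ a (-σ) := by simpa using hσ.smul (-1)

lemma sub (hσ : Sym h ρ δ a σ) (hτ : Sym h ρ δ a τ) : Sym h ρ δ a (σ - τ) := by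
  rw [sub_eq_add_neg]; exact hσ.add hτ.neg

lemma mul (P : Admissible h ρ δ) (hσ : Sym h ρ δ a σ) (hτ : Sym h ρ δ b τ) :
    Sym h ρ δ (a + b) (σ * τ) := fun k => (hσ k).mul P (hτ k)

lemma inv (P : Admissible h ρ δ) {c : ℝ} (hc : 0 < c) (hlow : ∀ m θ, c * wt h m ^ a ≤ ‖σ m θ‖)
    (hσ : Sym h ρ δ a σ) : Sym h ρ δ (-a) σ⁻¹ := fun k => (hσ k).inv P hc hlow

lemma opP (hσ : Sym h ρ δ a σ) (j : Fin n) : Sym h ρ δ (a + δ) (fun m => opP h j (σ m)) :=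
  fun k => ((hσ (k + 1)).2 j).1

lemma diffOp (hσ : Sym h ρ δ a σ) (j : Fin n) : Sym h ρ δ (a - ρ) (diffOp h j σ) :=
  fun k => ((hσ (k + 1)).2 j).2

lemma zero (a : ℝ) : Sym h ρ δ a (0 : LatFun n) := by
  intro k
  induction k generalizing a with
  | zero => exact ⟨fun _ => TorusSmooth.const 0, 0, le_rfl, fun m θ => by simp⟩
  | succ k ih =>
    refine ⟨⟨fun _ => TorusSmooth.const 0, 0, le_rfl, fun m θ => by simp⟩, fun j => ⟨?_, ?_⟩⟩
    · have : (fun m : Fin n → ℤ => SemiclassicalLattice.opP h j ((0 : LatFun n) m)) = 0 := by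
        funext m θ
        simp [SemiclassicalLattice.opP, torusDeriv]
      rw [this]; exact ih _
    · have : SemiclassicalLattice.diffOp h j (0 : LatFun n) = 0 := by
        funext m θ; simp [SemiclassicalLattice.diffOp]
      rw [this]; exact ih _

lemma sum {ι : Type*} {s : Finset ι} {F : ι → LatFun n} (hF : ∀ i ∈ s, Sym h ρ δ a (F i)) :
    Sym h ρ δ a (∑ i ∈ s, F i) := by
  classical
  induction s using Finset.induction_on with
  | empty => simpa using zero a
  | insert i s hi ih =>
    rw [Finset.sum_insert hi]
    exact (hF i (Finset.mem_insert_self _ _)).add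
      (ih fun j hj => hF j (Finset.mem_insert_of_mem hj))

end Sym

end

section

variable {n : ℕ} {h ρ δ : ℝ}

/-! ### Multi-index differences and derivatives -/

/-- The multi-index `α + eⱼ`. -/
def incr (j : Fin n) (α : Fin n → ℕ) : Fin n → ℕ := α + Pi.single j 1

lemma incr_self (j : Fin n) (α : Fin n → ℕ) : incr j α j = α j + 1 := by simp [incr]

lemma incr_of_ne {i j : Fin n} (hij : i ≠ j) (α : Fin n → ℕ) : incr j α i = α i := by
  simp [incr, hij]

lemma prod_incr {M : Type*} [CommMonoid M] (F : Fin n → ℕ → M) (j : Fin n) (α : Fin n → ℕ) :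
    ∏ i, F i (incr j α i) = F j (α j + 1) * ∏ i ∈ {j}ᶜ, F i (α i) := by
  rw [Fintype.prod_eq_mul_prod_compl j, incr_self]
  congr 1
  exact Finset.prod_congr rfl fun i hi => by rw [incr_of_ne (by simpa using hi)]

lemma sum_incr (j : Fin n) (α : Fin n → ℕ) : ∑ i, incr j α i = ∑ i, α i + 1 := by
  simp [incr, Finset.sum_add_distrib]

/-- Suitable choices of `R` give, from one induction, commutation with a single difference,
commutation with `opP`, and preservation of smoothness. -/
lemma diffOpMulti_induction {R : LatFun n → LatFun n → Prop}
    (hR : ∀ i σ τ, R σ τ → R (diffOp h i σ) (diffOp h i τ)) (α : Fin n → ℕ) {σ τ : LatFun n}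
    (hστ : R σ τ) : R (diffOpMulti h α σ) (diffOpMulti h α τ) := by
  have hit : ∀ i k σ τ, R σ τ → R ((diffOp h i)^[k] σ) ((diffOp h i)^[k] τ) := by
    intro i k
    induction k with
    | zero => exact fun _ _ h0 => h0
    | succ k ih =>
      intro σ τ h0
      rw [Function.iterate_succ_apply', Function.iterate_succ_apply']
      exact hR _ _ _ (ih _ _ h0)
  unfold diffOpMulti
  induction List.finRange n with
  | nil => exact hστ
  | cons i l ih => exact hit _ _ _ _ ih

lemma diffOp_comm (h : ℝ) (i j : Fin n) (σ : LatFun n) :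
    diffOp h i (diffOp h j σ) = diffOp h j (diffOp h i σ) := by
  funext m θ
  simp only [diffOp, add_right_comm m (Pi.single i 1) (Pi.single j 1)]
  ring

lemma diffOp_diffOpMulti (h : ℝ) (j : Fin n) (α : Fin n → ℕ) (σ : LatFun n) :
    diffOpMulti h α (diffOp h j σ) = diffOp h j (diffOpMulti h α σ) :=
  diffOpMulti_induction (R := fun σ τ => τ = diffOp h j σ)
    (fun i σ τ hτ => by rw [hτ, diffOp_comm]) α rfl

lemma iterate_diffOp_comm (h : ℝ) (i j : Fin n) (k : ℕ) (σ : LatFun n) :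
    (diffOp h i)^[k] (diffOp h j σ) = diffOp h j ((diffOp h i)^[k] σ) :=
  (Function.Commute.iterate_left (fun τ => diffOp_comm h i j τ) k) σ

lemma diffOpMulti_add_single (h : ℝ) (j : Fin n) (α : Fin n → ℕ) (σ : LatFun n) :
    diffOpMulti h (incr j α) σ = diffOp h j (diffOpMulti h α σ) := by
  -- In a list without repetition the extra difference enters exactly once, at j, and then commutes
  -- outwards past the remaining factors.
  have key : ∀ l : List (Fin n), l.Nodup →
      l.foldr (fun i τ => (diffOp h i)^[(incr j α) i] τ) σ =
        if j ∈ l then diffOp h j (l.foldr (fun i τ => (diffOp h i)^[α i] τ) σ)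
        else l.foldr (fun i τ => (diffOp h i)^[α i] τ) σ := by
    intro l hl
    induction l with
    | nil => simp
    | cons i l ih =>
      obtain ⟨hi, hl⟩ := List.nodup_cons.1 hl
      rw [List.foldr_cons, List.foldr_cons, ih hl]
      by_cases hij : j = i
      · subst hij
        simp only [hi, if_false, List.mem_cons, true_or, if_true, incr_self,
          Function.iterate_succ_apply']
      · have h1 : incr j α i = α i := incr_of_ne (Ne.symm hij) α
        rw [h1]
        by_cases hjl : j ∈ l
        · simp only [hjl, if_true, List.mem_cons, or_true, iterate_diffOp_comm]
        · simp only [hjl, if_false, List.mem_cons, hij, or_false]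
  exact (key (List.finRange n) (List.nodup_finRange n)).trans (if_pos (List.mem_finRange j))

lemma diffOpMulti_zero (h : ℝ) (σ : LatFun n) : diffOpMulti h 0 σ = σ := by
  unfold diffOpMulti
  induction List.finRange n with
  | nil => rfl
  | cons i l ih => simp

lemma smooth_diffOpMulti {σ : LatFun n} (hσ : ∀ m, TorusSmooth (σ m)) (α : Fin n → ℕ) :
    ∀ m, TorusSmooth (diffOpMulti h α σ m) :=
  diffOpMulti_induction (R := fun σ _ => ∀ m, TorusSmooth (σ m))
    (fun i _ _ hs m => smooth_diffOp hs h i m) α (τ := σ) hσ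

lemma diffOpMulti_opP {σ : LatFun n} (hσ : ∀ m, TorusSmooth (σ m)) (j : Fin n) (α : Fin n → ℕ) :
    diffOpMulti h α (fun m => opP h j (σ m)) = fun m => opP h j (diffOpMulti h α σ m) :=
  (diffOpMulti_induction
    (R := fun σ τ => (∀ m, TorusSmooth (σ m)) ∧ τ = fun m => opP h j (σ m))
    (fun i _ _ ⟨hs, hτ⟩ => ⟨smooth_diffOp hs h i, by rw [hτ, diffOp_opP hs]⟩) α ⟨hσ, rfl⟩).2

lemma torusD_succ (h : ℝ) (j : Fin n) (b : ℕ) (g : UnitAddTorus (Fin n) → ℂ) :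
    torusD h j (b + 1) g = opP h j (torusD h j b g) + (-(h * b : ℂ)) • torusD h j b g := by
  funext θ
  simp only [torusD, opP, Pi.add_apply, Pi.smul_apply, smul_eq_mul]
  ring

lemma TorusSmooth.torusD {g : UnitAddTorus (Fin n) → ℂ} (hg : TorusSmooth g) (h : ℝ) (j : Fin n) :
    ∀ b, TorusSmooth (torusD h j b g)
  | 0 => hg
  | b + 1 => by
    rw [torusD_succ]
    exact ((hg.torusD h j b).opP h j).add ((hg.torusD h j b).const_mul _)

lemma coef_torusD {g : UnitAddTorus (Fin n) → ℂ} (hg : TorusSmooth g) (h : ℝ) (j : Fin n)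
    (p : Fin n → ℤ) (b : ℕ) :
    coef (torusD h j b g) p = (h ^ b * ∏ l ∈ Finset.range b, ((p j : ℂ) - l)) * coef g p := by
  induction b with
  | zero => simp [torusD]
  | succ b ih =>
    have h1 := hg.torusD h j b
    have h2 : coef (opP h j (torusD h j b g) + (-(h * b : ℂ)) • torusD h j b g) p =
        coef (opP h j (torusD h j b g)) p + -(h * b : ℂ) * coef (torusD h j b g) p := by
      rw [← coef_const_mul]
      exact coef_add (h1.opP h j).continuous (h1.const_mul _).continuous p
    rw [torusD_succ, h2, coef_opP h1, ih, Finset.prod_range_succ]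
    ring

lemma TorusSmooth.torusDMulti {g : UnitAddTorus (Fin n) → ℂ} (hg : TorusSmooth g) (h : ℝ)
    (β : Fin n → ℕ) : TorusSmooth (torusDMulti h β g) := by
  unfold SemiclassicalLattice.torusDMulti
  induction List.finRange n with
  | nil => exact hg
  | cons i l ih => exact ih.torusD h i _

/-- The falling factorials are the numerators of the Newton binomials; this match produces D^(γ)/γ!
in the composition formula. -/
lemma coef_torusDMulti {g : UnitAddTorus (Fin n) → ℂ} (hg : TorusSmooth g) (h : ℝ)
    (β : Fin n → ℕ) (p : Fin n → ℤ) :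
    coef (torusDMulti h β g) p =
      (∏ j, (h ^ β j * ∏ l ∈ Finset.range (β j), ((p j : ℂ) - l))) * coef g p := by
  rw [Fin.prod_univ_def]
  unfold SemiclassicalLattice.torusDMulti
  suffices ∀ l : List (Fin n), TorusSmooth (l.foldr (fun j g' => SemiclassicalLattice.torusD h j (β j) g') g) ∧
      coef (l.foldr (fun j g' => SemiclassicalLattice.torusD h j (β j) g') g) p =
      (l.map fun j => (h ^ β j * ∏ l ∈ Finset.range (β j), ((p j : ℂ) - l))).prod * coef g p from
    (this _).2
  intro l
  induction l with
  | nil => simpa using hg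
  | cons i l ih =>
    refine ⟨ih.1.torusD h i _, ?_⟩
    rw [List.foldr_cons, coef_torusD ih.1, ih.2, List.map_cons, List.prod_cons]
    ring

/-- On the frequency side this is pⱼ = (pⱼ - βⱼ) + βⱼ. -/
lemma torusDMulti_opP {g : UnitAddTorus (Fin n) → ℂ} (hg : TorusSmooth g) (h : ℝ)
    (β : Fin n → ℕ) (j : Fin n) :
    torusDMulti h β (opP h j g) =
      torusDMulti h (incr j β) g + (h * β j : ℂ) • torusDMulti h β g := by
  have h1 := hg.torusDMulti h (incr j β)
  have h2 := hg.torusDMulti h β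
  refine ((hg.opP h j).torusDMulti h β).eq_of_coef_eq (h1.add (h2.const_mul _)) fun p => ?_
  have h3 : coef (torusDMulti h (incr j β) g + (h * β j : ℂ) • torusDMulti h β g) p = coef (torusDMulti h (incr j β) g) p +
      (h * β j : ℂ) * coef (torusDMulti h β g) p := by
    rw [← coef_const_mul]
    exact coef_add h1.continuous (h2.const_mul _).continuous p
  rw [h3, coef_torusDMulti (hg.opP h j), coef_opP hg, coef_torusDMulti hg, coef_torusDMulti hg,
    prod_incr (fun i b => (h ^ b * ∏ l ∈ Finset.range b, ((p i : ℂ) - l) : ℂ)),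
    Fintype.prod_eq_mul_prod_compl j]
  simp only [Finset.prod_range_succ]
  ring

/-! ### Comparison of the two descriptions of the symbol classes -/

namespace IsSymbol

variable {μ : ℝ} {σ : LatFun n}

lemma diffOp (hσ : IsSymbol h μ ρ δ σ) (j : Fin n) : IsSymbol h (μ - ρ) ρ δ (diffOp h j σ) := by
  refine ⟨smooth_diffOp hσ.smooth h j, fun α β => ?_⟩
  obtain ⟨C, hC, hb⟩ := hσ.bound (incr j α) β
  refine ⟨C, hC, fun m θ => ?_⟩
  rw [diffOp_diffOpMulti, ← diffOpMulti_add_single]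
  refine (hb m θ).trans (le_of_eq ?_)
  rw [sum_incr]
  push_cast
  ring_nf

lemma opP (P : Admissible h ρ δ) (hσ : IsSymbol h μ ρ δ σ) (j : Fin n) :
    IsSymbol h (μ + δ) ρ δ (fun m => opP h j (σ m)) := by
  refine ⟨fun m => (hσ.smooth m).opP h j, fun α β => ?_⟩
  obtain ⟨C, hC, hb⟩ := hσ.bound α (incr j β)
  obtain ⟨D, hD, hb'⟩ := hσ.bound α β
  refine ⟨C + h * β j * D, by have := P.pos; positivity, fun m θ => ?_⟩
  rw [diffOpMulti_opP hσ.smooth, torusDMulti_opP (smooth_diffOpMulti hσ.smooth α m), add_mul]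
  refine (norm_add_le _ _).trans (add_le_add ((hb m θ).trans (le_of_eq ?_)) ?_)
  · rw [sum_incr]
    push_cast
    ring_nf
  · have h1 : ‖(h * β j : ℂ)‖ = h * β j := by
      simp [abs_of_pos P.pos]
    rw [Pi.smul_apply, norm_smul, h1, mul_assoc _ D]
    refine mul_le_mul_of_nonneg_left ((hb' m θ).trans (mul_le_mul_of_nonneg_left
      (Real.rpow_le_rpow_of_exponent_le (P.one_le_wt m) ?_) hD.le))
      (mul_nonneg P.pos.le (Nat.cast_nonneg _))
    -- The correction term carries one derivative fewer; δ ≥ 0 makes it admissible at the higher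
    -- order.
    linarith [P.nonneg]

lemma symOrd (P : Admissible h ρ δ) (k : ℕ) : ∀ {μ : ℝ} {σ : LatFun n}, IsSymbol h μ ρ δ σ →
    SymOrd h ρ δ k μ σ := by
  have h0 : ∀ {μ : ℝ} {σ : LatFun n}, IsSymbol h μ ρ δ σ → BoundOrd h μ σ := fun {μ σ} hσ => by
    obtain ⟨C, hC, hb⟩ := hσ.bound 0 0
    refine ⟨hσ.smooth, C, hC.le, fun m θ => ?_⟩
    have h1 : torusDMulti h 0 (σ m) = σ m := by
      refine ((hσ.smooth m).torusDMulti h 0).eq_of_coef_eq (hσ.smooth m) fun p => ?_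
      simp [coef_torusDMulti (hσ.smooth m)]
    simpa [diffOpMulti_zero, h1, wt] using hb m θ
  induction k with
  | zero => exact h0
  | succ k ih => exact fun hσ => ⟨h0 hσ, fun j => ⟨ih (hσ.opP P j), ih (hσ.diffOp j)⟩⟩

lemma sym (P : Admissible h ρ δ) (hσ : IsSymbol h μ ρ δ σ) : Sym h ρ δ μ σ :=
  fun k => hσ.symOrd P k

end IsSymbol

namespace Sym

variable {a : ℝ} {σ : LatFun n}

lemma iterate_diffOp (j : Fin n) : ∀ (k : ℕ) {a : ℝ} {σ : LatFun n}, Sym h ρ δ a σ →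
    Sym h ρ δ (a - ρ * k) ((SemiclassicalLattice.diffOp h j)^[k] σ)
  | 0, _, _, hσ => by simpa using hσ
  | k + 1, a, σ, hσ => by
    rw [Function.iterate_succ_apply']
    convert! (iterate_diffOp j k hσ).diffOp j using 1
    push_cast; ring

lemma diffOpMulti (hσ : Sym h ρ δ a σ) (α : Fin n → ℕ) :
    Sym h ρ δ (a - ρ * ((∑ j, α j : ℕ) : ℝ)) (diffOpMulti h α σ) := by
  rw [Fin.sum_univ_def]
  unfold SemiclassicalLattice.diffOpMulti
  induction List.finRange n with
  | nil => simpa using hσ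
  | cons i l ih =>
    rw [List.map_cons, List.sum_cons, List.foldr_cons]
    convert! ih.iterate_diffOp i (α i) using 1
    push_cast; ring

lemma torusD (P : Admissible h ρ δ) (hσ : Sym h ρ δ a σ) (j : Fin n) :
    ∀ b : ℕ, Sym h ρ δ (a + δ * b) (fun m => torusD h j b (σ m))
  | 0 => by simpa [SemiclassicalLattice.torusD] using hσ
  | b + 1 => by
    have h1 : (fun m => SemiclassicalLattice.torusD h j (b + 1) (σ m)) =
        (fun m => SemiclassicalLattice.opP h j (SemiclassicalLattice.torusD h j b (σ m))) +
        (-(h * b : ℂ)) • fun m => SemiclassicalLattice.torusD h j b (σ m) :=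
      funext fun m => torusD_succ h j b (σ m)
    rw [h1]
    have h2 := hσ.torusD P j b
    have := P.nonneg
    refine ((h2.opP j).mono P ?_).add ((h2.smul _).mono P ?_)
    all_goals push_cast; nlinarith

lemma torusDMulti (P : Admissible h ρ δ) (hσ : Sym h ρ δ a σ) (β : Fin n → ℕ) :
    Sym h ρ δ (a + δ * ((∑ j, β j : ℕ) : ℝ)) (fun m => torusDMulti h β (σ m)) := by
  rw [Fin.sum_univ_def]
  unfold SemiclassicalLattice.torusDMulti
  induction List.finRange n with
  | nil => simpa using hσ
  | cons i l ih =>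
    simp only [List.map_cons, List.sum_cons, List.foldr_cons]
    convert! ih.torusD P i (β i) using 1
    push_cast; ring

lemma isSymbol (P : Admissible h ρ δ) (hσ : Sym h ρ δ a σ) : IsSymbol h a ρ δ σ := by
  refine ⟨hσ.smooth, fun α β => ?_⟩
  obtain ⟨-, C, hC, hb⟩ := ((hσ.diffOpMulti α).torusDMulti P β 0).boundOrd
  refine ⟨C + 1, by positivity, fun m θ => (hb m θ).trans ?_⟩
  exact mul_le_mul_of_nonneg_right (by linarith) (Real.rpow_nonneg (P.wt_pos m).le _)

end Sym

lemma isSymbol_iff_sym (P : Admissible h ρ δ) {μ : ℝ} {σ : LatFun n} :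
    IsSymbol h μ ρ δ σ ↔ Sym h ρ δ μ σ := ⟨fun hσ => hσ.sym P, fun hσ => hσ.isSymbol P⟩

end

section

variable {n : ℕ} {h ρ δ : ℝ}

/-! ### Fourier coefficients of symbols -/

/-- Each power of `siz p` costs one θ-derivative, hence a factor (1+|k|)^δ. The constant depends on
ħ through the factors ħ⁻¹. -/
lemma SymOrd.exists_coef_le (P : Admissible h ρ δ) (L : ℕ) : ∀ {μ : ℝ} {σ : LatFun n},
    SymOrd h ρ δ L μ σ →
    ∃ C, 0 ≤ C ∧ ∀ m p, ‖coef (σ m) p‖ * siz p ^ L ≤ C * wt h m ^ (μ + δ * L) := by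
  induction L with
  | zero =>
    intro μ σ hσ
    obtain ⟨-, C, hC, hb⟩ := hσ.boundOrd
    exact ⟨C, hC, fun m p => by simpa using norm_coef_le (hb m) p⟩
  | succ L ih =>
    intro μ σ hσ
    obtain ⟨C, hC, hb⟩ := ih hσ.of_succ
    choose D hD hb' using fun j => ih (hσ.2 j).1
    have hh := P.pos
    refine ⟨C + ∑ j, h⁻¹ * D j, add_nonneg hC (Finset.sum_nonneg fun j _ =>
      mul_nonneg (inv_nonneg.2 hh.le) (hD j)), fun m p => ?_⟩
    have hw : wt h m ^ (μ + δ * L) ≤ wt h m ^ (μ + δ * (L + 1 : ℕ)) :=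
      Real.rpow_le_rpow_of_exponent_le (P.one_le_wt m) (by push_cast; linarith [P.nonneg])
    have h1 : ∀ j, |(p j : ℝ)| * (‖coef (σ m) p‖ * siz p ^ L) ≤
        h⁻¹ * D j * wt h m ^ (μ + δ * (L + 1 : ℕ)) := fun j => by
      have := hb' j m p
      rw [coef_opP (hσ.smooth m), norm_mul, norm_mul, Complex.norm_real, Complex.norm_intCast,
        Real.norm_of_nonneg hh.le, show μ + δ + δ * L = μ + δ * (L + 1 : ℕ) by push_cast; ring]
        at this
      rw [mul_assoc, le_inv_mul_iff₀ hh]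
      linarith
    calc ‖coef (σ m) p‖ * siz p ^ (L + 1)
        = ‖coef (σ m) p‖ * siz p ^ L + ∑ j, |(p j : ℝ)| * (‖coef (σ m) p‖ * siz p ^ L) := by
          rw [← Finset.sum_mul, pow_succ]
          nth_rewrite 2 [siz]
          ring
      _ ≤ _ := by
          rw [add_mul, Finset.sum_mul]
          exact add_le_add ((hb m p).trans (mul_le_mul_of_nonneg_left hw hC))
            (Finset.sum_le_sum fun j _ => h1 j)

lemma Sym.exists_coef_le (P : Admissible h ρ δ) {μ : ℝ} {σ : LatFun n} (hσ : Sym h ρ δ μ σ)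
    (L : ℕ) : ∃ C, 0 ≤ C ∧ ∀ m p, ‖coef (σ m) p‖ * siz p ^ L ≤ C * wt h m ^ (μ + δ * L) :=
  (hσ L).exists_coef_le P L

lemma mul_siz_pow_mono {x : ℝ} (hx : 0 ≤ x) (p : Fin n → ℤ) {k l : ℕ} (hkl : k ≤ l) :
    x * siz p ^ k ≤ x * siz p ^ l :=
  mul_le_mul_of_nonneg_left (pow_le_pow_right₀ (one_le_siz p) hkl) hx

lemma coef_diffOp {σ : LatFun n} (hσ : ∀ m, TorusSmooth (σ m)) (j : Fin n) (m p : Fin n → ℤ) :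
    coef (diffOp h j σ m) p = (h : ℂ)⁻¹ * (coef (σ (m + Pi.single j 1)) p - coef (σ m) p) := by
  have h1 : diffOp h j σ m = fun θ => (h : ℂ)⁻¹ * (σ (m + Pi.single j 1) θ - σ m θ) := by
    funext θ; rw [diffOp, div_eq_inv_mul]
  rw [h1, coef_const_mul, coef_sub (hσ _).continuous (hσ _).continuous]

/-- Decay of the Fourier coefficients implies symbol estimates. -/
lemma SymOrd.of_coef_le (P : Admissible h ρ δ) (k : ℕ) : ∀ {s C μ : ℝ} {σ : LatFun n},
    (∀ m, TorusSmooth (σ m)) →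
    (∀ m p, ‖coef (σ m) p‖ * siz p ^ (k + 2 * n) ≤ C * wt h m ^ s) → s + k * ρ ≤ μ →
    SymOrd h ρ δ k μ σ := by
  have h0 : ∀ {k : ℕ} {s C μ : ℝ} {σ : LatFun n}, (∀ m, TorusSmooth (σ m)) →
      (∀ m p, ‖coef (σ m) p‖ * siz p ^ (k + 2 * n) ≤ C * wt h m ^ s) → s + k * ρ ≤ μ →
      BoundOrd h μ σ := fun {k s C μ σ} hs hb hμ => by
    refine ⟨hs, |C| * sizSum n, mul_nonneg (abs_nonneg _) (sizSum_nonneg n), fun m θ => ?_⟩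
    rw [← ((hs m).hasSum_coef θ).tsum_eq]
    have h1 : ∀ p, ‖coef (σ m) p * UnitAddTorus.mFourier p θ‖ * siz p ^ (2 * n) ≤
        C * wt h m ^ s := fun p => by
      rw [norm_mul, norm_mFourier_apply, mul_one]
      exact (mul_siz_pow_mono (norm_nonneg _) p (by lia)).trans (hb m p)
    refine (norm_tsum_le_of_siz h1).trans ?_
    have h2 : wt h m ^ s ≤ wt h m ^ μ := Real.rpow_le_rpow_of_exponent_le (P.one_le_wt m)
      (by nlinarith [P.rho_pos, (Nat.cast_nonneg k : (0 : ℝ) ≤ k)])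
    have h3 : C * wt h m ^ s ≤ |C| * wt h m ^ μ :=
      mul_le_mul (le_abs_self C) h2 (Real.rpow_nonneg (P.wt_pos m).le _) (abs_nonneg _)
    calc _ ≤ |C| * wt h m ^ μ * sizSum n := mul_le_mul_of_nonneg_right h3 (sizSum_nonneg n)
      _ = _ := by ring
  have hh := P.pos
  induction k with
  | zero => exact fun hs hb hμ => h0 hs hb hμ
  | succ k ih =>
    intro s C μ σ hs hb hμ
    refine ⟨h0 hs hb hμ, fun j => ⟨?_, ?_⟩⟩
    · refine ih (s := s) (C := C) (fun m => (hs m).opP h j) (fun m p => ?_) ?_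
      · refine le_trans ?_ (hb m p)
        rw [coef_opP (hs m), norm_mul, norm_mul, Complex.norm_real, Complex.norm_intCast,
          Real.norm_of_nonneg hh.le]
        have h1 : h * |(p j : ℝ)| ≤ siz p := by
          nlinarith [abs_apply_le_siz p j, P.le_one, abs_nonneg (p j : ℝ)]
        calc h * |(p j : ℝ)| * ‖coef (σ m) p‖ * siz p ^ (k + 2 * n)
            ≤ siz p * ‖coef (σ m) p‖ * siz p ^ (k + 2 * n) := by
              have := siz_pos p
              gcongr
          _ = _ := by ring
      · have := P.rho_pos
        have := P.nonneg
        push_cast at hμ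
        linarith
    -- The difference is not used to gain order: its two values are bounded separately by Peetre's
    -- inequality, and the missing ρ is paid from the slack in s + kρ ≤ μ.
    · refine ih (s := s) (C := h⁻¹ * (|C| * 2 ^ |s| + |C|)) (smooth_diffOp hs h j)
        (fun m p => ?_) ?_
      · have h1 : ∀ m, ‖coef (σ m) p‖ * siz p ^ (k + 2 * n) ≤ |C| * wt h m ^ s := fun m =>
          ((mul_siz_pow_mono (norm_nonneg _) p (by lia)).trans (hb m p)).trans
            (mul_le_mul_of_nonneg_right (le_abs_self C) (Real.rpow_nonneg (P.wt_pos m).le _))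
        have h2 := wt_add_rpow_le P.pos.le P.le_one m (Pi.single j 1) s
        rw [siz_single] at h2
        have h3 := mul_le_mul_of_nonneg_left h2 (abs_nonneg C)
        rw [coef_diffOp hs, norm_mul, norm_inv, Complex.norm_real, Real.norm_of_nonneg hh.le]
        have h4 : ‖coef (σ (m + Pi.single j 1)) p - coef (σ m) p‖ * siz p ^ (k + 2 * n) ≤
            (|C| * 2 ^ |s| + |C|) * wt h m ^ s := by
          calc _ ≤ (‖coef (σ (m + Pi.single j 1)) p‖ + ‖coef (σ m) p‖) * siz p ^ (k + 2 * n) :=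
                mul_le_mul_of_nonneg_right (norm_sub_le _ _) (pow_nonneg (siz_pos p).le _)
            _ ≤ _ := by linarith [h1 m, h1 (m + Pi.single j 1)]
        calc _ = h⁻¹ * (‖coef (σ (m + Pi.single j 1)) p - coef (σ m) p‖ *
              siz p ^ (k + 2 * n)) := by ring
          _ ≤ h⁻¹ * ((|C| * 2 ^ |s| + |C|) * wt h m ^ s) :=
              mul_le_mul_of_nonneg_left h4 (inv_nonneg.2 hh.le)
          _ = _ := by ring
      · push_cast at hμ
        linarith

/-- Bounds for large lattice points extend to all lattice points. -/
lemma exists_coef_le_of_large (hh : 0 < h) {σ : LatFun n} (hσ : ∀ m, TorusSmooth (σ m)) {L : ℕ}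
    {s R C : ℝ} (hb : ∀ m, R < wt h m → ∀ p, ‖coef (σ m) p‖ * siz p ^ L ≤ C * wt h m ^ s) :
    ∃ C', ∀ m p, ‖coef (σ m) p‖ * siz p ^ L ≤ C' * wt h m ^ s := by
  choose D hD using fun m => (hσ m).exists_coef_le L
  set F := (finite_wt_le (n := n) hh R).toFinset
  have hpos : ∀ m : Fin n → ℤ, 0 < wt h m ^ s := fun m => Real.rpow_pos_of_pos (wt_pos hh.le m) s
  have hterm : ∀ m, 0 ≤ |D m| / wt h m ^ s := fun m => div_nonneg (abs_nonneg _) (hpos m).le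
  -- Each of the finitely many small lattice points contributes its own constant, normalised by its
  -- weight.
  refine ⟨|C| + ∑ m ∈ F, |D m| / wt h m ^ s, fun m p => ?_⟩
  by_cases hm : R < wt h m
  · refine (hb m hm p).trans (mul_le_mul_of_nonneg_right ?_ (hpos m).le)
    linarith [le_abs_self C, Finset.sum_nonneg fun m (_ : m ∈ F) => hterm m]
  · have hmF : m ∈ F := by simpa [F] using hm
    have h1 := Finset.single_le_sum (fun m _ => hterm m) hmF
    refine ((hD m p).trans (le_abs_self _)).trans ?_
    rw [← div_le_iff₀ (hpos m)]
    linarith [abs_nonneg C]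

/-! ### Negligible symbols and asymptotic summation. -/

/-- Functions whose Fourier coefficients decay rapidly in both variables. -/
def Negligible (h : ℝ) (σ : LatFun n) : Prop :=
  (∀ m, TorusSmooth (σ m)) ∧ ∀ T L : ℕ, ∃ C, ∀ m p,
    ‖coef (σ m) p‖ * siz p ^ L ≤ C * wt h m ^ (-(T : ℝ))

lemma Negligible.sym (P : Admissible h ρ δ) {σ : LatFun n} (hσ : Negligible h σ) (μ : ℝ) :
    Sym h ρ δ μ σ := fun k => by
  obtain ⟨T, hT⟩ := exists_nat_ge (k * ρ - μ)
  obtain ⟨C, hC⟩ := hσ.2 T (k + 2 * n)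
  exact SymOrd.of_coef_le P k hσ.1 hC (by linarith)

lemma negligible_of_sym (P : Admissible h ρ δ) {σ : LatFun n} (hσ : ∀ μ, Sym h ρ δ μ σ) :
    Negligible h σ := by
  refine ⟨(hσ 0).smooth, fun T L => ?_⟩
  obtain ⟨C, -, hC⟩ := (hσ (-T - δ * L)).exists_coef_le P L
  exact ⟨C, fun m p => by simpa using hC m p⟩

/-- The right side involves neither ρ nor δ: smoothing symbols are the same for all admissible
types. -/
lemma isSmoothing_iff (P : Admissible h ρ δ) {σ : LatFun n} :
    IsSmoothing h σ ↔ Negligible h σ :=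
  ⟨fun hσ => negligible_of_sym P.one_zero fun μ => (hσ μ).sym P.one_zero,
    fun hσ μ => (hσ.sym P.one_zero μ).isSymbol P.one_zero⟩

lemma negligible_of_eq_zero (hh : 0 < h) {σ : LatFun n} (hσ : ∀ m, TorusSmooth (σ m)) {R : ℝ}
    (h0 : ∀ m, R < wt h m → ∀ θ, σ m θ = 0) : Negligible h σ :=
  ⟨hσ, fun T L => exists_coef_le_of_large hh hσ (C := 0) fun m hm p => by
    have : σ m = fun _ => 0 := funext (h0 m hm)
    rw [this, coef_zero]; simp⟩

lemma smooth_sub {σ τ : LatFun n} (hσ : ∀ m, TorusSmooth (σ m)) (hτ : ∀ m, TorusSmooth (τ m))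
    (m : Fin n → ℤ) : TorusSmooth ((σ - τ) m) := (hσ m).sub (hτ m)

lemma smooth_add {σ τ : LatFun n} (hσ : ∀ m, TorusSmooth (σ m)) (hτ : ∀ m, TorusSmooth (τ m))
    (m : Fin n → ℤ) : TorusSmooth ((σ + τ) m) := (hσ m).add (hτ m)

lemma smooth_sum {ι : Type*} {s : Finset ι} {F : ι → LatFun n}
    (hF : ∀ i ∈ s, ∀ m, TorusSmooth (F i m)) (m : Fin n → ℤ) :
    TorusSmooth ((∑ i ∈ s, F i) m) := by
  have h1 : (∑ i ∈ s, F i) m = fun θ => ∑ i ∈ s, F i m θ := by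
    funext θ; simp [Finset.sum_apply]
  rw [h1]
  exact TorusSmooth.sum fun i hi => hF i hi m

/-- The difference is supported on finitely many lattice points, hence negligible. This frees the
values at |k| < M in the parametrix recursion. -/
lemma Sym.congr_of_large (P : Admissible h ρ δ) {μ R : ℝ} {σ τ : LatFun n}
    (hσ : Sym h ρ δ μ σ) (hτ : ∀ m, TorusSmooth (τ m))
    (heq : ∀ m, R < wt h m → ∀ θ, τ m θ = σ m θ) : Sym h ρ δ μ τ := by
  have h1 : Negligible h (τ - σ) := negligible_of_eq_zero P.pos (smooth_sub hτ hσ.smooth)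
    (R := R) fun m hm θ => by simp [heq m hm θ]
  simpa using (h1.sym P μ).add hσ

/-- Remainder estimates with an arbitrary loss suffice for an asymptotic expansion. -/
lemma sym_sub_sum_of_remainder (P : Admissible h ρ δ) {s ε : ℝ} (hε : 0 ≤ ε) {σ : LatFun n}
    {a : ℕ → LatFun n} (hσ : ∀ m, TorusSmooth (σ m)) (ha : ∀ j : ℕ, Sym h ρ δ (s - ε * j) (a j))
    (hrem : ∀ T L : ℕ, ∃ N₀ : ℕ, ∀ N ≥ N₀, ∃ C, ∀ m p,
      ‖coef ((σ - ∑ j ∈ Finset.range N, a j) m) p‖ * siz p ^ L ≤ C * wt h m ^ (-(T : ℝ)))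
    (N : ℕ) : Sym h ρ δ (s - ε * N) (σ - ∑ j ∈ Finset.range N, a j) := by
  intro k
  obtain ⟨T, hT⟩ := exists_nat_ge (k * ρ - (s - ε * N))
  obtain ⟨N₀, hN₀⟩ := hrem T (k + 2 * n)
  -- With this many terms the remainder beats the loss in `SymOrd.of_coef_le`; the extra terms, of
  -- index at least N, have order at most s - εN already.
  obtain ⟨C, hC⟩ := hN₀ (max N N₀) (le_max_right _ _)
  have h1 : SymOrd h ρ δ k (s - ε * N) (σ - ∑ j ∈ Finset.range (max N N₀), a j) :=
    SymOrd.of_coef_le P k (smooth_sub hσ (smooth_sum fun j _ => (ha j).smooth)) hC (by linarith)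
  have h2 : Sym h ρ δ (s - ε * N) (∑ j ∈ Finset.Ico N (max N N₀), a j) := by
    refine Sym.sum fun j hj => (ha j).mono P ?_
    have : (N : ℝ) ≤ j := by exact_mod_cast (Finset.mem_Ico.1 hj).1
    nlinarith
  have h3 : σ - ∑ j ∈ Finset.range N, a j = (σ - ∑ j ∈ Finset.range (max N N₀), a j) +
      ∑ j ∈ Finset.Ico N (max N N₀), a j := by
    rw [Finset.sum_Ico_eq_sub _ (le_max_left N N₀)]; abel
  rw [h3]
  exact h1.add (h2 k)

lemma coef_sub_sum {σ : LatFun n} (hσ : ∀ m, TorusSmooth (σ m)) {ι : Type*} {s : Finset ι}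
    {a : ι → LatFun n} (ha : ∀ i ∈ s, ∀ m, TorusSmooth (a i m)) (m p : Fin n → ℤ) :
    coef ((σ - ∑ i ∈ s, a i) m) p = coef (σ m) p - ∑ i ∈ s, coef (a i m) p := by
  rw [← coef_sum s (fun i hi => (ha i hi m).continuous),
    ← coef_sub (hσ m).continuous (TorusSmooth.sum fun i hi => ha i hi m).continuous]
  congr 1
  funext θ; simp [Finset.sum_apply]

/-- Asymptotic summation. -/
lemma exists_asymptotic_sum (P : Admissible h ρ δ) {s ε : ℝ} (hε : 0 < ε) {r : ℕ → LatFun n}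
    (hr : ∀ j : ℕ, Sym h ρ δ (s - ε * j) (r j)) :
    ∃ σ, ∀ N : ℕ, Sym h ρ δ (s - ε * N) (σ - ∑ j ∈ Finset.range N, r j) := by
  choose C hC0 hC using fun j L => (hr j).exists_coef_le P L
  -- Thresholds: the j-th term is switched on only where the weight is at least `t j`. There `C j L`
  -- ≤ 2^(-j) (1+|k|) for L ≤ j, and the summand j makes the sum finite at each point. A sharp
  -- cut-off suffices, since differences are estimated with loss.
  let t : ℕ → ℝ := fun j => 2 ^ j * (∑ L ∈ Finset.range (j + 1), C j L) + j
  have ht : ∀ j : ℕ, (j : ℝ) ≤ t j := fun j => le_add_of_nonneg_left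
    (mul_nonneg (by positivity) (Finset.sum_nonneg fun L _ => hC0 j L))
  have htC : ∀ j L, L ≤ j → 2 ^ j * C j L ≤ t j := fun j L hL => by
    have h1 := Finset.single_le_sum (fun L _ => hC0 j L)
      (Finset.mem_range.2 (Nat.lt_succ_of_le hL))
    have h2 := mul_le_mul_of_nonneg_left h1 (by positivity : (0 : ℝ) ≤ 2 ^ j)
    exact h2.trans (le_add_of_nonneg_right (Nat.cast_nonneg _))
  let J : (Fin n → ℤ) → Finset ℕ := fun m =>
    (Finset.range (⌊wt h m⌋₊ + 1)).filter fun j => t j ≤ wt h m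
  have hJ : ∀ m j, j ∈ J m ↔ t j ≤ wt h m := fun m j => by
    simp only [J, Finset.mem_filter, Finset.mem_range, and_iff_right_iff_imp]
    exact fun hj => Nat.lt_succ_of_le (Nat.le_floor ((ht j).trans hj))
  let σ : LatFun n := fun m θ => ∑ j ∈ J m, r j m θ
  have hσ : ∀ m, TorusSmooth (σ m) := fun m => TorusSmooth.sum fun j _ => (hr j).smooth m
  refine ⟨σ, sym_sub_sum_of_remainder P hε.le hσ hr fun T L => ?_⟩
  -- The 1 is the power of the weight spent on absorbing the constants `C j L`.
  obtain ⟨N₁, hN₁⟩ := exists_nat_ge ((s + 1 + δ * L + T) / ε)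
  refine ⟨max L N₁, fun N hN => ?_⟩
  -- Beyond this radius the first N terms are all switched on and cancel; the constant 2 is the sum
  -- of the geometric series.
  refine exists_coef_le_of_large P.pos (R := ∑ j ∈ Finset.range N, t j) (C := 2)
    (smooth_sub hσ (smooth_sum fun j _ => (hr j).smooth)) fun m hm p => ?_
  have hsub : Finset.range N ⊆ J m := fun j hj => by
    rw [hJ]
    exact (Finset.single_le_sum (f := t) (fun j _ => (Nat.cast_nonneg j).trans (ht j)) hj).trans
      hm.le
  have hw := P.one_le_wt m
  have hLN : L ≤ N := (le_max_left _ _).trans hN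
  have hexp : s + 1 + δ * L + T ≤ ε * N := by
    rw [div_le_iff₀ hε] at hN₁
    have : (N₁ : ℝ) ≤ N := by exact_mod_cast (le_max_right _ _).trans hN
    nlinarith
  rw [coef_sub_sum hσ fun j _ => (hr j).smooth]
  have h1 : coef (σ m) p = ∑ j ∈ J m, coef (r j m) p :=
    coef_sum _ (fun j _ => ((hr j).smooth m).continuous) p
  rw [h1, ← Finset.sum_sdiff hsub, add_sub_cancel_right]
  have h2 : ∀ j ∈ J m \ Finset.range N, ‖coef (r j m) p‖ * siz p ^ L ≤
      (1 / 2) ^ j * wt h m ^ (-(T : ℝ)) := fun j hj => by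
    obtain ⟨hj1, hj2⟩ := Finset.mem_sdiff.1 hj
    have hNj : N ≤ j := by simpa using hj2
    have h3 : C j L ≤ (1 / 2) ^ j * wt h m ^ (1 : ℝ) := by
      have h4 := (htC j L (hLN.trans hNj)).trans ((hJ m j).1 hj1)
      rw [Real.rpow_one, one_div, inv_pow, le_inv_mul_iff₀ (by positivity)]
      exact h4
    refine (hC j L m p).trans ?_
    calc C j L * wt h m ^ (s - ε * j + δ * L)
        ≤ (1 / 2) ^ j * wt h m ^ (1 : ℝ) * wt h m ^ (s - ε * j + δ * L) :=
          mul_le_mul_of_nonneg_right h3 (Real.rpow_nonneg (P.wt_pos m).le _)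
      _ = (1 / 2) ^ j * wt h m ^ (1 + (s - ε * j + δ * L)) := by
          rw [mul_assoc, ← Real.rpow_add (P.wt_pos m)]
      _ ≤ _ := by
          refine mul_le_mul_of_nonneg_left (Real.rpow_le_rpow_of_exponent_le hw ?_)
            (by positivity)
          have : (N : ℝ) ≤ j := by exact_mod_cast hNj
          nlinarith
  calc _ ≤ (∑ j ∈ J m \ Finset.range N, ‖coef (r j m) p‖) * siz p ^ L :=
        mul_le_mul_of_nonneg_right (norm_sum_le _ _) (pow_nonneg (siz_pos p).le _)
    _ ≤ ∑ j ∈ J m \ Finset.range N, (1 / 2 : ℝ) ^ j * wt h m ^ (-(T : ℝ)) := by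
        rw [Finset.sum_mul]; exact Finset.sum_le_sum h2
    _ ≤ 2 * wt h m ^ (-(T : ℝ)) := by
        rw [← Finset.sum_mul]
        refine mul_le_mul_of_nonneg_right ?_ (Real.rpow_nonneg (P.wt_pos m).le _)
        exact (summable_geometric_two.sum_le_tsum _ fun _ _ => by positivity).trans_eq
          tsum_geometric_two

end

section

variable {n : ℕ} {h ρ δ : ℝ}

/-! ### The discrete Taylor formula -/

/-- The binomial coefficient `x (x-1) ⋯ (x-b+1) / b!`. -/
def cchoose (x : ℂ) (b : ℕ) : ℂ := (∏ l ∈ Finset.range b, (x - l)) / (b.factorial : ℂ)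

lemma cchoose_zero (x : ℂ) : cchoose x 0 = 1 := by simp [cchoose]

lemma cchoose_zero_succ (b : ℕ) : cchoose 0 (b + 1) = 0 := by
  simp [cchoose, Finset.prod_range_succ']

lemma cchoose_add_one (x : ℂ) (b : ℕ) :
    cchoose (x + 1) (b + 1) = cchoose x (b + 1) + cchoose x b := by
  have h1 : ∏ l ∈ Finset.range (b + 1), (x + 1 - (l : ℂ)) =
      (∏ l ∈ Finset.range b, (x - (l : ℂ))) * (x + 1) := by
    rw [Finset.prod_range_succ']
    simp
  have h2 : (b.factorial : ℂ) ≠ 0 := by exact_mod_cast b.factorial_ne_zero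
  have h3 : (b + 1 : ℂ) ≠ 0 := by exact_mod_cast b.succ_ne_zero
  rw [cchoose, cchoose, cchoose, h1, Finset.prod_range_succ, Nat.factorial_succ]
  push_cast
  field_simp
  ring

/-- The multi-index binomial coefficient. -/
def mchoose (p : Fin n → ℤ) (γ : Fin n → ℕ) : ℂ := ∏ j, cchoose (p j) (γ j)

lemma mchoose_add_single_incr (p : Fin n → ℤ) (j : Fin n) (γ : Fin n → ℕ) :
    mchoose (p + Pi.single j 1) (incr j γ) = mchoose p (incr j γ) + mchoose p γ := by
  have h0 : ∀ p' : Fin n → ℤ, mchoose p' (incr j γ) =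
      cchoose (p' j) (γ j + 1) * ∏ i ∈ {j}ᶜ, cchoose (p' i) (γ i) := fun p' =>
    prod_incr (fun i b => cchoose (p' i) b) j γ
  rw [h0, h0, mchoose, Fintype.prod_eq_mul_prod_compl j]
  have h1 : ∀ i ∈ ({j}ᶜ : Finset (Fin n)),
      cchoose ((p + Pi.single j 1 : Fin n → ℤ) i : ℤ) (γ i) = cchoose (p i) (γ i) := fun i hi => by
    have : i ≠ j := by simpa using hi
    simp [this]
  rw [Finset.prod_congr rfl h1, ← add_mul]
  congr 1
  simpa using cchoose_add_one (p j) (γ j)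

lemma mchoose_add_single_of_eq_zero (p : Fin n → ℤ) (j : Fin n) {γ : Fin n → ℕ} (hγ : γ j = 0) :
    mchoose (p + Pi.single j 1) γ = mchoose p γ := by
  refine Finset.prod_congr rfl fun i _ => ?_
  by_cases hij : i = j
  · subst hij; rw [hγ, cchoose_zero, cchoose_zero]
  · simp [hij]

lemma mchoose_zero_right (p : Fin n → ℤ) : mchoose p 0 = 1 := by simp [mchoose, cchoose_zero]

lemma mchoose_zero_left {γ : Fin n → ℕ} (hγ : γ ≠ 0) : mchoose (0 : Fin n → ℤ) γ = 0 := by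
  obtain ⟨j, hj⟩ := Function.ne_iff.1 hγ
  obtain ⟨b, hb⟩ := Nat.exists_eq_succ_of_ne_zero hj
  refine Finset.prod_eq_zero (Finset.mem_univ j) ?_
  rw [hb]; simpa using cchoose_zero_succ b

lemma incr_injective (j : Fin n) : Function.Injective (incr j) :=
  fun _ _ hab => add_right_cancel hab

/-- Only multi-indices with γⱼ ≥ 1 contribute, and these are the γ' + eⱼ. -/
lemma sum_piAntidiag_succ {M : Type*} [AddCommMonoid M] (j : Fin n) (i : ℕ)
    {f : (Fin n → ℕ) → M} (hf : ∀ γ, γ j = 0 → f γ = 0) :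
    ∑ γ ∈ Finset.piAntidiag Finset.univ (i + 1), f γ =
      ∑ γ ∈ Finset.piAntidiag Finset.univ i, f (incr j γ) := by
  rw [← Finset.sum_image (f := f) (g := incr j) fun _ _ _ _ hab => incr_injective j hab]
  symm
  refine Finset.sum_subset (fun γ hγ => ?_) fun γ hγ hγ' => hf γ ?_
  · obtain ⟨γ', h1, rfl⟩ := Finset.mem_image.1 hγ
    rw [Finset.mem_piAntidiag] at h1 ⊢
    exact ⟨by rw [sum_incr, h1.1], fun _ _ => Finset.mem_univ _⟩
  · by_contra h0
    refine hγ' (Finset.mem_image.2 ⟨γ - Pi.single j 1, ?_, ?_⟩)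
    · have h1 : incr j (γ - Pi.single j 1) = γ := by
        funext k
        by_cases hk : k = j
        · subst hk; rw [incr_self]; simp; lia
        · rw [incr_of_ne hk]; simp [hk]
      rw [Finset.mem_piAntidiag] at hγ ⊢
      refine ⟨?_, fun _ _ => Finset.mem_univ _⟩
      have h2 := sum_incr j (γ - Pi.single j 1)
      rw [h1] at h2
      lia
    · funext k
      by_cases hk : k = j
      · subst hk; rw [incr_self]; simp; lia
      · rw [incr_of_ne hk]; simp [hk]

/-- The remainder of order `N` in the discrete Taylor expansion of `σ(m + p)` at `m`. -/
def taylorRem (h : ℝ) (N : ℕ) (σ : LatFun n) (m p : Fin n → ℤ) : UnitAddTorus (Fin n) → ℂ :=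
  fun θ => σ (m + p) θ - ∑ i ∈ Finset.range N, ∑ γ ∈ Finset.piAntidiag Finset.univ i,
    mchoose p γ * (h : ℂ) ^ i * diffOpMulti h γ σ m θ

lemma smooth_taylorRem {σ : LatFun n} (hσ : ∀ m, TorusSmooth (σ m)) (N : ℕ) (m p : Fin n → ℤ) :
    TorusSmooth (taylorRem h N σ m p) :=
  (hσ _).sub (TorusSmooth.sum fun _ _ => TorusSmooth.sum fun γ _ =>
    (smooth_diffOpMulti hσ γ m).const_mul _)

lemma taylorRem_zero (N : ℕ) (σ : LatFun n) (m : Fin n → ℤ) :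
    taylorRem h (N + 1) σ m 0 = fun _ => 0 := by
  funext θ
  rw [taylorRem, Finset.sum_range_succ', Finset.sum_eq_zero]
  · simp [mchoose_zero_right, diffOpMulti_zero]
  · intro i _
    refine Finset.sum_eq_zero fun γ hγ => ?_
    rw [mchoose_zero_left, zero_mul, zero_mul]
    rintro rfl
    simp [Finset.mem_piAntidiag] at hγ

/-- Pascal's rule: one step in p trades an order of the remainder for a difference of σ, which
drives the induction on N in the remainder estimate. -/
lemma taylorRem_step (hh : h ≠ 0) (N : ℕ) (σ : LatFun n) (m p : Fin n → ℤ) (j : Fin n)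
    (θ : UnitAddTorus (Fin n)) :
    taylorRem h (N + 1) σ m (p + Pi.single j 1) θ - taylorRem h (N + 1) σ m p θ =
      h * taylorRem h N (diffOp h j σ) m p θ := by
  have hh' : (h : ℂ) ≠ 0 := by exact_mod_cast hh
  have h1 : ∀ i, ∑ γ ∈ Finset.piAntidiag Finset.univ (i + 1),
        mchoose (p + Pi.single j 1) γ * (h : ℂ) ^ (i + 1) * diffOpMulti h γ σ m θ =
      ∑ γ ∈ Finset.piAntidiag Finset.univ (i + 1),
        mchoose p γ * (h : ℂ) ^ (i + 1) * diffOpMulti h γ σ m θ +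
      h * ∑ γ ∈ Finset.piAntidiag Finset.univ i,
        mchoose p γ * (h : ℂ) ^ i * diffOpMulti h γ (diffOp h j σ) m θ := fun i => by
    rw [← sub_eq_iff_eq_add', ← Finset.sum_sub_distrib, sum_piAntidiag_succ j, Finset.mul_sum]
    · refine Finset.sum_congr rfl fun γ _ => ?_
      rw [mchoose_add_single_incr, diffOp_diffOpMulti, ← diffOpMulti_add_single]
      ring
    · intro γ hγ
      rw [mchoose_add_single_of_eq_zero p j hγ, sub_self]
  have h2 : (h : ℂ) * diffOp h j σ (m + p) θ = σ (m + (p + Pi.single j 1)) θ - σ (m + p) θ := by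
    rw [diffOp, ← add_assoc, mul_div_cancel₀ _ hh']
  simp only [taylorRem, Finset.sum_range_succ' _ N, h1, Finset.sum_add_distrib, mul_sub, h2,
    Finset.piAntidiag_zero, Finset.sum_singleton, mchoose_zero_right, ← Finset.mul_sum]
  ring

/-- One step towards the origin; a negative coordinate is handled by reading a forward increment
backwards. The resulting path never leaves the ℓ¹ ball of p. -/
lemma exists_single_step {p : Fin n → ℤ} {k : ℕ} (hp : ∑ j, (p j).natAbs = k + 1) :
    ∃ p' j, ∑ j, (p' j).natAbs = k ∧ (p = p' + Pi.single j 1 ∨ p' = p + Pi.single j 1) := by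
  obtain ⟨j, hj⟩ : ∃ j, p j ≠ 0 := by
    by_contra! h0
    simp [h0] at hp
  have key : ∀ p' : Fin n → ℤ, (∀ i, i ≠ j → p' i = p i) → (p' j).natAbs + 1 = (p j).natAbs →
      ∑ j, (p' j).natAbs = k := fun p' h1 h2 => by
    rw [Fintype.sum_eq_add_sum_compl j] at hp ⊢
    rw [Finset.sum_congr rfl fun i hi => by rw [h1 i (by simpa using hi)]]
    lia
  rcases lt_or_gt_of_ne hj with h0 | h0
  · refine ⟨p + Pi.single j 1, j, key _ (fun i hi => by simp [hi]) ?_, Or.inr rfl⟩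
    simp only [Pi.add_apply, Pi.single_eq_same]
    lia
  · refine ⟨p - Pi.single j 1, j, key _ (fun i hi => by simp [hi]) ?_, Or.inl (by simp)⟩
    simp only [Pi.sub_apply, Pi.single_eq_same]
    lia

lemma siz_eq_natAbs (p : Fin n → ℤ) : siz p = 1 + (∑ j, (p j).natAbs : ℕ) := by
  simp [siz, Nat.cast_natAbs]

/-- A function on `ℤⁿ` vanishing at the origin is controlled by its increments. -/
lemma norm_le_of_increments {E : Type*} [NormedAddCommGroup E] {G : (Fin n → ℤ) → E} {B S : ℝ}
    (h0 : G 0 = 0) (hG : ∀ p j, siz p ≤ S → ‖G (p + Pi.single j 1) - G p‖ ≤ B)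
    (p : Fin n → ℤ) (hp : siz p ≤ S) : ‖G p‖ ≤ (siz p - 1) * B := by
  suffices ∀ (k : ℕ) (p : Fin n → ℤ), ∑ j, (p j).natAbs = k → siz p ≤ S → ‖G p‖ ≤ k * B by
    have h1 := this _ p rfl hp
    rwa [siz_eq_natAbs, add_sub_cancel_left]
  intro k
  induction k with
  | zero =>
    intro p hp _
    have : p = 0 := by
      funext j
      simpa using Finset.sum_eq_zero_iff.1 hp j (Finset.mem_univ j)
    simp [this, h0]
  | succ k ih =>
    intro p hp hpS
    obtain ⟨p', j, hp', hstep⟩ := exists_single_step hp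
    have hp'S : siz p' ≤ S := by
      rw [siz_eq_natAbs, hp] at hpS
      rw [siz_eq_natAbs, hp']
      push_cast at hpS
      linarith
    have h1 : ‖G p - G p'‖ ≤ B := by
      rcases hstep with rfl | rfl
      · exact hG p' j hp'S
      · rw [norm_sub_rev]; exact hG p j hpS
    have h2 := ih p' hp' hp'S
    calc ‖G p‖ = ‖(G p - G p') + G p'‖ := by rw [sub_add_cancel]
      _ ≤ B + k * B := (norm_add_le _ _).trans (add_le_add h1 h2)
      _ = _ := by push_cast; ring

/-- A remainder of positive order vanishes at p = 0, and its increments are ħ times remainders of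
one order less for Δⱼσ. Summation along a path to the origin costs at most S per order; the path
stays in the ball, so only differences at those m + p' enter. -/
lemma norm_coef_taylorRem_le (hh : 0 < h) (hle : h ≤ 1) {B S : ℝ} (hB : 0 ≤ B)
    (m q : Fin n → ℤ) (N : ℕ) : ∀ {σ : LatFun n}, (∀ m, TorusSmooth (σ m)) →
    (∀ γ ∈ Finset.piAntidiag Finset.univ N, ∀ p', siz p' ≤ S →
      ‖coef (diffOpMulti h γ σ (m + p')) q‖ ≤ B) →
    ∀ p, siz p ≤ S → ‖coef (taylorRem h N σ m p) q‖ ≤ S ^ N * B := by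
  induction N with
  | zero =>
    intro σ hσ hb p hp
    have h1 : taylorRem h 0 σ m p = σ (m + p) := by funext θ; simp [taylorRem]
    have h2 := hb 0 (by simp) p hp
    rw [h1, pow_zero, one_mul]
    rwa [diffOpMulti_zero] at h2
  | succ N ih =>
    intro σ hσ hb p hp
    have hS : 1 ≤ S := (one_le_siz p).trans hp
    have hstep : ∀ p j, siz p ≤ S →
        ‖coef (taylorRem h (N + 1) σ m (p + Pi.single j 1)) q - coef (taylorRem h (N + 1) σ m p) q‖
          ≤ S ^ N * B := fun p j hp => by
      have h1 : coef (taylorRem h (N + 1) σ m (p + Pi.single j 1)) q -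
          coef (taylorRem h (N + 1) σ m p) q = h * coef (taylorRem h N (diffOp h j σ) m p) q := by
        rw [← coef_const_mul, ← coef_sub (smooth_taylorRem hσ _ _ _).continuous
          (smooth_taylorRem hσ _ _ _).continuous]
        simp only [taylorRem_step hh.ne']
      have h2 := ih (smooth_diffOp hσ h j) (fun γ hγ p' hp' => by
        rw [diffOp_diffOpMulti, ← diffOpMulti_add_single]
        refine hb _ ?_ p' hp'
        rw [Finset.mem_piAntidiag] at hγ ⊢
        exact ⟨by rw [sum_incr, hγ.1], fun _ _ => Finset.mem_univ _⟩) p hp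
      rw [h1, norm_mul, Complex.norm_real, Real.norm_of_nonneg hh.le]
      exact (mul_le_of_le_one_left (norm_nonneg _) hle).trans h2
    have h0 : coef (taylorRem h (N + 1) σ m 0) q = 0 := by rw [taylorRem_zero, coef_zero]
    refine (norm_le_of_increments (G := fun p => coef (taylorRem h (N + 1) σ m p) q) h0 hstep p
      hp).trans ?_
    rw [pow_succ, mul_right_comm, mul_comm]
    exact mul_le_mul_of_nonneg_left (by linarith) (by positivity)

end

section

variable {n : ℕ} {h ρ δ a b : ℝ} {σ τ : LatFun n}

/-! ### Composition of symbols -/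

/-- The symbol `(1/γ!) D^{(γ)} σ Δ^γ τ`. -/
def compTerm (h : ℝ) (γ : Fin n → ℕ) (σ τ : LatFun n) : LatFun n := fun m θ =>
  1 / ((∏ i, (γ i).factorial : ℕ) : ℂ) * (torusDMulti h γ (σ m) θ * diffOpMulti h γ τ m θ)

/-- The homogeneous part of order `i` in the expansion of the composition. -/
def compPart (h : ℝ) (i : ℕ) (σ τ : LatFun n) : LatFun n :=
  ∑ γ ∈ Finset.piAntidiag Finset.univ i, compTerm h γ σ τ

/-- The Fourier coefficients of the symbol of the composition. -/
def compCoef (σ τ : LatFun n) (m q : Fin n → ℤ) : ℂ :=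
  ∑' p, coef (σ m) p * coef (τ (m + p)) (q - p)

/-- The symbol of the composition. -/
def comp (σ τ : LatFun n) : LatFun n := fun m => fourierSeries (compCoef σ τ m)

lemma compTerm_sym (P : Admissible h ρ δ) (hσ : Sym h ρ δ a σ) (hτ : Sym h ρ δ b τ) {i : ℕ}
    {γ : Fin n → ℕ} (hγ : ∑ j, γ j = i) :
    Sym h ρ δ (a + b - (ρ - δ) * i) (compTerm h γ σ τ) := by
  have h1 := (((hσ.torusDMulti P γ).mul P (hτ.diffOpMulti γ)).smul
    (1 / ((∏ i, (γ i).factorial : ℕ) : ℂ))).mono P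
    (b := a + b - (ρ - δ) * i) (by rw [hγ]; linarith)
  exact h1

lemma compPart_sym (P : Admissible h ρ δ) (hσ : Sym h ρ δ a σ) (hτ : Sym h ρ δ b τ) (i : ℕ) :
    Sym h ρ δ (a + b - (ρ - δ) * i) (compPart h i σ τ) :=
  Sym.sum fun _ hγ => compTerm_sym P hσ hτ (Finset.mem_piAntidiag.1 hγ).1

/-- The convolution formula, with 1/γ! turning the falling factorial multiplier of D^(γ) into a
binomial. -/
lemma hasSum_coef_compTerm (hσ : ∀ m, TorusSmooth (σ m)) (hτ : ∀ m, TorusSmooth (τ m)) {i : ℕ}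
    {γ : Fin n → ℕ} (hγ : ∑ j, γ j = i) (m q : Fin n → ℤ) :
    HasSum (fun p => coef (σ m) p *
      (mchoose p γ * (h : ℂ) ^ i * coef (diffOpMulti h γ τ m) (q - p)))
      (coef (compTerm h γ σ τ m) q) := by
  have h1 := (hasSum_coef_mul ((hσ m).torusDMulti h γ)
    (smooth_diffOpMulti (h := h) hτ γ m).continuous q).mul_left
      (1 / ((∏ i, (γ i).factorial : ℕ) : ℂ))
  rw [← coef_const_mul] at h1
  refine h1.congr_fun fun p => ?_
  have h2 : (∏ j, (γ j).factorial : ℂ) ≠ 0 :=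
    Finset.prod_ne_zero_iff.2 fun j _ => by exact_mod_cast (γ j).factorial_ne_zero
  rw [coef_torusDMulti (hσ m), Finset.prod_mul_distrib, Finset.prod_pow_eq_pow_sum, hγ, mchoose]
  simp only [cchoose, Finset.prod_div_distrib]
  push_cast
  field_simp

lemma mul_siz_pow_le_of_split {x y : ℝ} (hx : 0 ≤ x) (hy : 0 ≤ y) (p q : Fin n → ℤ) (L : ℕ) :
    x * y * siz q ^ L ≤ (x * siz p ^ L) * (y * siz (q - p) ^ L) := by
  have h1 : siz q ^ L ≤ siz p ^ L * siz (q - p) ^ L := by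
    rw [← mul_pow]
    refine pow_le_pow_left₀ (siz_pos q).le ?_ L
    simpa using siz_add_le p (q - p)
  calc x * y * siz q ^ L ≤ x * y * (siz p ^ L * siz (q - p) ^ L) :=
        mul_le_mul_of_nonneg_left h1 (mul_nonneg hx hy)
    _ = _ := by ring

/-- At a fixed m the coefficients of σ decay at any rate, so they absorb both the polynomial cost K
of moving the weight from m+p to m and the 2n powers for summability. Uniformity in m is not sought
here. -/
lemma exists_compCoef_bound (P : Admissible h ρ δ) (hσ : Sym h ρ δ a σ) (hτ : Sym h ρ δ b τ)
    (m : Fin n → ℤ) (L : ℕ) : ∃ C, ∀ p q,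
      ‖coef (σ m) p * coef (τ (m + p)) (q - p)‖ * siz q ^ L * siz p ^ (2 * n) ≤ C := by
  obtain ⟨D, hD, hb⟩ := hτ.exists_coef_le P L
  obtain ⟨K, hK⟩ := exists_nat_ge |b + δ * L|
  obtain ⟨C, hC⟩ := (hσ.smooth m).exists_coef_le (L + K + 2 * n)
  refine ⟨C * (D * wt h m ^ (b + δ * L)), fun p q => ?_⟩
  have hp := siz_pos p
  have h1 : ‖coef (τ (m + p)) (q - p)‖ * siz (q - p) ^ L ≤
      D * wt h m ^ (b + δ * L) * siz p ^ K := by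
    refine (hb (m + p) (q - p)).trans ?_
    rw [mul_assoc]
    refine mul_le_mul_of_nonneg_left ((wt_add_rpow_le P.pos.le P.le_one m p _).trans ?_) hD
    refine mul_le_mul_of_nonneg_left ?_ (Real.rpow_nonneg (P.wt_pos m).le _)
    rw [← Real.rpow_natCast]
    exact Real.rpow_le_rpow_of_exponent_le (one_le_siz p) hK
  have h2 := mul_siz_pow_le_of_split (norm_nonneg (coef (σ m) p))
    (norm_nonneg (coef (τ (m + p)) (q - p))) p q L
  have h3 : 0 ≤ D * wt h m ^ (b + δ * L) := mul_nonneg hD (Real.rpow_nonneg (P.wt_pos m).le _)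
  rw [norm_mul]
  calc _ ≤ (‖coef (σ m) p‖ * siz p ^ L) * (D * wt h m ^ (b + δ * L) * siz p ^ K) *
        siz p ^ (2 * n) := by
        refine mul_le_mul_of_nonneg_right (h2.trans (mul_le_mul_of_nonneg_left h1 ?_)) ?_ <;>
          positivity
    _ = ‖coef (σ m) p‖ * siz p ^ (L + K + 2 * n) * (D * wt h m ^ (b + δ * L)) := by ring
    _ ≤ _ := mul_le_mul_of_nonneg_right (hC p) h3

lemma summable_compCoef (P : Admissible h ρ δ) (hσ : Sym h ρ δ a σ) (hτ : Sym h ρ δ b τ)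
    (m q : Fin n → ℤ) : Summable fun p => ‖coef (σ m) p * coef (τ (m + p)) (q - p)‖ := by
  obtain ⟨C, hC⟩ := exists_compCoef_bound P hσ hτ m 0
  exact summable_norm_of_siz (C := C) fun p => by simpa using hC p q

lemma rapidDecay_compCoef (P : Admissible h ρ δ) (hσ : Sym h ρ δ a σ) (hτ : Sym h ρ δ b τ)
    (m : Fin n → ℤ) : RapidDecay (compCoef σ τ m) := fun L => by
  obtain ⟨C, hC⟩ := exists_compCoef_bound P hσ hτ m L
  refine ⟨C * sizSum n, fun q => ?_⟩
  have hq : 0 ≤ siz q ^ L := pow_nonneg (siz_pos q).le _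
  have h1 := norm_tsum_le_of_siz (C := C)
    (c := fun p => coef (σ m) p * coef (τ (m + p)) (q - p) * ((siz q ^ L : ℝ) : ℂ)) fun p => by
      rw [norm_mul, Complex.norm_real, Real.norm_of_nonneg hq]; exact hC p q
  rwa [tsum_mul_right, norm_mul, Complex.norm_real, Real.norm_of_nonneg hq] at h1

lemma smooth_comp (P : Admissible h ρ δ) (hσ : Sym h ρ δ a σ) (hτ : Sym h ρ δ b τ)
    (m : Fin n → ℤ) : TorusSmooth (comp σ τ m) :=
  torusSmooth_fourierSeries (rapidDecay_compCoef P hσ hτ m)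

lemma coef_comp (P : Admissible h ρ δ) (hσ : Sym h ρ δ a σ) (hτ : Sym h ρ δ b τ)
    (m q : Fin n → ℤ) : coef (comp σ τ m) q = compCoef σ τ m q :=
  coef_fourierSeries (rapidDecay_compCoef P hσ hτ m).summable_norm q

/-- Negative powers of the weight near `m`, as used in the remainder estimate. -/
lemma wt_rpow_le_of_siz_le (P : Admissible h ρ δ) {t : ℝ} (ht : t ≤ 0) (Q : ℕ)
    (m : Fin n → ℤ) {p p' : Fin n → ℤ} (hp : siz p' ≤ siz p) :
    wt h (m + p') ^ t ≤ 2 ^ (-t) * wt h m ^ t + 2 ^ Q * siz p ^ Q * wt h m ^ (-(Q : ℝ)) := by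
  have hw := P.wt_pos m
  have hp0 := siz_pos p
  have h1 := wt_le_add P.pos.le P.le_one m p'
  -- If p is small, the weight at m+p' is at least half that at m. Otherwise 1 ≤ (2 `siz p` / `wt h
  -- m`)^Q, which trades decay in p for decay in m.
  rcases le_total (siz p) (wt h m / 2) with h2 | h2
  · have h3 : wt h (m + p') ^ t ≤ (wt h m / 2) ^ t :=
      Real.rpow_le_rpow_of_nonpos (by positivity) (by linarith) ht
    have h4 : (wt h m / 2) ^ t = 2 ^ (-t) * wt h m ^ t := by
      rw [Real.div_rpow hw.le zero_le_two, Real.rpow_neg zero_le_two, div_eq_inv_mul]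
    rw [← h4]
    exact h3.trans (le_add_of_nonneg_right (by positivity))
  · have h3 : wt h (m + p') ^ t ≤ 1 :=
      Real.rpow_le_one_of_one_le_of_nonpos (P.one_le_wt _) ht
    have h4 : (1 : ℝ) ≤ 2 ^ Q * siz p ^ Q * wt h m ^ (-(Q : ℝ)) := by
      rw [Real.rpow_neg hw.le, Real.rpow_natCast, ← mul_pow, ← inv_pow, ← mul_pow]
      refine one_le_pow₀ ?_
      rw [← div_eq_mul_inv, le_div_iff₀ hw]
      linarith
    exact (h3.trans h4).trans (le_add_of_nonneg_left (by positivity))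

lemma norm_coef_taylorRem_le_wt (P : Admissible h ρ δ) (hτ : Sym h ρ δ b τ) (N L Q : ℕ)
    (ht : b - ρ * N + δ * L ≤ 0) : ∃ D, 0 ≤ D ∧ ∀ m p q,
      ‖coef (taylorRem h N τ m p) q‖ * siz q ^ L ≤ D * siz p ^ N *
        (2 ^ (-(b - ρ * N + δ * L)) * wt h m ^ (b - ρ * N + δ * L) +
          2 ^ Q * siz p ^ Q * wt h m ^ (-(Q : ℝ))) := by
  choose D hD hb using fun γ => (hτ.diffOpMulti γ).exists_coef_le P L
  refine ⟨∑ γ ∈ Finset.piAntidiag Finset.univ N, D γ, Finset.sum_nonneg fun γ _ => hD γ,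
    fun m p q => ?_⟩
  set D' := ∑ γ ∈ Finset.piAntidiag Finset.univ N, D γ
  set V := 2 ^ (-(b - ρ * N + δ * L)) * wt h m ^ (b - ρ * N + δ * L) +
    2 ^ Q * siz p ^ Q * wt h m ^ (-(Q : ℝ))
  have hw := P.wt_pos m
  have hp0 := siz_pos p
  have hq0 : 0 < siz q ^ L := pow_pos (siz_pos q) _
  have hD' : 0 ≤ D' := Finset.sum_nonneg fun γ _ => hD γ
  have hV : 0 ≤ V := by positivity
  -- The remainder estimate works at one frequency q, so the decay in q is carried by the constant
  -- `B`.
  have h1 := norm_coef_taylorRem_le P.pos P.le_one (B := D' * V / siz q ^ L) (S := siz p)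
    (by positivity) m q N hτ.smooth (fun γ hγ p' hp' => by
      have h2 := hb γ (m + p') q
      rw [(Finset.mem_piAntidiag.1 hγ).1] at h2
      rw [le_div_iff₀ hq0]
      refine h2.trans (mul_le_mul (Finset.single_le_sum (fun γ _ => hD γ) hγ)
        (wt_rpow_le_of_siz_le P ht Q m hp') (Real.rpow_nonneg (P.wt_pos _).le _) hD')) p le_rfl
  calc _ ≤ siz p ^ N * (D' * V / siz q ^ L) * siz q ^ L :=
        mul_le_mul_of_nonneg_right h1 hq0.le
    _ = _ := by field_simp

/-- The remainder in the composition formula. -/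
lemma exists_comp_remainder_bound (P : Admissible h ρ δ) (hσ : Sym h ρ δ a σ)
    (hτ : Sym h ρ δ b τ) (T L : ℕ) : ∃ N₀ : ℕ, ∀ N ≥ N₀, ∃ C, ∀ m q,
      ‖∑' p, coef (σ m) p * coef (taylorRem h N τ m p) (q - p)‖ * siz q ^ L ≤
        C * wt h m ^ (-(T : ℝ)) := by
  have hε : 0 < ρ - δ := sub_pos.2 P.lt
  have hδ := P.nonneg
  have hδ1 : 0 < 1 - δ := sub_pos.2 P.delta_lt
  -- The small-p term has exponent a + b - (ρ-δ)N + δ(2L+2n), to be at most -T; `N₂` makes the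
  -- exponent of the differences of τ nonpositive.
  obtain ⟨N₁, hN₁⟩ := exists_nat_ge ((a + b + δ * (2 * L + 2 * n) + T) / (ρ - δ))
  obtain ⟨N₂, hN₂⟩ := exists_nat_ge ((b + δ * L) / ρ)
  refine ⟨max N₁ N₂, fun N hN => ?_⟩
  have hN1 : (N₁ : ℝ) ≤ N := by exact_mod_cast (le_max_left _ _).trans hN
  have hN2 : (N₂ : ℝ) ≤ N := by exact_mod_cast (le_max_right _ _).trans hN
  rw [div_le_iff₀ hε] at hN₁
  rw [div_le_iff₀ P.rho_pos] at hN₂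
  -- In the large-p term each extra power of `siz p` costs δ and gains 1; since δ < 1, some Q,
  -- depending on N, suffices.
  obtain ⟨Q, hQ⟩ := exists_nat_ge ((a + δ * (N + L + 2 * n) + T) / (1 - δ))
  rw [div_le_iff₀ hδ1] at hQ
  have ht : b - ρ * N + δ * L ≤ 0 := by nlinarith [P.rho_pos]
  obtain ⟨D, hD, hbD⟩ := norm_coef_taylorRem_le_wt P hτ N L Q ht
  obtain ⟨C₁, hC₁, hb₁⟩ := hσ.exists_coef_le P (N + L + 2 * n)
  obtain ⟨C₂, hC₂, hb₂⟩ := hσ.exists_coef_le P (N + L + Q + 2 * n)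
  refine ⟨D * (2 ^ (-(b - ρ * N + δ * L)) * C₁ + 2 ^ Q * C₂) * sizSum n, fun m q => ?_⟩
  have hw := P.wt_pos m
  have hq : 0 ≤ siz q ^ L := pow_nonneg (siz_pos q).le _
  have e1 : wt h m ^ (a + δ * (N + L + 2 * n : ℕ)) * wt h m ^ (b - ρ * N + δ * L) ≤
      wt h m ^ (-(T : ℝ)) := by
    rw [← Real.rpow_add hw]
    refine Real.rpow_le_rpow_of_exponent_le (P.one_le_wt m) ?_
    push_cast
    nlinarith
  have e2 : wt h m ^ (a + δ * (N + L + Q + 2 * n : ℕ)) * wt h m ^ (-(Q : ℝ)) ≤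
      wt h m ^ (-(T : ℝ)) := by
    rw [← Real.rpow_add hw]
    refine Real.rpow_le_rpow_of_exponent_le (P.one_le_wt m) ?_
    push_cast
    nlinarith
  have key : ∀ p, ‖coef (σ m) p * coef (taylorRem h N τ m p) (q - p) *
      ((siz q ^ L : ℝ) : ℂ)‖ * siz p ^ (2 * n) ≤
        D * (2 ^ (-(b - ρ * N + δ * L)) * C₁ + 2 ^ Q * C₂) * wt h m ^ (-(T : ℝ)) := fun p => by
    have hp := siz_pos p
    rw [norm_mul, Complex.norm_real, Real.norm_of_nonneg hq, norm_mul]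
    have h1 := mul_siz_pow_le_of_split (norm_nonneg (coef (σ m) p))
      (norm_nonneg (coef (taylorRem h N τ m p) (q - p))) p q L
    set t := b - ρ * N + δ * L
    calc _ ≤ (‖coef (σ m) p‖ * siz p ^ L) * (D * siz p ^ N * (2 ^ (-t) * wt h m ^ t +
          2 ^ Q * siz p ^ Q * wt h m ^ (-(Q : ℝ)))) * siz p ^ (2 * n) := by
          refine mul_le_mul_of_nonneg_right (h1.trans (mul_le_mul_of_nonneg_left
            (hbD m p (q - p)) ?_)) ?_ <;> positivity
      _ = D * (2 ^ (-t) * ((‖coef (σ m) p‖ * siz p ^ (N + L + 2 * n)) * wt h m ^ t) +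
          2 ^ Q * ((‖coef (σ m) p‖ * siz p ^ (N + L + Q + 2 * n)) * wt h m ^ (-(Q : ℝ)))) := by
          ring
      _ ≤ D * (2 ^ (-t) * ((C₁ * wt h m ^ (a + δ * (N + L + 2 * n : ℕ))) * wt h m ^ t) +
          2 ^ Q * ((C₂ * wt h m ^ (a + δ * (N + L + Q + 2 * n : ℕ))) *
            wt h m ^ (-(Q : ℝ)))) := by
          have := hb₁ m p
          have := hb₂ m p
          gcongr
      _ = D * (2 ^ (-t) * (C₁ * (wt h m ^ (a + δ * (N + L + 2 * n : ℕ)) * wt h m ^ t)) +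
          2 ^ Q * (C₂ * (wt h m ^ (a + δ * (N + L + Q + 2 * n : ℕ)) *
            wt h m ^ (-(Q : ℝ))))) := by ring
      _ ≤ D * (2 ^ (-t) * (C₁ * wt h m ^ (-(T : ℝ))) +
          2 ^ Q * (C₂ * wt h m ^ (-(T : ℝ)))) := by gcongr
      _ = _ := by ring
  have h1 := norm_tsum_le_of_siz key
  rw [tsum_mul_right, norm_mul, Complex.norm_real, Real.norm_of_nonneg hq] at h1
  refine h1.trans (le_of_eq (by ring))

lemma coef_comp_sub (P : Admissible h ρ δ) (hσ : Sym h ρ δ a σ) (hτ : Sym h ρ δ b τ) (N : ℕ)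
    (m q : Fin n → ℤ) :
    coef ((comp σ τ - ∑ i ∈ Finset.range N, compPart h i σ τ) m) q =
      ∑' p, coef (σ m) p * coef (taylorRem h N τ m p) (q - p) := by
  have hpart : ∀ i, HasSum (fun p => coef (σ m) p * ∑ γ ∈ Finset.piAntidiag Finset.univ i,
      mchoose p γ * (h : ℂ) ^ i * coef (diffOpMulti h γ τ m) (q - p))
      (coef (compPart h i σ τ m) q) := fun i => by
    have h1 : coef (compPart h i σ τ m) q =
        ∑ γ ∈ Finset.piAntidiag Finset.univ i, coef (compTerm h γ σ τ m) q := by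
      rw [← coef_sum _ fun γ hγ => ((compTerm_sym P hσ hτ rfl).smooth m).continuous]
      congr 1
      funext θ; simp [compPart, Finset.sum_apply]
    rw [h1]
    simp only [Finset.mul_sum]
    exact hasSum_sum fun γ hγ =>
      hasSum_coef_compTerm hσ.smooth hτ.smooth (Finset.mem_piAntidiag.1 hγ).1 m q
  have hcomp : HasSum (fun p => coef (σ m) p * coef (τ (m + p)) (q - p))
      (coef (comp σ τ m) q) := by
    rw [coef_comp P hσ hτ]
    exact (summable_compCoef P hσ hτ m q).of_norm.hasSum
  rw [coef_sub_sum (smooth_comp P hσ hτ) fun i _ => (compPart_sym P hσ hτ i).smooth]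
  rw [← (hcomp.sub (hasSum_sum fun i _ => hpart i)).tsum_eq]
  refine tsum_congr fun p => ?_
  rw [← Finset.mul_sum, ← mul_sub]
  congr 1
  have hs : ∀ γ, TorusSmooth (diffOpMulti h γ τ m) := fun γ => smooth_diffOpMulti hτ.smooth γ m
  have h2 : coef (taylorRem h N τ m p) (q - p) = coef (τ (m + p)) (q - p) -
      coef (fun θ => ∑ i ∈ Finset.range N, ∑ γ ∈ Finset.piAntidiag Finset.univ i,
        mchoose p γ * (h : ℂ) ^ i * diffOpMulti h γ τ m θ) (q - p) :=
    coef_sub (hτ.smooth _).continuous (TorusSmooth.sum fun i _ => TorusSmooth.sum fun γ _ =>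
      (hs γ).const_mul _).continuous _
  rw [h2, coef_sum _ fun i _ => (TorusSmooth.sum fun γ _ => (hs γ).const_mul _).continuous]
  congr 1
  refine Finset.sum_congr rfl fun i _ => ?_
  rw [coef_sum _ fun γ _ => ((hs γ).const_mul _).continuous]
  simp only [coef_const_mul]

/-- The composition formula. -/
theorem comp_sub_sum_sym (P : Admissible h ρ δ) (hσ : Sym h ρ δ a σ) (hτ : Sym h ρ δ b τ)
    (N : ℕ) : Sym h ρ δ (a + b - (ρ - δ) * N)
      (comp σ τ - ∑ i ∈ Finset.range N, compPart h i σ τ) :=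
  sym_sub_sum_of_remainder P (sub_pos.2 P.lt).le (smooth_comp P hσ hτ)
    (compPart_sym P hσ hτ) (fun T L => by
      simpa only [coef_comp_sub P hσ hτ] using exists_comp_remainder_bound P hσ hτ T L) N

lemma comp_sym (P : Admissible h ρ δ) (hσ : Sym h ρ δ a σ) (hτ : Sym h ρ δ b τ) :
    Sym h ρ δ (a + b) (comp σ τ) := by
  simpa using comp_sub_sum_sym P hσ hτ 0

lemma compPart_zero (h : ℝ) (hσ : ∀ m, TorusSmooth (σ m)) : compPart h 0 σ τ = σ * τ := by
  funext m θ
  have h1 : torusDMulti h 0 (σ m) = σ m :=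
    ((hσ m).torusDMulti h 0).eq_of_coef_eq (hσ m) fun p => by simp [coef_torusDMulti (hσ m)]
  simp [compPart, compTerm, h1, diffOpMulti_zero]

lemma comp_sub_mul_sym (P : Admissible h ρ δ) (hσ : Sym h ρ δ a σ) (hτ : Sym h ρ δ b τ) :
    Sym h ρ δ (a + b - (ρ - δ)) (comp σ τ - σ * τ) := by
  simpa [compPart_zero h hσ.smooth] using comp_sub_sum_sym P hσ hτ 1

end

section

variable {n : ℕ} {h ρ δ a b : ℝ} {σ τ : LatFun n}

/-! ### Operators on the Schwartz space -/

lemma wt_le_siz (hle : h ≤ 1) (p : Fin n → ℤ) : wt h p ≤ siz p := by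
  have := latNorm_le_siz hle p
  rw [wt]; linarith

lemma siz_le_mul_wt (hh : 0 < h) (p : Fin n → ℤ) : siz p ≤ (1 + n / h) * wt h p := by
  have h1 : ∀ j, |(p j : ℝ)| ≤ latNorm h p / h := fun j => by
    rw [latNorm, mul_div_cancel_left₀ _ hh.ne']
    exact Real.abs_le_sqrt (Finset.single_le_sum (f := fun j => (p j : ℝ) ^ 2)
      (fun _ _ => sq_nonneg _) (Finset.mem_univ j))
  have h2 : ∑ j, |(p j : ℝ)| ≤ n * (latNorm h p / h) := by
    simpa using Finset.sum_le_sum fun j (_ : j ∈ Finset.univ) => h1 j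
  have h3 := latNorm_nonneg hh.le p
  have h4 : (n : ℝ) * (latNorm h p / h) = n / h * latNorm h p := by ring
  have h5 : (0 : ℝ) ≤ n / h := by positivity
  rw [siz, wt]
  nlinarith

/-- For fixed ħ the two weights are equivalent, so Schwartz functions and Fourier coefficients share
one notion of decay. -/
lemma mem_schwartz_iff (hh : 0 < h) (hle : h ≤ 1) {f : (Fin n → ℤ) → ℂ} :
    f ∈ schwartz n h ↔ RapidDecay f := by
  have key : ∀ (N : ℕ) (m : Fin n → ℤ) (x C : ℝ),
      x ≤ C * wt h m ^ (-(N : ℝ)) ↔ x * wt h m ^ N ≤ C := fun N m x C => by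
    rw [Real.rpow_neg (wt_pos hh.le m).le, Real.rpow_natCast, ← div_eq_mul_inv,
      le_div_iff₀ (pow_pos (wt_pos hh.le m) N)]
  constructor
  · intro hf L
    obtain ⟨C, hC⟩ := hf L
    refine ⟨C * (1 + n / h) ^ L, fun m => ?_⟩
    have h1 := (key L m _ C).1 (hC m)
    have h2 : siz m ^ L ≤ (1 + n / h) ^ L * wt h m ^ L := by
      rw [← mul_pow]
      exact pow_le_pow_left₀ (siz_pos m).le (siz_le_mul_wt hh m) L
    calc ‖f m‖ * siz m ^ L ≤ ‖f m‖ * ((1 + n / h) ^ L * wt h m ^ L) :=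
          mul_le_mul_of_nonneg_left h2 (norm_nonneg _)
      _ = ‖f m‖ * wt h m ^ L * (1 + n / h) ^ L := by ring
      _ ≤ _ := mul_le_mul_of_nonneg_right h1 (by positivity)
  · intro hf N
    obtain ⟨C, hC⟩ := hf N
    refine ⟨C, fun m => (key N m _ C).2 (le_trans ?_ (hC m))⟩
    exact mul_le_mul_of_nonneg_left (pow_le_pow_left₀ (wt_pos hh.le m).le (wt_le_siz hle m) N)
      (norm_nonneg _)

lemma rapidDecay_schwartz (hh : 0 < h) (hle : h ≤ 1) (f : schwartz n h) :
    RapidDecay (f : (Fin n → ℤ) → ℂ) := (mem_schwartz_iff hh hle).1 f.2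

/-- The matrix form of the quantization formula. -/
lemma hasSum_opFun (hσ : ∀ m, TorusSmooth (σ m)) {f : (Fin n → ℤ) → ℂ} (hf : RapidDecay f)
    (m : Fin n → ℤ) : HasSum (fun p => coef (σ m) p * f (m + p)) (opFun σ f m) := by
  obtain ⟨C, hC⟩ := exists_norm_le_of_continuous (hσ m).continuous
  have hc := (hσ m).continuous
  -- The quantization integral is the Fourier coefficient at -m of σ(m,·) times the transform of f;
  -- it is integrated term by term and reindexed by l = m + p.
  have h1 := coef_tsum (F := fun l θ => f l * (UnitAddTorus.mFourier (-l) θ * σ m θ))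
    (b := fun l => ‖f l‖ * C) (fun l => by fun_prop) (fun l θ => by
      rw [norm_mul, norm_mul, norm_mFourier_apply, one_mul]
      exact mul_le_mul_of_nonneg_left (hC θ) (norm_nonneg _)) (hf.summable_norm.mul_right C) (-m)
  have h2 : coef (fun θ => ∑' l, f l * (UnitAddTorus.mFourier (-l) θ * σ m θ)) (-m) =
      opFun σ f m := by
    simp only [coef, opFun, fourierLat, neg_neg, mul_assoc]
    congr 1
    funext θ
    have h3 : ∀ l, f l * (UnitAddTorus.mFourier (-l) θ * σ m θ) =
        σ m θ * (UnitAddTorus.mFourier (-l) θ * f l) := fun l => by ring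
    simp only [h3, tsum_mul_left]
  rw [h2] at h1
  simp only [coef_const_mul, coef_mFourier_mul] at h1
  have h3 := ((Equiv.addLeft m).hasSum_iff (f := fun l => f l * coef (σ m) (-m - -l))
    (a := opFun σ f m)).2 h1
  refine h3.congr_fun fun p => ?_
  simp [mul_comm]

lemma IsOp.hasSum (P : Admissible h ρ δ) {A : Module.End ℂ (schwartz n h)} (hA : IsOp σ A)
    (hσ : ∀ m, TorusSmooth (σ m)) (f : schwartz n h) (m : Fin n → ℤ) :
    HasSum (fun p => coef (σ m) p * (f : (Fin n → ℤ) → ℂ) (m + p))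
      ((A f : (Fin n → ℤ) → ℂ) m) := by
  rw [hA f m]
  exact hasSum_opFun hσ (rapidDecay_schwartz P.pos P.le_one f) m

lemma isOp_of_hasSum (P : Admissible h ρ δ) {A : Module.End ℂ (schwartz n h)}
    (hσ : ∀ m, TorusSmooth (σ m))
    (hA : ∀ (f : schwartz n h) m, HasSum (fun p => coef (σ m) p * (f : (Fin n → ℤ) → ℂ) (m + p))
      ((A f : (Fin n → ℤ) → ℂ) m)) : IsOp σ A := fun f m =>
  (hA f m).unique (hasSum_opFun hσ (rapidDecay_schwartz P.pos P.le_one f) m)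

lemma rapidDecay_single (l : Fin n → ℤ) : RapidDecay (Pi.single l (1 : ℂ)) := fun L =>
  ⟨siz l ^ L, fun p => by
    by_cases hp : p = l
    · subst hp; simp
    · simp only [ne_eq, hp, not_false_eq_true, Pi.single_eq_of_ne, norm_zero, zero_mul]
      exact pow_nonneg (siz_pos l).le _⟩

/-- An operator determines its symbol. -/
lemma IsOp.unique (P : Admissible h ρ δ) {A : Module.End ℂ (schwartz n h)}
    (hσ : ∀ m, TorusSmooth (σ m)) (hτ : ∀ m, TorusSmooth (τ m)) (hA : IsOp σ A)
    (hA' : IsOp τ A) : σ = τ := by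
  funext m
  refine (hσ m).eq_of_coef_eq (hτ m) fun p => ?_
  -- Testing on the point mass at m + p reads off the p-th coefficient of the symbol at m.
  let f : schwartz n h := ⟨Pi.single (m + p) 1,
    (mem_schwartz_iff P.pos P.le_one).2 (rapidDecay_single _)⟩
  have key : ∀ σ : LatFun n, (∀ m, TorusSmooth (σ m)) → IsOp σ A →
      (A f : (Fin n → ℤ) → ℂ) m = coef (σ m) p := fun σ hσ hA => by
    refine (hA.hasSum P hσ f m).unique ?_
    have h1 := hasSum_single (f := fun p => coef (σ m) p * (f : (Fin n → ℤ) → ℂ) (m + p)) p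
      fun p' hp' => by simp [f, hp']
    simpa [f] using h1
  rw [← key σ hσ hA, ← key τ hτ hA']

lemma Sym.opFun_mem (P : Admissible h ρ δ) (hσ : Sym h ρ δ a σ) (f : schwartz n h) :
    opFun σ (f : (Fin n → ℤ) → ℂ) ∈ schwartz n h := by
  intro L
  have hδ1 : 0 < 1 - δ := sub_pos.2 P.delta_lt
  -- Moving the decay of f from m+p to m costs N powers of `siz p`, for which σ pays δN; the net
  -- gain (1-δ)N must reach L.
  obtain ⟨N, hN⟩ := exists_nat_ge ((a + δ * (2 * n) + L) / (1 - δ))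
  rw [div_le_iff₀ hδ1] at hN
  obtain ⟨C, hC⟩ := f.2 N
  obtain ⟨D, hD, hb⟩ := hσ.exists_coef_le P (N + 2 * n)
  refine ⟨D * |C| * sizSum n, fun m => ?_⟩
  rw [← (hasSum_opFun hσ.smooth (rapidDecay_schwartz P.pos P.le_one f) m).tsum_eq]
  have hw := P.wt_pos m
  change _ ≤ D * |C| * sizSum n * wt h m ^ (-(L : ℝ))
  have key : ∀ p, ‖coef (σ m) p * (f : (Fin n → ℤ) → ℂ) (m + p)‖ * siz p ^ (2 * n) ≤
      D * |C| * wt h m ^ (-(L : ℝ)) := fun p => by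
    have hp := siz_pos p
    have h1 : ‖(f : (Fin n → ℤ) → ℂ) (m + p)‖ ≤ |C| * (wt h m ^ (-(N : ℝ)) * siz p ^ N) := by
      have h2 := wt_add_rpow_le P.pos.le P.le_one m p (-(N : ℝ))
      rw [abs_neg, Nat.abs_cast, Real.rpow_natCast] at h2
      exact (hC (m + p)).trans (mul_le_mul (le_abs_self C) h2
        (Real.rpow_nonneg (P.wt_pos _).le _) (abs_nonneg _))
    have h3 : wt h m ^ (a + δ * (N + 2 * n : ℕ)) * wt h m ^ (-(N : ℝ)) ≤
        wt h m ^ (-(L : ℝ)) := by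
      rw [← Real.rpow_add hw]
      refine Real.rpow_le_rpow_of_exponent_le (P.one_le_wt m) ?_
      push_cast
      nlinarith
    have h4 := hb m p
    rw [norm_mul]
    calc _ ≤ ‖coef (σ m) p‖ * (|C| * (wt h m ^ (-(N : ℝ)) * siz p ^ N)) * siz p ^ (2 * n) := by
          gcongr
      _ = |C| * ((‖coef (σ m) p‖ * siz p ^ (N + 2 * n)) * wt h m ^ (-(N : ℝ))) := by ring
      _ ≤ |C| * ((D * wt h m ^ (a + δ * (N + 2 * n : ℕ))) * wt h m ^ (-(N : ℝ))) := by gcongr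
      _ = |C| * (D * (wt h m ^ (a + δ * (N + 2 * n : ℕ)) * wt h m ^ (-(N : ℝ)))) := by ring
      _ ≤ |C| * (D * wt h m ^ (-(L : ℝ))) := by gcongr
      _ = _ := by ring
  exact (norm_tsum_le_of_siz key).trans (le_of_eq (by ring))

/-- Every symbol defines an operator on the Schwartz space. -/
lemma Sym.exists_isOp (P : Admissible h ρ δ) (hσ : Sym h ρ δ a σ) :
    ∃ A : Module.End ℂ (schwartz n h), IsOp σ A := by
  have hs := fun (f : schwartz n h) m =>
    hasSum_opFun hσ.smooth (rapidDecay_schwartz P.pos P.le_one f) m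
  refine ⟨{ toFun := fun f => ⟨opFun σ f, hσ.opFun_mem P f⟩
            map_add' := fun f g => ?_
            map_smul' := fun c f => ?_ }, fun f m => rfl⟩
  · ext m
    refine (hs (f + g) m).unique (((hs f m).add (hs g m)).congr_fun fun p => ?_)
    simp [mul_add]
  · ext m
    refine (hs (c • f) m).unique (((hs f m).mul_left c).congr_fun fun p => ?_)
    simp
    ring

/-! ### Algebra of operators on the symbol side. -/

section

variable {A B : Module.End ℂ (schwartz n h)}

lemma IsOp.add (P : Admissible h ρ δ) (hσ : ∀ m, TorusSmooth (σ m))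
    (hτ : ∀ m, TorusSmooth (τ m)) (hA : IsOp σ A) (hB : IsOp τ B) : IsOp (σ + τ) (A + B) := by
  refine isOp_of_hasSum P (smooth_add hσ hτ) fun f m => ?_
  refine ((hA.hasSum P hσ f m).add (hB.hasSum P hτ f m)).congr_fun fun p => ?_
  have h1 : coef ((σ + τ) m) p = coef (σ m) p + coef (τ m) p :=
    coef_add (hσ m).continuous (hτ m).continuous p
  rw [h1, add_mul]

lemma IsOp.sub (P : Admissible h ρ δ) (hσ : ∀ m, TorusSmooth (σ m))
    (hτ : ∀ m, TorusSmooth (τ m)) (hA : IsOp σ A) (hB : IsOp τ B) : IsOp (σ - τ) (A - B) := by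
  refine isOp_of_hasSum P (smooth_sub hσ hτ) fun f m => ?_
  refine ((hA.hasSum P hσ f m).sub (hB.hasSum P hτ f m)).congr_fun fun p => ?_
  have h1 : coef ((σ - τ) m) p = coef (σ m) p - coef (τ m) p :=
    coef_sub (hσ m).continuous (hτ m).continuous p
  rw [h1, sub_mul]

lemma isOp_zero (P : Admissible h ρ δ) : IsOp (0 : LatFun n) (0 : Module.End ℂ (schwartz n h)) :=
  isOp_of_hasSum P (fun _ => TorusSmooth.const 0) fun f m => by
    have h1 : ∀ p, coef ((0 : LatFun n) m) p = 0 := fun p => coef_zero p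
    simp only [h1, zero_mul]
    exact hasSum_zero

lemma isOp_one (P : Admissible h ρ δ) : IsOp (1 : LatFun n) (1 : Module.End ℂ (schwartz n h)) :=
  isOp_of_hasSum P (fun _ => TorusSmooth.const 1) fun f m => by
    have h1 : ∀ p, coef ((1 : LatFun n) m) p = if 0 = p then 1 else 0 := fun p => by
      rw [← coef_mFourier]
      congr 1
      funext θ
      rw [UnitAddTorus.mFourier_zero]; rfl
    simp only [h1]
    have h2 := hasSum_single (f := fun p => (if 0 = p then (1 : ℂ) else 0) *
      (f : (Fin n → ℤ) → ℂ) (m + p)) 0 fun p hp => by rw [if_neg (Ne.symm hp), zero_mul]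
    simpa using h2

lemma IsOp.sum (P : Admissible h ρ δ) {ι : Type*} {s : Finset ι} {F : ι → LatFun n}
    {G : ι → Module.End ℂ (schwartz n h)} (hs : ∀ i ∈ s, ∀ m, TorusSmooth (F i m))
    (hF : ∀ i ∈ s, IsOp (F i) (G i)) : IsOp (∑ i ∈ s, F i) (∑ i ∈ s, G i) := by
  classical
  induction s using Finset.induction_on with
  | empty => simpa using isOp_zero P
  | insert i s hi ih =>
    rw [Finset.sum_insert hi, Finset.sum_insert hi]
    have hs' : ∀ i ∈ s, ∀ m, TorusSmooth (F i m) := fun j hj => hs j (Finset.mem_insert_of_mem hj)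
    exact (hF i (Finset.mem_insert_self _ _)).add P (hs i (Finset.mem_insert_self _ _))
      (smooth_sum hs') (ih hs' fun j hj => hF j (Finset.mem_insert_of_mem hj))

/-- Matrix multiplication: the double sum over the intermediate displacement p and the total
displacement q converges absolutely and may be evaluated in either order. -/
lemma IsOp.mul (P : Admissible h ρ δ) (hσ : Sym h ρ δ a σ) (hτ : Sym h ρ δ b τ)
    (hA : IsOp σ A) (hB : IsOp τ B) : IsOp (comp σ τ) (A * B) := by
  refine isOp_of_hasSum P (smooth_comp P hσ hτ) fun f m => ?_
  simp only [coef_comp P hσ hτ]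
  obtain ⟨C, hC⟩ := exists_compCoef_bound P hσ hτ m (2 * n)
  have hf := rapidDecay_schwartz P.pos P.le_one f
  obtain ⟨D, hD⟩ := hf 0
  let F : (Fin n → ℤ) → (Fin n → ℤ) → ℂ := fun q p =>
    coef (σ m) p * coef (τ (m + p)) (q - p) * (f : (Fin n → ℤ) → ℂ) (m + q)
  have hF : Summable (Function.uncurry F) := by
    have h1 := ((summable_siz n).mul_of_nonneg (summable_siz n)
      (fun p => inv_nonneg.2 (pow_nonneg (siz_pos p).le _))
      (fun p => inv_nonneg.2 (pow_nonneg (siz_pos p).le _))).mul_left (C * D)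
    refine Summable.of_norm_bounded h1 fun ⟨q, p⟩ => ?_
    have hp : 0 < siz p ^ (2 * n) := pow_pos (siz_pos p) _
    have hq : 0 < siz q ^ (2 * n) := pow_pos (siz_pos q) _
    have h2 := hC p q
    have h3 : ‖(f : (Fin n → ℤ) → ℂ) (m + q)‖ ≤ D := by simpa using hD (m + q)
    have h4 : ‖coef (σ m) p * coef (τ (m + p)) (q - p)‖ ≤
        C * ((siz q ^ (2 * n))⁻¹ * (siz p ^ (2 * n))⁻¹) := by
      rw [← mul_inv, ← div_eq_mul_inv, le_div_iff₀ (mul_pos hq hp), ← mul_assoc]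
      exact h2
    have h5 := mul_le_mul h4 h3 (norm_nonneg _) ((norm_nonneg _).trans h4)
    simp only [Function.uncurry, F, norm_mul] at h5 ⊢
    linarith
  have hq : ∀ q, HasSum (F q) (compCoef σ τ m q * (f : (Fin n → ℤ) → ℂ) (m + q)) := fun q =>
    (summable_compCoef P hσ hτ m q).of_norm.hasSum.mul_right _
  have hp : ∀ p, HasSum (fun q => F q p)
      (coef (σ m) p * (B f : (Fin n → ℤ) → ℂ) (m + p)) := fun p => by
    have h1 := (hB.hasSum P hτ.smooth f (m + p)).mul_left (coef (σ m) p)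
    rw [← (Equiv.addLeft p).hasSum_iff]
    refine h1.congr_fun fun r => ?_
    simp [F, mul_assoc, add_assoc]
  have h1 : HasSum (fun p => coef (σ m) p * (B f : (Fin n → ℤ) → ℂ) (m + p))
      (∑' x : (Fin n → ℤ) × (Fin n → ℤ), Function.uncurry F x) := by
    have h2 : HasSum (fun x : (Fin n → ℤ) × (Fin n → ℤ) => Function.uncurry F x.swap)
        (∑' x : (Fin n → ℤ) × (Fin n → ℤ), Function.uncurry F x) :=
      (Equiv.prodComm _ _).hasSum_iff.2 hF.hasSum
    exact h2.prod_fiberwise hp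
  have h3 := hA.hasSum P hσ.smooth (B f) m
  rw [Module.End.mul_apply, h3.unique h1]
  exact hF.hasSum.prod_fiberwise hq

end

end

section

variable {n : ℕ} {h ρ δ a b μ : ℝ} {σ τ : LatFun n}

/-! ### Classes of operators -/

/-- A shortcut for instance search. -/
scoped instance : Ring (Module.End ℂ (schwartz n h)) := Module.End.instRing

section

variable {A B : Module.End ℂ (schwartz n h)}

lemma mem_opClass_iff (P : Admissible h ρ δ) :
    A ∈ OpClass n h μ ρ δ ↔ ∃ σ, Sym h ρ δ μ σ ∧ IsOp σ A := by
  simp only [OpClass, Set.mem_ofPred_eq, isSymbol_iff_sym P]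

lemma opClass_mono (P : Admissible h ρ δ) (hab : a ≤ b) (hA : A ∈ OpClass n h a ρ δ) :
    A ∈ OpClass n h b ρ δ := by
  rw [mem_opClass_iff P] at hA ⊢
  obtain ⟨σ, hσ, hA⟩ := hA
  exact ⟨σ, hσ.mono P hab, hA⟩

lemma opClass_add (P : Admissible h ρ δ) (hA : A ∈ OpClass n h a ρ δ)
    (hB : B ∈ OpClass n h a ρ δ) : A + B ∈ OpClass n h a ρ δ := by
  rw [mem_opClass_iff P] at hA hB ⊢
  obtain ⟨σ, hσ, hA⟩ := hA
  obtain ⟨τ, hτ, hB⟩ := hB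
  exact ⟨σ + τ, hσ.add hτ, hA.add P hσ.smooth hτ.smooth hB⟩

lemma opClass_sub (P : Admissible h ρ δ) (hA : A ∈ OpClass n h a ρ δ)
    (hB : B ∈ OpClass n h a ρ δ) : A - B ∈ OpClass n h a ρ δ := by
  rw [mem_opClass_iff P] at hA hB ⊢
  obtain ⟨σ, hσ, hA⟩ := hA
  obtain ⟨τ, hτ, hB⟩ := hB
  exact ⟨σ - τ, hσ.sub hτ, hA.sub P hσ.smooth hτ.smooth hB⟩

lemma opClass_zero (P : Admissible h ρ δ) (a : ℝ) :
    (0 : Module.End ℂ (schwartz n h)) ∈ OpClass n h a ρ δ :=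
  (mem_opClass_iff P).2 ⟨0, Sym.zero a, isOp_zero P⟩

lemma opClass_sum (P : Admissible h ρ δ) {ι : Type*} {s : Finset ι}
    {G : ι → Module.End ℂ (schwartz n h)} (hG : ∀ i ∈ s, G i ∈ OpClass n h a ρ δ) :
    ∑ i ∈ s, G i ∈ OpClass n h a ρ δ := by
  classical
  induction s using Finset.induction_on with
  | empty => exact opClass_zero P a
  | insert i s hi ih =>
    rw [Finset.sum_insert hi]
    exact opClass_add P (hG i (Finset.mem_insert_self _ _))
      (ih fun j hj => hG j (Finset.mem_insert_of_mem hj))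

lemma opClass_mul (P : Admissible h ρ δ) (hA : A ∈ OpClass n h a ρ δ)
    (hB : B ∈ OpClass n h b ρ δ) : A * B ∈ OpClass n h (a + b) ρ δ := by
  rw [mem_opClass_iff P] at hA hB ⊢
  obtain ⟨σ, hσ, hA⟩ := hA
  obtain ⟨τ, hτ, hB⟩ := hB
  exact ⟨comp σ τ, comp_sym P hσ hτ, hA.mul P hσ hτ hB⟩

lemma Sym.one : Sym h ρ δ 0 (1 : LatFun n) := by
  have h0 : BoundOrd h 0 (1 : LatFun n) :=
    ⟨fun _ => TorusSmooth.const 1, 1, zero_le_one, fun m θ => by simp⟩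
  intro k
  cases k with
  | zero => exact h0
  | succ k =>
    refine ⟨h0, fun j => ⟨?_, ?_⟩⟩
    · have : (fun m : Fin n → ℤ => SemiclassicalLattice.opP h j ((1 : LatFun n) m)) = 0 := by
        funext m θ
        simp [SemiclassicalLattice.opP, torusDeriv]
      rw [this]
      exact Sym.zero _ k
    · have : SemiclassicalLattice.diffOp h j (1 : LatFun n) = 0 := by
        funext m θ; simp [SemiclassicalLattice.diffOp]
      rw [this]
      exact Sym.zero _ k

lemma opClass_one (P : Admissible h ρ δ) :
    (1 : Module.End ℂ (schwartz n h)) ∈ OpClass n h 0 ρ δ :=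
  (mem_opClass_iff P).2 ⟨1, Sym.one, isOp_one P⟩

/-- Two symbols of the same operator have the same order. -/
lemma sym_of_mem_opClass (P : Admissible h ρ δ) (hσ : ∀ m, TorusSmooth (σ m)) (hA : IsOp σ A)
    (hA' : A ∈ OpClass n h μ ρ δ) : Sym h ρ δ μ σ := by
  obtain ⟨τ, hτ, hB⟩ := (mem_opClass_iff P).1 hA'
  rwa [hA.unique P hσ hτ.smooth hB]

/-- The symbols witnessing the various orders coincide, because an operator determines its symbol.
-/
lemma mem_opSmoothing_iff (P : Admissible h ρ δ) :
    A ∈ OpSmoothing n h ↔ ∀ μ, A ∈ OpClass n h μ ρ δ := by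
  constructor
  · rintro ⟨σ, hσ, hA⟩ μ
    exact (mem_opClass_iff P).2 ⟨σ, ((isSmoothing_iff P).1 hσ).sym P μ, hA⟩
  · intro hA
    obtain ⟨σ, hσ, hA0⟩ := (mem_opClass_iff P).1 (hA 0)
    exact ⟨σ, (isSmoothing_iff P).2 (negligible_of_sym P fun μ =>
      sym_of_mem_opClass P hσ.smooth hA0 (hA μ)), hA0⟩

lemma mem_opSmoothing_of_forall (P : Admissible h ρ δ) (s : ℝ)
    (hA : ∀ N : ℕ, A ∈ OpClass n h (s - (ρ - δ) * N) ρ δ) : A ∈ OpSmoothing n h := by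
  rw [mem_opSmoothing_iff P]
  intro μ
  have hε : 0 < ρ - δ := sub_pos.2 P.lt
  obtain ⟨N, hN⟩ := exists_nat_ge ((s - μ) / (ρ - δ))
  rw [div_le_iff₀ hε] at hN
  exact opClass_mono P (by linarith) (hA N)

lemma exists_asymptotic_sum_opClass (P : Admissible h ρ δ) {s : ℝ}
    {G : ℕ → Module.End ℂ (schwartz n h)}
    (hG : ∀ j : ℕ, G j ∈ OpClass n h (s - (ρ - δ) * j) ρ δ) :
    ∃ A, ∀ N : ℕ, A - ∑ j ∈ Finset.range N, G j ∈ OpClass n h (s - (ρ - δ) * N) ρ δ := by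
  choose r hr hG using fun j => (mem_opClass_iff P).1 (hG j)
  obtain ⟨σ, hσ⟩ := exists_asymptotic_sum P (sub_pos.2 P.lt) hr
  have h0 : Sym h ρ δ s σ := by simpa using hσ 0
  obtain ⟨A, hA⟩ := h0.exists_isOp P
  refine ⟨A, fun N => (mem_opClass_iff P).2 ⟨_, hσ N, ?_⟩⟩
  exact hA.sub P h0.smooth (smooth_sum fun j _ => (hr j).smooth)
    (IsOp.sum P (fun j _ => (hr j).smooth) fun j _ => hG j)

/-- Inversion of `1 - R` modulo smoothing operators by the Neumann series. -/
lemma exists_neumann (P : Admissible h ρ δ) {R : Module.End ℂ (schwartz n h)}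
    (hR : R ∈ OpClass n h (-(ρ - δ)) ρ δ) : ∃ S ∈ OpClass n h 0 ρ δ,
      S * (1 - R) - 1 ∈ OpSmoothing n h ∧ (1 - R) * S - 1 ∈ OpSmoothing n h := by
  have hε : 0 < ρ - δ := sub_pos.2 P.lt
  have hpow : ∀ j : ℕ, R ^ j ∈ OpClass n h (0 - (ρ - δ) * j) ρ δ := fun j => by
    induction j with
    | zero => simpa using opClass_one P
    | succ j ih =>
      rw [pow_succ]
      refine opClass_mono P (le_of_eq ?_) (opClass_mul P ih hR)
      push_cast; ring
  obtain ⟨S, hS⟩ := exists_asymptotic_sum_opClass P hpow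
  have h1 : 1 - R ∈ OpClass n h 0 ρ δ :=
    opClass_sub P (opClass_one P) (opClass_mono P (by linarith) hR)
  refine ⟨S, by simpa using hS 0, mem_opSmoothing_of_forall P 0 fun N => ?_,
    mem_opSmoothing_of_forall P 0 fun N => ?_⟩
  -- The partial geometric sum inverts 1 - R up to R^N, so both terms have order -(ρ-δ)N.
  · have h2 : S * (1 - R) - 1 = (S - ∑ j ∈ Finset.range N, R ^ j) * (1 - R) - R ^ N := by
      rw [sub_mul, geom_sum_mul_neg]; abel
    rw [h2]
    exact opClass_sub P (opClass_mono P (by linarith) (opClass_mul P (hS N) h1)) (hpow N)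
  · have h2 : (1 - R) * S - 1 = (1 - R) * (S - ∑ j ∈ Finset.range N, R ^ j) - R ^ N := by
      rw [mul_sub, mul_neg_geom_sum]; abel
    rw [h2]
    exact opClass_sub P (opClass_mono P (by linarith) (opClass_mul P h1 (hS N))) (hpow N)

lemma opSmoothing_mul_left (P : Admissible h ρ δ) (hA : A ∈ OpClass n h a ρ δ)
    (hB : B ∈ OpSmoothing n h) : A * B ∈ OpSmoothing n h := by
  rw [mem_opSmoothing_iff P] at hB ⊢
  exact fun μ => opClass_mono P (by linarith) (opClass_mul P hA (hB (μ - a)))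

lemma opSmoothing_mul_right (P : Admissible h ρ δ) (hA : A ∈ OpSmoothing n h)
    (hB : B ∈ OpClass n h b ρ δ) : A * B ∈ OpSmoothing n h := by
  rw [mem_opSmoothing_iff P] at hA ⊢
  exact fun μ => opClass_mono P (by linarith) (opClass_mul P (hA (μ - b)) hB)

lemma opSmoothing_add (P : Admissible h ρ δ) (hA : A ∈ OpSmoothing n h)
    (hB : B ∈ OpSmoothing n h) : A + B ∈ OpSmoothing n h := by
  rw [mem_opSmoothing_iff P] at hA hB ⊢
  exact fun μ => opClass_add P (hA μ) (hB μ)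

lemma opSmoothing_sub (P : Admissible h ρ δ) (hA : A ∈ OpSmoothing n h)
    (hB : B ∈ OpSmoothing n h) : A - B ∈ OpSmoothing n h := by
  rw [mem_opSmoothing_iff P] at hA hB ⊢
  exact fun μ => opClass_sub P (hA μ) (hB μ)

end

/-! ### Parametrices -/

/-- A symbol inverse modulo lower order yields a two-sided parametrix. -/
lemma exists_parametrix (P : Admissible h ρ δ) {U : Module.End ℂ (schwartz n h)}
    (hσ : Sym h ρ δ μ σ) (hU : IsOp σ U) (hτ : Sym h ρ δ (-μ) τ)
    (hinv : Negligible h (τ * σ - 1)) :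
    ∃ V ∈ OpClass n h (-μ) ρ δ, IsParametrix V U := by
  obtain ⟨V₀, hV₀⟩ := hτ.exists_isOp P
  have hU' : U ∈ OpClass n h μ ρ δ := (mem_opClass_iff P).2 ⟨σ, hσ, hU⟩
  have hV₀' : V₀ ∈ OpClass n h (-μ) ρ δ := (mem_opClass_iff P).2 ⟨τ, hτ, hV₀⟩
  have h1 : 1 - V₀ * U ∈ OpClass n h (-(ρ - δ)) ρ δ := by
    refine (mem_opClass_iff P).2 ⟨1 - comp τ σ, ?_, (isOp_one P).sub P (fun _ => TorusSmooth.const 1)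
      (smooth_comp P hτ hσ) (hV₀.mul P hτ hσ hU)⟩
    have h2 := (comp_sub_mul_sym P hτ hσ).mono P (b := -(ρ - δ)) (by linarith)
    have h3 := (h2.add (hinv.sym P _)).neg
    rwa [show -(comp τ σ - τ * σ + (τ * σ - 1)) = 1 - comp τ σ by abel] at h3
  have h1' : 1 - U * V₀ ∈ OpClass n h (-(ρ - δ)) ρ δ := by
    refine (mem_opClass_iff P).2 ⟨1 - comp σ τ, ?_, (isOp_one P).sub P (fun _ => TorusSmooth.const 1)
      (smooth_comp P hσ hτ) (hU.mul P hσ hτ hV₀)⟩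
    have h2 := (comp_sub_mul_sym P hσ hτ).mono P (b := -(ρ - δ)) (by linarith)
    rw [mul_comm] at hinv
    have h3 := (h2.add (hinv.sym P _)).neg
    rwa [show -(comp σ τ - σ * τ + (σ * τ - 1)) = 1 - comp σ τ by abel] at h3
  obtain ⟨S, hS, hS1, -⟩ := exists_neumann P h1
  obtain ⟨S', hS', -, hS1'⟩ := exists_neumann P h1'
  rw [sub_sub_cancel] at hS1 hS1'
  have hV : S * V₀ ∈ OpClass n h (-μ) ρ δ :=
    opClass_mono P (by linarith) (opClass_mul P hS hV₀')
  have hW : V₀ * S' ∈ OpClass n h (-μ) ρ δ :=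
    opClass_mono P (by linarith) (opClass_mul P hV₀' hS')
  rw [← mul_assoc] at hS1
  rw [mul_assoc] at hS1'
  -- A left and a right parametrix agree modulo smoothing operators, so the left one is also a right
  -- one.
  have hdiff : S * V₀ - V₀ * S' ∈ OpSmoothing n h := by
    have h4 : S * V₀ - V₀ * S' =
        (S * V₀ * U - 1) * (V₀ * S') - S * V₀ * (U * (V₀ * S') - 1) := by noncomm_ring
    rw [h4]
    exact opSmoothing_sub P (opSmoothing_mul_right P hS1 hW) (opSmoothing_mul_left P hV hS1')
  refine ⟨S * V₀, hV, hS1, ?_⟩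
  have h5 : U * (S * V₀) - 1 = U * (S * V₀ - V₀ * S') + (U * (V₀ * S') - 1) := by noncomm_ring
  rw [h5]
  exact opSmoothing_add P (opSmoothing_mul_left P hU' hdiff) hS1'

/-! ### Lower bounds and inversion of elliptic symbols. -/

lemma exists_rpow_neg_le {ε η : ℝ} (hε : 0 < ε) (hη : 0 < η) (C : ℝ) :
    ∃ R > 0, ∀ w ≥ R, C * w ^ (-ε) ≤ η := by
  have h1 := (tendsto_rpow_neg_atTop hε).const_mul C
  rw [mul_zero] at h1
  obtain ⟨R, hR⟩ := Filter.eventually_atTop.1 (h1.eventually_le_const hη)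
  exact ⟨max R 1, by positivity, fun w hw => hR w ((le_max_left _ _).trans hw)⟩

/-- An operator with a parametrix has an elliptic symbol. -/
lemma isEllipticSymbol_of_isParametrix (P : Admissible h ρ δ) {U V : Module.End ℂ (schwartz n h)}
    (hσ : Sym h ρ δ μ σ) (hU : IsOp σ U) (hτ : Sym h ρ δ (-μ) τ) (hV : IsOp τ V)
    (hUV : U * V - 1 ∈ OpSmoothing n h) : IsEllipticSymbol h μ σ := by
  have hε : 0 < ρ - δ := sub_pos.2 P.lt
  have h1 : Sym h ρ δ (-(ρ - δ)) (comp σ τ - 1) :=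
    sym_of_mem_opClass P (smooth_sub (smooth_comp P hσ hτ) (fun _ => TorusSmooth.const 1))
      ((hU.mul P hσ hτ hV).sub P (smooth_comp P hσ hτ) (fun _ => TorusSmooth.const 1) (isOp_one P))
      ((mem_opSmoothing_iff P).1 hUV _)
  -- Negative order makes στ tend to 1, so |στ| ≥ 1/2 far out; dividing by the upper bound on τ
  -- bounds σ below.
  have h2 : Sym h ρ δ (-(ρ - δ)) (σ * τ - 1) := by
    have h3 := h1.sub ((comp_sub_mul_sym P hσ hτ).mono P (b := -(ρ - δ)) (by linarith))
    rwa [show comp σ τ - 1 - (comp σ τ - σ * τ) = σ * τ - 1 by abel] at h3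
  obtain ⟨-, C, hC, hb⟩ := (h2 0).boundOrd
  obtain ⟨-, D, hD, hb'⟩ := (hτ 0).boundOrd
  obtain ⟨R, hR, hRw⟩ := exists_rpow_neg_le hε (half_pos one_pos) C
  refine ⟨(2 * (D + 1))⁻¹, by positivity, R, hR, fun m hm θ => ?_⟩
  have hw := P.wt_pos m
  have h3 : ‖σ m θ * τ m θ - 1‖ ≤ 1 / 2 :=
    (hb m θ).trans (hRw _ (by rw [wt]; linarith))
  have h4 : 1 / 2 ≤ ‖σ m θ * τ m θ‖ := by
    have h5 := norm_sub_norm_le (1 : ℂ) (1 - σ m θ * τ m θ)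
    rw [norm_one, norm_sub_rev, sub_sub_cancel] at h5
    linarith
  have h5 : ‖τ m θ‖ ≤ (D + 1) * wt h m ^ (-μ) := (hb' m θ).trans
    (mul_le_mul_of_nonneg_right (by linarith) (Real.rpow_nonneg hw.le _))
  rw [norm_mul] at h4
  have h6 : 1 / 2 ≤ ‖σ m θ‖ * ((D + 1) * wt h m ^ (-μ)) :=
    h4.trans (mul_le_mul_of_nonneg_left h5 (norm_nonneg _))
  have h7 : wt h m ^ (-μ) * wt h m ^ μ = 1 := by
    rw [← Real.rpow_add hw, neg_add_cancel, Real.rpow_zero]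
  have h8 := mul_le_mul_of_nonneg_right h6 (Real.rpow_nonneg hw.le μ)
  rw [mul_assoc, mul_assoc, h7, mul_one] at h8
  change _ * wt h m ^ μ ≤ _
  rw [inv_mul_le_iff₀ (by positivity)]
  linarith

/-- Ellipticity is stable under perturbations of lower order. -/
lemma IsEllipticSymbol.of_sub (P : Admissible h ρ δ) (hσ : IsEllipticSymbol h μ σ)
    (hd : Sym h ρ δ (μ - (ρ - δ)) (σ - τ)) : IsEllipticSymbol h μ τ := by
  obtain ⟨c, hc, M, hM, hb⟩ := hσ
  obtain ⟨-, C, hC, hb'⟩ := (hd 0).boundOrd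
  obtain ⟨R, hR, hRw⟩ := exists_rpow_neg_le (sub_pos.2 P.lt) (half_pos hc) C
  refine ⟨c / 2, half_pos hc, max M R, lt_max_of_lt_left hM, fun m hm θ => ?_⟩
  have hw := P.wt_pos m
  have h1 := hb m ((le_max_left _ _).trans hm) θ
  have h2 := hb' m θ
  have h3 := hRw (wt h m) (by rw [wt]; linarith [(le_max_right M R).trans hm])
  rw [sub_eq_add_neg μ, Real.rpow_add hw] at h2
  have h4 := mul_le_mul_of_nonneg_right h3 (Real.rpow_nonneg hw.le μ)
  have h5 := norm_sub_norm_le (σ m θ) (τ m θ)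
  have h6 : ‖σ m θ - τ m θ‖ ≤ C * (wt h m ^ μ * wt h m ^ (-(ρ - δ))) := h2
  change c / 2 * wt h m ^ μ ≤ _
  change c * wt h m ^ μ ≤ _ at h1
  linarith

/-- Uniform lower bound wherever an elliptic symbol does not vanish. -/
lemma IsEllipticSymbol.exists_lower_bound (hh : 0 < h) (hσ : IsEllipticSymbol h μ σ)
    (hs : ∀ m, TorusSmooth (σ m)) {M : ℝ}
    (h0 : ∀ m, M ≤ latNorm h m → ∀ θ, σ m θ ≠ 0) :
    ∃ D > 0, ∀ m, M ≤ latNorm h m → ∀ θ, wt h m ^ μ ≤ D * ‖σ m θ‖ := by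
  obtain ⟨c, hc, M', -, hb⟩ := hσ
  -- At a single lattice point nonvanishing gives a lower bound by compactness of the torus; only
  -- finitely many points lie below the radius `M'` of ellipticity.
  have hm : ∀ m, ∃ D, 0 ≤ D ∧ (M ≤ latNorm h m → ∀ θ, wt h m ^ μ ≤ D * ‖σ m θ‖) := fun m => by
    by_cases hm : M ≤ latNorm h m
    · obtain ⟨C, hC⟩ := exists_norm_le_of_continuous ((hs m).inv (h0 m hm)).continuous
      have hw : 0 ≤ wt h m ^ μ := Real.rpow_nonneg (wt_pos hh.le m).le _
      have hC0 : 0 ≤ C := (norm_nonneg _).trans (hC 0)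
      refine ⟨wt h m ^ μ * C, mul_nonneg hw hC0, fun _ θ => ?_⟩
      have h1 := hC θ
      have h2 : 0 < ‖σ m θ‖ := norm_pos_iff.2 (h0 m hm θ)
      rw [norm_inv, inv_le_iff_one_le_mul₀ h2] at h1
      calc wt h m ^ μ = wt h m ^ μ * 1 := (mul_one _).symm
        _ ≤ wt h m ^ μ * (C * ‖σ m θ‖) := mul_le_mul_of_nonneg_left h1 hw
        _ = _ := by ring
    · exact ⟨0, le_rfl, fun hm' => absurd hm' hm⟩
  choose D hD hbD using hm
  set F := (finite_wt_le (n := n) hh (1 + M')).toFinset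
  have hF : 0 ≤ ∑ m ∈ F, D m := Finset.sum_nonneg fun m _ => hD m
  refine ⟨c⁻¹ + ∑ m ∈ F, D m, by positivity, fun m hm θ => ?_⟩
  by_cases hmM : M' ≤ latNorm h m
  · have h1 := hb m hmM θ
    rw [← le_inv_mul_iff₀ hc] at h1
    exact h1.trans (mul_le_mul_of_nonneg_right (le_add_of_nonneg_right hF) (norm_nonneg _))
  · have hmF : m ∈ F := by
      simp only [F, Set.Finite.mem_toFinset, Set.mem_ofPred_eq, wt]
      linarith
    have h1 := Finset.single_le_sum (fun m _ => hD m) hmF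
    refine (hbD m hm θ).trans (mul_le_mul_of_nonneg_right ?_ (norm_nonneg _))
    have : 0 < c⁻¹ := inv_pos.2 hc
    linarith

/-- A symbol bounded below at large lattice points has an inverse symbol there. -/
lemma exists_inverse_symbol (P : Admissible h ρ δ) (hσ : Sym h ρ δ μ σ) {M D : ℝ} (hD : 0 < D)
    (hlow : ∀ m, M ≤ latNorm h m → ∀ θ, wt h m ^ μ ≤ D * ‖σ m θ‖) :
    ∃ τ : LatFun n, Sym h ρ δ (-μ) τ ∧
      ∀ m, M ≤ latNorm h m → ∀ θ, τ m θ = (σ m θ)⁻¹ := by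
  classical
  -- Replacing σ by 1 at the finitely many remaining points makes it invertible everywhere without
  -- changing its class.
  let u : LatFun n := fun m => if M ≤ latNorm h m then σ m else 1
  have hu : ∀ m, M ≤ latNorm h m → u m = σ m := fun m hm => if_pos hm
  have hus : ∀ m, TorusSmooth (u m) := fun m => by
    by_cases hm : M ≤ latNorm h m
    · rw [hu m hm]; exact hσ.smooth m
    · simp only [u, if_neg hm]; exact TorusSmooth.const 1
  have husym : Sym h ρ δ μ u := hσ.congr_of_large P hus (R := 1 + M) fun m hm θ => by
    rw [hu m (by rw [wt] at hm; linarith)]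
  -- `D` serves the large points; the other summand bounds the weight to the power μ where `u` is 1.
  refine ⟨u⁻¹, husym.inv P (c := (D + (1 + |M|) ^ |μ|)⁻¹) (by positivity) fun m θ => ?_,
    fun m hm θ => by simp [hu m hm]⟩
  rw [inv_mul_le_iff₀ (by positivity)]
  by_cases hm : M ≤ latNorm h m
  · rw [hu m hm]
    refine (hlow m hm θ).trans (mul_le_mul_of_nonneg_right ?_ (norm_nonneg _))
    linarith [Real.rpow_nonneg (by positivity : 0 ≤ 1 + |M|) |μ|]
  · simp only [u, if_neg hm, Pi.one_apply, norm_one, mul_one]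
    have h1 : wt h m ^ μ ≤ wt h m ^ |μ| :=
      Real.rpow_le_rpow_of_exponent_le (P.one_le_wt m) (le_abs_self μ)
    have h2 : wt h m ^ |μ| ≤ (1 + |M|) ^ |μ| :=
      Real.rpow_le_rpow (P.wt_pos m).le
        (by rw [wt]; linarith [le_abs_self M, not_le.1 hm]) (abs_nonneg _)
    linarith

lemma negligible_mul_sub_one (P : Admissible h ρ δ) (hσ : ∀ m, TorusSmooth (σ m))
    (hτ : ∀ m, TorusSmooth (τ m)) {M : ℝ} (h0 : ∀ m, M ≤ latNorm h m → ∀ θ, σ m θ ≠ 0)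
    (hinv : ∀ m, M ≤ latNorm h m → ∀ θ, τ m θ = (σ m θ)⁻¹) : Negligible h (τ * σ - 1) := by
  refine negligible_of_eq_zero P.pos (smooth_sub (fun m => (hτ m).mul (hσ m))
    fun m => TorusSmooth.const 1) (R := 1 + M) fun m hm θ => ?_
  have hm' : M ≤ latNorm h m := by rw [wt] at hm; linarith
  simp [hinv m hm', h0 m hm' θ]

/-- The characterisation of ellipticity by the existence of a parametrix. -/
theorem isEllipticOp_iff_exists_parametrix (P : Admissible h ρ δ)
    {U : Module.End ℂ (schwartz n h)} (hU : U ∈ OpClass n h μ ρ δ) :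
    IsEllipticOp μ ρ δ U ↔ ∃ V ∈ OpClass n h (-μ) ρ δ, IsParametrix V U := by
  constructor
  · rintro ⟨σ, hσ, hU, hell⟩
    have hσ := hσ.sym P
    obtain ⟨c, hc, M, -, hb⟩ := hell
    have h0 : ∀ m, M ≤ latNorm h m → ∀ θ, σ m θ ≠ 0 := fun m hm θ => norm_pos_iff.1
      ((mul_pos hc (Real.rpow_pos_of_pos (P.wt_pos m) μ)).trans_le (hb m hm θ))
    obtain ⟨τ, hτ, hinv⟩ := exists_inverse_symbol P hσ (inv_pos.2 hc) fun m hm θ => by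
      rw [le_inv_mul_iff₀ hc]; exact hb m hm θ
    exact exists_parametrix P hσ hU hτ (negligible_mul_sub_one P hσ.smooth hτ.smooth h0 hinv)
  · rintro ⟨V, hV, -, hUV⟩
    obtain ⟨σ, hσ, hU⟩ := (mem_opClass_iff P).1 hU
    obtain ⟨τ, hτ, hV⟩ := (mem_opClass_iff P).1 hV
    exact ⟨σ, hσ.isSymbol P, hU, isEllipticSymbol_of_isParametrix P hσ hU hτ hV hUV⟩

end

section

variable {n : ℕ} {h ρ δ μ M : ℝ} {u v : ℕ → LatFun n}

/-! ### The parametrix recursion -/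

/-- The sum in the parametrix recursion. -/
def recursionSum (h : ℝ) (N : ℕ) (v u : ℕ → LatFun n) : LatFun n :=
  ∑ j ∈ Finset.range N, ∑ l ∈ Finset.range (N - j + 1), compPart h (N - j - l) (v j) (u l)

lemma recursionSum_apply (N : ℕ) (m : Fin n → ℤ) (θ : UnitAddTorus (Fin n)) :
    recursionSum h N v u m θ = ∑ j ∈ Finset.range N, ∑ l ∈ Finset.range (N - j + 1),
      ∑ γ ∈ Finset.piAntidiag (Finset.univ : Finset (Fin n)) (N - j - l),
        1 / ((∏ i, (γ i).factorial : ℕ) : ℂ) *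
          (torusDMulti h γ (v j m) θ * diffOpMulti h γ (u l) m θ) := by
  simp only [recursionSum, compPart, Finset.sum_apply, compTerm]

lemma IsParametrixRecursion.succ_eq (hv : IsParametrixRecursion h M u v) {N : ℕ} (hN : 1 ≤ N)
    {m : Fin n → ℤ} (hm : M ≤ latNorm h m) (θ : UnitAddTorus (Fin n)) :
    v N m θ = (-1) / u 0 m θ * recursionSum h N v u m θ := by
  rw [hv.succ N hN m hm θ, recursionSum_apply]

/-- The solution of the parametrix recursion that vanishes for `|k| < M`. -/
def parametrixSeq (h M : ℝ) (u : ℕ → LatFun n) : ℕ → LatFun n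
  | 0 => fun m θ => if M ≤ latNorm h m then 1 / u 0 m θ else 0
  | N + 1 => fun m θ => if M ≤ latNorm h m then (-1) / u 0 m θ *
      -- Indexing by `Fin (N + 1)` carries the bound on j needed for the recursion to terminate.
      ∑ j : Fin (N + 1), ∑ l ∈ Finset.range (N + 1 - j + 1),
        ∑ γ ∈ Finset.piAntidiag (Finset.univ : Finset (Fin n)) (N + 1 - j - l),
          1 / ((∏ i, (γ i).factorial : ℕ) : ℂ) *
            (torusDMulti h γ (parametrixSeq h M u j m) θ * diffOpMulti h γ (u l) m θ) else 0

lemma smooth_parametrixSeq (hu : ∀ l m, TorusSmooth (u l m))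
    (h0 : ∀ m, M ≤ latNorm h m → ∀ θ, u 0 m θ ≠ 0) (N : ℕ) :
    ∀ m, TorusSmooth (parametrixSeq h M u N m) := by
  induction N using Nat.strong_induction_on with
  | _ N ih =>
    intro m
    by_cases hm : M ≤ latNorm h m
    · have hinv := (hu 0 m).inv (h0 m hm)
      cases N with
      | zero =>
        unfold parametrixSeq
        simpa only [if_pos hm, one_div] using hinv
      | succ N =>
        unfold parametrixSeq
        simp only [if_pos hm, div_eq_mul_inv (-1 : ℂ)]
        refine (hinv.const_mul (-1)).mul (TorusSmooth.sum fun j _ => TorusSmooth.sum fun l _ =>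
          TorusSmooth.sum fun γ _ => TorusSmooth.const_mul _ ?_)
        exact ((ih j j.2 m).torusDMulti h γ).mul (smooth_diffOpMulti (hu l) γ m)
    · cases N <;> unfold parametrixSeq <;> simp only [if_neg hm] <;> exact TorusSmooth.const 0

lemma isParametrixRecursion_parametrixSeq (hu : ∀ l m, TorusSmooth (u l m))
    (h0 : ∀ m, M ≤ latNorm h m → ∀ θ, u 0 m θ ≠ 0) :
    IsParametrixRecursion h M u (parametrixSeq h M u) where
  smooth := smooth_parametrixSeq hu h0
  zero m hm θ := by simp only [parametrixSeq, if_pos hm]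
  succ N hN m hm θ := by
    obtain ⟨N, rfl⟩ := Nat.exists_eq_succ_of_ne_zero (Nat.one_le_iff_ne_zero.1 hN)
    rw [parametrixSeq]
    simp only [if_pos hm]
    rw [Finset.sum_range]

lemma lt_latNorm_of_wt {m : Fin n → ℤ} (hm : 1 + M < wt h m) : M ≤ latNorm h m := by
  rw [wt] at hm; linarith

/-- The orders of the solutions of the parametrix recursion. -/
lemma IsParametrixRecursion.sym (P : Admissible h ρ δ) (hv : IsParametrixRecursion h M u v)
    (hu : ∀ l : ℕ, Sym h ρ δ (μ - (ρ - δ) * l) (u l)) {τ : LatFun n} (hτ : Sym h ρ δ (-μ) τ)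
    (hinv : ∀ m, M ≤ latNorm h m → ∀ θ, τ m θ = (u 0 m θ)⁻¹) (N : ℕ) :
    Sym h ρ δ (-μ - (ρ - δ) * N) (v N) := by
  induction N using Nat.strong_induction_on with
  | _ N ih =>
    rcases Nat.eq_zero_or_pos N with rfl | hN
    · rw [Nat.cast_zero, mul_zero, sub_zero]
      refine hτ.congr_of_large P (hv.smooth 0) (R := 1 + M) fun m hm θ => ?_
      rw [hv.zero m (lt_latNorm_of_wt hm), hinv m (lt_latNorm_of_wt hm), one_div]
    · have h1 : Sym h ρ δ (-((ρ - δ) * N)) (recursionSum h N v u) := by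
        refine Sym.sum fun j hj => Sym.sum fun l hl => ?_
        have hjN := Finset.mem_range.1 hj
        have hlN := Finset.mem_range.1 hl
        refine (compPart_sym P (ih j hjN) (hu l) (N - j - l)).mono P (le_of_eq ?_)
        -- Order count: the ∓μ cancel and the drops j, l, N-j-l add up to N.
        have h2 : (N : ℝ) = j + l + (N - j - l : ℕ) := by
          rw [← Nat.cast_add, ← Nat.cast_add]; congr 1; omega
        rw [h2]; ring
      have h2 := ((hτ.mul P h1).neg).mono P (b := -μ - (ρ - δ) * N) (by linarith)
      refine h2.congr_of_large P (hv.smooth N) (R := 1 + M) fun m hm θ => ?_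
      rw [hv.succ_eq hN (lt_latNorm_of_wt hm), Pi.neg_apply, Pi.neg_apply, Pi.mul_apply,
        Pi.mul_apply, hinv m (lt_latNorm_of_wt hm), div_eq_mul_inv]
      ring

/-- Sorts the triples with j + l + i < N by their total K; raising N by one adds the layer j + l + i
= N. -/
lemma sum_triangle {E : Type*} [AddCommMonoid E] (f : ℕ → ℕ → ℕ → E) (N : ℕ) :
    ∑ j ∈ Finset.range N, ∑ l ∈ Finset.range (N - j), ∑ i ∈ Finset.range (N - j - l), f j l i =
      ∑ K ∈ Finset.range N, ∑ j ∈ Finset.range (K + 1), ∑ l ∈ Finset.range (K - j + 1),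
        f j l (K - j - l) := by
  induction N with
  | zero => simp
  | succ N ih =>
    rw [Finset.sum_range_succ (fun K => ∑ j ∈ Finset.range (K + 1),
      ∑ l ∈ Finset.range (K - j + 1), f j l (K - j - l)), ← ih]
    have h1 : ∀ j ∈ Finset.range (N + 1), ∑ l ∈ Finset.range (N + 1 - j),
        ∑ i ∈ Finset.range (N + 1 - j - l), f j l i =
        ∑ l ∈ Finset.range (N - j), ∑ i ∈ Finset.range (N - j - l), f j l i +
          ∑ l ∈ Finset.range (N - j + 1), f j l (N - j - l) := fun j hj => by
      have hj' := Finset.mem_range.1 hj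
      have h2 : ∀ l ∈ Finset.range (N - j + 1), ∑ i ∈ Finset.range (N + 1 - j - l), f j l i =
          ∑ i ∈ Finset.range (N - j - l), f j l i + f j l (N - j - l) := fun l hl => by
        have hl' := Finset.mem_range.1 hl
        rw [show N + 1 - j - l = N - j - l + 1 by omega, Finset.sum_range_succ]
      rw [show N + 1 - j = N - j + 1 by omega]
      rw [show N + 1 - j = N - j + 1 by omega] at h2
      rw [Finset.sum_congr rfl h2, Finset.sum_add_distrib, Finset.sum_range_succ
        (fun l => ∑ i ∈ Finset.range (N - j - l), f j l i), Nat.sub_self, Finset.sum_range_zero,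
        add_zero]
    rw [Finset.sum_congr rfl h1, Finset.sum_add_distrib, Finset.sum_range_succ
      (fun j => ∑ l ∈ Finset.range (N - j), ∑ i ∈ Finset.range (N - j - l), f j l i),
      Nat.sub_self, Finset.sum_range_zero, add_zero]

/-- The recursion makes the formal composition of `∑ v_j` with `∑ u_l` equal to `1`. -/
lemma IsParametrixRecursion.sum_compPart (hv : IsParametrixRecursion h M u v)
    {m : Fin n → ℤ} (hm : M ≤ latNorm h m) (h0 : ∀ θ, u 0 m θ ≠ 0) (N : ℕ)
    (θ : UnitAddTorus (Fin n)) :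
    (∑ j ∈ Finset.range (N + 1), ∑ l ∈ Finset.range (N + 1 - j),
      ∑ i ∈ Finset.range (N + 1 - j - l), compPart h i (v j) (u l)) m θ = 1 := by
  -- In the layer of total K, the index j = K forces l = i = 0 and contributes v_K u₀; the rest is
  -- the recursion sum, so the layer vanishes for K ≥ 1.
  have h1 : ∀ K, (∑ j ∈ Finset.range (K + 1), ∑ l ∈ Finset.range (K - j + 1),
      compPart h (K - j - l) (v j) (u l)) = recursionSum h K v u + v K * u 0 := fun K => by
    rw [Finset.sum_range_succ, recursionSum, Nat.sub_self, zero_add, Finset.sum_range_one,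
      Nat.sub_zero, compPart_zero h (hv.smooth K)]
  rw [sum_triangle (fun j l i => compPart h i (v j) (u l)), Finset.sum_congr rfl fun K _ => h1 K,
    Finset.sum_range_succ']
  simp only [Pi.add_apply, Finset.sum_apply, Pi.mul_apply]
  rw [Finset.sum_eq_zero fun K _ => ?_, hv.zero m hm θ]
  · simp [recursionSum, h0 θ]
  · rw [hv.succ_eq (Nat.le_add_left 1 K) hm]
    field_simp [h0 θ]
    ring

/-! ### The expansion of a parametrix -/

/-- Pairing V_j with U truncated after N - j terms gives every truncation error the same order
-(ρ-δ)N. The compositions V_j U_l are likewise expanded up to total order N, and the retained terms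
sum to 1 at |k| ≥ M by the recursion. -/
lemma sum_mul_sub_one_mem (P : Admissible h ρ δ) {U : Module.End ℂ (schwartz n h)}
    {Us Vs : ℕ → Module.End ℂ (schwartz n h)}
    (hu : ∀ l : ℕ, Sym h ρ δ (μ - (ρ - δ) * l) (u l)) (hUs : ∀ l, IsOp (u l) (Us l))
    (hU : HasExpansion μ ρ δ U Us) (h0 : ∀ m, M ≤ latNorm h m → ∀ θ, u 0 m θ ≠ 0)
    (hv : IsParametrixRecursion h M u v)
    (hvs : ∀ j : ℕ, Sym h ρ δ (-μ - (ρ - δ) * j) (v j)) (hVs : ∀ j, IsOp (v j) (Vs j)) (N : ℕ) :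
    (∑ j ∈ Finset.range N, Vs j) * U - 1 ∈ OpClass n h (-((ρ - δ) * N)) ρ δ := by
  have hε : 0 < ρ - δ := sub_pos.2 P.lt
  have hone : ∀ m, TorusSmooth ((1 : LatFun n) m) := fun _ => TorusSmooth.const 1
  have h1 : (∑ j ∈ Finset.range N, ∑ l ∈ Finset.range (N - j), Vs j * Us l) - 1 ∈
      OpClass n h (-((ρ - δ) * N)) ρ δ := by
    rcases N with _ | N
    · simpa using opClass_sub P (opClass_zero P 0) (opClass_one P)
    have hsm : ∀ j l m, TorusSmooth (comp (v j) (u l) m) := fun j l =>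
      smooth_comp P (hvs j) (hu l)
    refine (mem_opClass_iff P).2
      ⟨(∑ j ∈ Finset.range (N + 1), ∑ l ∈ Finset.range (N + 1 - j), comp (v j) (u l)) - 1, ?_,
        (IsOp.sum P (fun j _ => smooth_sum fun l _ => hsm j l) fun j _ =>
          IsOp.sum P (fun l _ => hsm j l) fun l _ => (hVs j).mul P (hvs j) (hu l) (hUs l)).sub P
          (smooth_sum fun j _ => smooth_sum fun l _ => hsm j l) hone (isOp_one P)⟩
    have h2 : Sym h ρ δ (-((ρ - δ) * (N + 1 : ℕ))) (∑ j ∈ Finset.range (N + 1),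
        ∑ l ∈ Finset.range (N + 1 - j), (comp (v j) (u l) -
          ∑ i ∈ Finset.range (N + 1 - j - l), compPart h i (v j) (u l))) := by
      refine Sym.sum fun j _ => Sym.sum fun l _ =>
        (comp_sub_sum_sym P (hvs j) (hu l) (N + 1 - j - l)).mono P ?_
      have h3 : ((N + 1 : ℕ) : ℝ) ≤ j + l + (N + 1 - j - l : ℕ) := by
        rw [← Nat.cast_add, ← Nat.cast_add, Nat.cast_le]; omega
      have h4 := mul_le_mul_of_nonneg_left h3 hε.le
      linarith
    have h3 : Negligible h ((∑ j ∈ Finset.range (N + 1), ∑ l ∈ Finset.range (N + 1 - j),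
        ∑ i ∈ Finset.range (N + 1 - j - l), compPart h i (v j) (u l)) - 1) :=
      negligible_of_eq_zero P.pos (smooth_sub (smooth_sum fun j _ => smooth_sum fun l _ =>
        smooth_sum fun i _ => (compPart_sym P (hvs j) (hu l) i).smooth) hone) (R := 1 + M)
        fun m hm θ => by
          have hm' := lt_latNorm_of_wt hm
          rw [Pi.sub_apply, Pi.sub_apply, hv.sum_compPart hm' (h0 m hm'), Pi.one_apply,
            Pi.one_apply, sub_self]
    have h4 := h2.add (h3.sym P _)
    simp only [Finset.sum_sub_distrib] at h4
    rwa [sub_add_sub_cancel] at h4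
  have h2 : ∑ j ∈ Finset.range N, Vs j * (U - ∑ l ∈ Finset.range (N - j), Us l) ∈
      OpClass n h (-((ρ - δ) * N)) ρ δ := opClass_sum P fun j hj => by
    refine opClass_mono P (le_of_eq ?_)
      (opClass_mul P ((mem_opClass_iff P).2 ⟨v j, hvs j, hVs j⟩) (hU (N - j)))
    rw [Nat.cast_sub (Finset.mem_range.1 hj).le]; ring
  have h3 := opClass_add P h2 h1
  simp only [mul_sub, Finset.mul_sum, Finset.sum_sub_distrib] at h3
  rw [Finset.sum_mul]
  rwa [sub_add_sub_cancel] at h3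

/-- With W = ∑_{j<N} V_j one has V - W = W(UV - 1) - (WU - 1)V: the first term is smoothing and the
second has order -μ - (ρ-δ)N. -/
theorem IsParametrix.hasExpansion (P : Admissible h ρ δ) {U V : Module.End ℂ (schwartz n h)}
    {Us Vs : ℕ → Module.End ℂ (schwartz n h)}
    (hu : ∀ l : ℕ, Sym h ρ δ (μ - (ρ - δ) * l) (u l)) (hUs : ∀ l, IsOp (u l) (Us l))
    (hU : HasExpansion μ ρ δ U Us) (h0 : ∀ m, M ≤ latNorm h m → ∀ θ, u 0 m θ ≠ 0)
    (hv : IsParametrixRecursion h M u v)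
    (hvs : ∀ j : ℕ, Sym h ρ δ (-μ - (ρ - δ) * j) (v j)) (hVs : ∀ j, IsOp (v j) (Vs j))
    (hV : V ∈ OpClass n h (-μ) ρ δ) (hVU : IsParametrix V U) :
    HasExpansion (-μ) ρ δ V Vs := fun N => by
  have hε : 0 < ρ - δ := sub_pos.2 P.lt
  have h1 := opClass_mul P (sum_mul_sub_one_mem P hu hUs hU h0 hv hvs hVs N) hV
  have h2 : ∑ j ∈ Finset.range N, Vs j ∈ OpClass n h (-μ) ρ δ := opClass_sum P fun j _ =>
    opClass_mono P (sub_le_self _ (by positivity)) ((mem_opClass_iff P).2 ⟨v j, hvs j, hVs j⟩)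
  have h3 := (mem_opSmoothing_iff P).1 (opSmoothing_mul_left P h2 hVU.2) (-μ - (ρ - δ) * N)
  have h4 := opClass_sub P h3 (opClass_mono P (by linarith) h1)
  generalize ∑ j ∈ Finset.range N, Vs j = W at h4 ⊢
  rwa [show W * (U * V - 1) - (W * U - 1) * V = V - W by noncomm_ring] at h4

/-- The leading term of an elliptic operator is elliptic. -/
lemma IsEllipticOp.leading (P : Admissible h ρ δ) {U : Module.End ℂ (schwartz n h)}
    {Us : ℕ → Module.End ℂ (schwartz n h)} (hell : IsEllipticOp μ ρ δ U)
    (hu : Sym h ρ δ μ (u 0)) (hUs : IsOp (u 0) (Us 0)) (hU : HasExpansion μ ρ δ U Us) :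
    IsEllipticSymbol h μ (u 0) := by
  obtain ⟨σ, hσ, hσU, hell⟩ := hell
  have h1 := hU 1
  rw [Finset.sum_range_one, Nat.cast_one, mul_one] at h1
  exact hell.of_sub P (sym_of_mem_opClass P (smooth_sub hσ.smooth hu.smooth)
    (hσU.sub P hσ.smooth hu.smooth hUs) h1)

end

end SemiclassicalLattice

end

/-- `IsOp` determines the operator from its symbol, and by `IsOp.unique` the smooth symbol from the
operator, so existential choices of `Vs` and of an elliptic symbol say the same as statements about
"the" operator or symbol. -/
theorem mainTheorem4 (n : ℕ) (h μ ρ δ : ℝ) (hpos : 0 < h) (hle : h ≤ 1)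
    (hδ : 0 ≤ δ) (hδρ : δ < ρ) (hρ : ρ ≤ 1)
    (U : Module.End ℂ (SemiclassicalLattice.schwartz n h))
    (hU : U ∈ SemiclassicalLattice.OpClass n h μ ρ δ) :
    (SemiclassicalLattice.IsEllipticOp μ ρ δ U ↔
      ∃ V ∈ SemiclassicalLattice.OpClass n h (-μ) ρ δ, SemiclassicalLattice.IsParametrix V U) ∧
    (SemiclassicalLattice.IsEllipticOp μ ρ δ U →
      ∀ (Us : ℕ → Module.End ℂ (SemiclassicalLattice.schwartz n h))
        (u : ℕ → (Fin n → ℤ) → UnitAddTorus (Fin n) → ℂ),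
        (∀ l : ℕ, SemiclassicalLattice.IsSymbol h (μ - (ρ - δ) * l) ρ δ (u l) ∧
          SemiclassicalLattice.IsOp (u l) (Us l)) →
        SemiclassicalLattice.HasExpansion μ ρ δ U Us →
        (∃ M > 0, ∀ m : Fin n → ℤ, M ≤ SemiclassicalLattice.latNorm h m →
          ∀ θ, u 0 m θ ≠ 0) ∧
        ∀ M : ℝ, (∀ m : Fin n → ℤ, M ≤ SemiclassicalLattice.latNorm h m →
            ∀ θ, u 0 m θ ≠ 0) →
          (∃ v, SemiclassicalLattice.IsParametrixRecursion h M u v) ∧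
          ∀ v, SemiclassicalLattice.IsParametrixRecursion h M u v →
            ∃ Vs : ℕ → Module.End ℂ (SemiclassicalLattice.schwartz n h),
              (∀ j : ℕ, SemiclassicalLattice.IsSymbol h (-μ - (ρ - δ) * j) ρ δ (v j) ∧
                SemiclassicalLattice.IsOp (v j) (Vs j)) ∧
              ∀ V ∈ SemiclassicalLattice.OpClass n h (-μ) ρ δ,
                SemiclassicalLattice.IsParametrix V U →
                  SemiclassicalLattice.HasExpansion (-μ) ρ δ V Vs) := by
  have P : SemiclassicalLattice.Admissible h ρ δ := ⟨hpos, hle, hδ, hδρ, hρ⟩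
  refine ⟨SemiclassicalLattice.isEllipticOp_iff_exists_parametrix P hU,
    fun hell Us u hu hexp => ?_⟩
  have hus : ∀ l : ℕ, SemiclassicalLattice.Sym h ρ δ (μ - (ρ - δ) * l) (u l) :=
    fun l => (hu l).1.sym P
  have hu0 : SemiclassicalLattice.Sym h ρ δ μ (u 0) := by simpa using hus 0
  have hell0 := hell.leading P hu0 (hu 0).2 hexp
  refine ⟨?_, fun M h0 => ⟨⟨_, SemiclassicalLattice.isParametrixRecursion_parametrixSeq
    (fun l => (hus l).smooth) h0⟩, fun v hv => ?_⟩⟩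
  · obtain ⟨c, hc, M, hM, hb⟩ := hell0
    exact ⟨M, hM, fun m hm θ => norm_pos_iff.1
      ((mul_pos hc (Real.rpow_pos_of_pos (P.wt_pos m) μ)).trans_le (hb m hm θ))⟩
  -- An arbitrary M carries only nonvanishing; ellipticity of the leading symbol upgrades this to a
  -- uniform lower bound, so that 1/u₀ is a symbol.
  · obtain ⟨D, hD, hlow⟩ := hell0.exists_lower_bound hpos hu0.smooth h0
    obtain ⟨τ, hτ, hinv⟩ := SemiclassicalLattice.exists_inverse_symbol P hu0 hD hlow
    have hvs := hv.sym P hus hτ hinv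
    choose Vs hVs using fun j => (hvs j).exists_isOp P
    exact ⟨Vs, fun j => ⟨(hvs j).isSymbol P, hVs j⟩, fun V hV hVU =>
      hVU.hasExpansion P hus (fun l => (hu l).2) hexp h0 hv hvs hVs hV⟩
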